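/- There is a universal constant $C>0$ with the following property. Let $d\ge 2$, $p\in[1,2]$, $1/p+1/q=1$ ($q\in[2,\infty]$), $M,M_2,\varepsilon>0$, $R\ge 0$, and put $\gamma=\varepsilon/(2M_2)$. There are parameters (a number of iterations $N\ge 0$, a batch size $B\ge 1$, weights $a_k>0$, $\beta>0$ and an exponent $r\in(1,2]$), which depend only on $d,p,q,M,M_2,R,\varepsilon$, such that the following holds. Let $Q\subseteq\mathbb{R}^d$ be closed and convex, $x^0\in Q$, and let $Q_\gamma$ be the set of the points at Euclidean distance at most $\gamma$ from $Q$. Let $f$ be convex on $Q_\gamma$ with $|f(y)-f(x)|\le M\|y-x\|_p$ and $|f(y)-f(x)|\le M_2\|y-x\|_2$ for all $x,y\in Q_\gamma$. Suppose that $f$ has a minimizer $x_*$ on $Q$ with $\|x^0-x_*\|_p\sqrt{\min\{q,\ln d\}}\le R$. Run the following batched accelerated stochastic gradient method for the smoothed problem $\min_{x\in Q} f_\gamma(x)$, $f_\gamma(x)=\mathbb{E}_u f(x+\gamma u)$ with $u$ uniform on the unit Euclidean ball. Let $A_k=\sum_{i<k}a_i$, $y_0=x^0$, $G_0=0$, let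 $z_k$ be the minimizer over $x\in Q$ of $\langle G_k,x\rangle+\frac{\beta}{2}\|x-x^0\|_r^2$, and for $k=0,\dots,N-1$ let $$x_{k+1}=\frac{A_ky_k+a_kz_k}{A_{k+1}},\quad g_{k+1}=\frac1B\sum_{j=1}^{B} d\,\frac{f(x_{k+1}+\gamma e_{k,j})-f(x_{k+1}-\gamma e_{k,j})}{2\gamma}\,e_{k,j},\quad G_{k+1}=G_k+a_kg_{k+1},\quad y_{k+1}=\frac{A_ky_k+a_kz_{k+1}}{A_{k+1}},$$ where the $e_{k,j}$ are independent and uniformly distributed on the unit Euclidean sphere. The method uses only values of $f$ (exact zeroth-order oracle), and the $2B$ oracle calls of one iteration can be made in parallel. Its output $y_N$ satisfies $\mathbb{E} f(y_N)-f(x_*)\le\varepsilon$ (the expectation exists). For every realization of the directions it makes at most $$C\,\frac{d^{1/4}\sqrt{MM_2}\,R}{\varepsilon}\ \text{ successive iterations and at most }\ C\,\frac{\min\{q,\ln d\}\,d^{2/q}M_2^2R^2}{\varepsilon^2}\ \text{ zeroth-order oracle calls.}$$ The latter number is also at most $C\,dM_2^2R^2/\varepsilon^2$ if $p=2$, and at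 most $C\,(\ln d)M_2^2R^2/\varepsilon^2$ if $p=1$. -/

import Mathlib

open MeasureTheory
open scoped ENNReal

noncomputable section

/-- The ambient space `ℝ^d` with its Euclidean structure. -/
abbrev Vec (d : ℕ) : Type := EuclideanSpace ℝ (Fin d)

/-- The unit Euclidean sphere of `ℝ^d`. -/
abbrev UnitSphere (d : ℕ) : Type := Metric.sphere (0 : Vec d) 1

/-- The norm `‖x‖_p` on `ℝ^d`, for `p ∈ [1, ∞]`. -/
def pNorm {d : ℕ} (p : ℝ≥0∞) (x : Vec d) : ℝ :=
  ‖WithLp.toLp p (WithLp.ofLp x)‖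

/-- The quantity `min {q, ln d}`; it equals `ln d` for `q = ∞`. -/
def minQLog (q : ℝ≥0∞) (d : ℕ) : ℝ :=
  (min q (ENNReal.ofReal (Real.log d))).toReal

/-- A deterministic method with access to an objective only through a zeroth-order oracle.
Either it stops with an output point, or it sends to the oracle a batch of `m` points,
all chosen before any of the answers is known (so that they may be processed in parallel),
and continues in a way that depends on the `m` returned function values. -/
inductive ZOMethod (d : ℕ) : Type
  | output (x : Vec d) : ZOMethod d
  | query (m : ℕ) (pts : Fin m → Vec d) (next : (Fin m → ℝ) → ZOMethod d) : ZOMethod d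

namespace ZOMethod

/-- The output point when the oracle returns the values of `f`. -/
def run {d : ℕ} (f : Vec d → ℝ) : ZOMethod d → Vec d
  | output x => x
  | query _ pts next => run f (next fun i => f (pts i))

/-- The number of successive iterations (rounds of parallel oracle calls). -/
def iterations {d : ℕ} (f : Vec d → ℝ) : ZOMethod d → ℕ
  | output _ => 0
  | query _ pts next => iterations f (next fun i => f (pts i)) + 1

/-- The total number of zeroth-order oracle calls. -/
def oracleCalls {d : ℕ} (f : Vec d → ℝ) : ZOMethod d → ℕ
  | output _ => 0
  | query m pts next => oracleCalls f (next fun i => f (pts i)) + m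

end ZOMethod

/-- The parameters of the batched accelerated gradient method. -/
structure AGMParams where
  /-- number of iterations -/
  N : ℕ
  /-- batch size -/
  B : ℕ
  /-- the weights `a_k` of the gradients -/
  a : ℕ → ℝ
  /-- weight of the prox-function -/
  β : ℝ
  /-- exponent of the prox-function `x ↦ ‖x - x⁰‖_r² / 2` -/
  r : ℝ≥0∞
  B_pos : 0 < B
  a_pos : ∀ k, 0 < a k
  β_pos : 0 < β
  one_lt_r : 1 < r
  r_le_two : r ≤ 2

namespace AGMParams

/-- `A_k = a_0 + ⋯ + a_{k-1}`. -/
def A (P : AGMParams) (k : ℕ) : ℝ := ∑ i ∈ Finset.range k, P.a i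

/-- The objective `⟨G, x⟩ + β ‖x - x⁰‖_r² / 2` of the prox-step. -/
def proxObjective {d : ℕ} (P : AGMParams) (x₀ G x : Vec d) : ℝ :=
  inner ℝ G x + P.β * (pNorm P.r (x - x₀) ^ 2 / 2)

open scoped Classical in
/-- The prox-step: the minimizer of `⟨G, x⟩ + β ‖x - x⁰‖_r² / 2` over `x ∈ Q`
(it exists and is unique for closed convex nonempty `Q`). -/
def prox {d : ℕ} (P : AGMParams) (Q : Set (Vec d)) (x₀ G : Vec d) : Vec d :=
  if h : ∃ z ∈ Q, IsMinOn (P.proxObjective x₀ G) Q z then h.choose else x₀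

/-- The convex combination `(A_k y + a_k z) / A_{k+1}`. -/
def combine {d : ℕ} (P : AGMParams) (k : ℕ) (y z : Vec d) : Vec d :=
  (P.A (k + 1))⁻¹ • (P.A k • y + P.a k • z)

end AGMParams

/-- The batch average over `j` of `d (v⁺_j - v⁻_j) / (2γ) • e_j`. For `v^±_j = f (x ± γ e_j)` this
is the average of the two-point estimators of the gradient at `x` of
`f_γ (x) = 𝔼_u f (x + γ u)`, `u` uniform on the unit Euclidean ball. -/
def batchGradient {d B : ℕ} (γ : ℝ) (e : Fin B → UnitSphere d) (vplus vminus : Fin B → ℝ) :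
    Vec d :=
  (B : ℝ)⁻¹ • ∑ j, ((d : ℝ) * ((vplus j - vminus j) / (2 * γ))) • (e j : Vec d)

/-- `n` further iterations of the batched accelerated gradient method on `Q`, applied to the smoothed
objective with smoothing parameter `γ`, when `k` iterations have been made, `y` is the current
approximate solution and `G` is the weighted sum of the gradient estimates found so far:
`z_k = prox G_k`, `x_{k+1} = (A_k y_k + a_k z_k) / A_{k+1}`,
`g_{k+1}` = the batch gradient estimate at `x_{k+1}`,
`G_{k+1} = G_k + a_k g_{k+1}`, `z_{k+1} = prox G_{k+1}`,
`y_{k+1} = (A_k y_k + a_k z_{k+1}) / A_{k+1}`. -/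
def fgmLoop {d : ℕ} (P : AGMParams) (γ : ℝ) (Q : Set (Vec d)) (x₀ : Vec d) :
    (n : ℕ) → (Fin n → Fin P.B → UnitSphere d) → (k : ℕ) → (y G : Vec d) → ZOMethod d
  | 0, _, _, y, _ => ZOMethod.output y
  | n + 1, e, k, y, G =>
    let x := P.combine k y (P.prox Q x₀ G)
    ZOMethod.query (P.B + P.B)
      (Fin.append (fun j => x + γ • (e 0 j : Vec d)) (fun j => x - γ • (e 0 j : Vec d)))
      fun v =>
        let g := batchGradient γ (e 0) (fun j => v (Fin.castAdd P.B j)) (fun j => v (Fin.natAdd P.B j))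
        let G' := G + P.a k • g
        fgmLoop P γ Q x₀ n (fun i => e i.succ) (k + 1) (P.combine k y (P.prox Q x₀ G')) G'

/-- The smoothing scheme based on the batched accelerated gradient method: `N` iterations from the
starting point `x₀`, where `e k j` is the `j`-th random direction of iteration `k`. -/
def fgm {d : ℕ} (P : AGMParams) (γ : ℝ) (Q : Set (Vec d)) (x₀ : Vec d)
    (e : Fin P.N → Fin P.B → UnitSphere d) : ZOMethod d :=
  fgmLoop P γ Q x₀ P.N e 0 x₀ 0

/-- The uniform probability measure on the unit Euclidean sphere (normalized surface measure). -/
def uniformSphere (d : ℕ) : Measure (UnitSphere d) :=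
  ((volume : Measure (Vec d)).toSphere Set.univ)⁻¹ • (volume : Measure (Vec d)).toSphere

/-- The law of `N × B` independent uniform directions. -/
def directionLaw (d N B : ℕ) : Measure (Fin N → Fin B → UnitSphere d) :=
  Measure.pi fun _ => Measure.pi fun _ => uniformSphere d

end

/-! ### The `p`-norms -/

section pNorm

variable {d : ℕ} {p r : ℝ≥0∞}

/-! Fix an exponent ρ comparable with κ = min {q, ln d} such that d^(1/ρ - 1/q) ≤ e, and let r ∈ (1,
2] be conjugate to ρ. The whole analysis uses the pair ‖·‖_r, ‖·‖_ρ. The space ℓ_r is 2-uniformly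
convex with constant r - 1 = 1/(ρ - 1) (`pNorm_uniformConvex`), so the prox-function is strongly
convex. The loss of a factor of order ρ is repaid by the factor √κ in the definition of R.

Smoothing. Convexity gives f ≤ f_γ ≤ f + γM₂ on Q, and γM₂ = ε/2 uses half of the accuracy. The mean
of the two-point estimator is a subgradient of f_γ. This follows from a divergence inequality on the
ball (`flux_le_integral_ball`, `inner_sphereGradient_le`), and differentiability of f_γ is never
needed. Since E|⟨e, v⟩| ≤ ‖v‖/√d on the sphere, this subgradient is Lipschitz with a constant of
order √d·M/γ, that is √d·M·M₂/ε.

Noise. Each estimator is d·H(e)·e up to scale, with H odd and Lipschitz. Odd Lipschitz functions on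
the sphere are of size 1/√d with Gaussian tails: the Maurey–Pisier rotation argument proves this for
Gaussian vectors (`integral_exp_sq_stdGaussian_le`), and independence of direction and norm carries
it to the sphere (`integral_exp_sq_uniformSphere_le`). Hence every coordinate of d·H(e)·e has
exponential moments at a scale free of d. Averaging B ≥ ρ copies gives a mean squared ‖·‖_ρ error of
at most a constant times ρ·d^(2/ρ)·M₂²/B (`integral_pNorm_sq_batchGradient_sub_le`).

Method. A potential made of A_k(f_γ(y_k) - f_γ(x_*)) and the gap of the prox objective at x_* grows
in one step only by a mean-zero term and by a_k² times the squared error (`potential_step`,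
`integral_run_fgmLoop_le`). With weights k + 1 this gives N² of order L·R²/ε, where L ~ √d·M·M₂/ε,
and B of order N·W/(L·ε), where W/B is the variance. The product N·B is then of order W·R²/ε²,
independent of L.

Three cases remain for the bounds to hold simultaneously. If R is so small that the starting point
is already accurate, no iteration is made. The accelerated choice also pays ρ calls per iteration
for the minimal batch, which is affordable only if the claimed iteration count is at most
d^(2/q)·M₂²R²/ε². Otherwise constant weights and the minimal batch are used, with the nonsmooth
bound `ballAverage_le_quadratic_add` in place of smoothness; then about d^(2/q)·M₂²R²/ε² iterations
suffice, which is below the claimed count. -/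

theorem one_le_toReal_of_one_le (hp : 1 ≤ p) (hp' : p ≠ ⊤) : 1 ≤ p.toReal := by
  rw [← ENNReal.toReal_one]
  exact ENNReal.toReal_mono hp' hp

theorem pNorm_eq_sum (hp : 1 ≤ p) (hp' : p ≠ ⊤) (x : Vec d) :
    pNorm p x = (∑ i, |x i| ^ p.toReal) ^ (1 / p.toReal) := by
  have := one_le_toReal_of_one_le hp hp'
  rw [pNorm, PiLp.norm_eq_sum (by linarith)]
  rfl

theorem pNorm_nonneg (hp : 1 ≤ p) (x : Vec d) : 0 ≤ pNorm p x := by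
  have : Fact (1 ≤ p) := ⟨hp⟩
  exact norm_nonneg _

theorem pNorm_add_le (hp : 1 ≤ p) (x y : Vec d) : pNorm p (x + y) ≤ pNorm p x + pNorm p y := by
  have : Fact (1 ≤ p) := ⟨hp⟩
  exact norm_add_le (WithLp.toLp p (WithLp.ofLp x)) (WithLp.toLp p (WithLp.ofLp y))

theorem pNorm_smul (hp : 1 ≤ p) (c : ℝ) (x : Vec d) : pNorm p (c • x) = |c| * pNorm p x := by
  have : Fact (1 ≤ p) := ⟨hp⟩
  exact norm_smul c (WithLp.toLp p (WithLp.ofLp x))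

theorem pNorm_neg (hp : 1 ≤ p) (x : Vec d) : pNorm p (-x) = pNorm p x := by
  have : Fact (1 ≤ p) := ⟨hp⟩
  exact norm_neg (WithLp.toLp p (WithLp.ofLp x))

theorem pNorm_sub_comm (hp : 1 ≤ p) (x y : Vec d) : pNorm p (x - y) = pNorm p (y - x) := by
  rw [← neg_sub, pNorm_neg hp]

theorem pNorm_zero (hp : 1 ≤ p) : pNorm p (0 : Vec d) = 0 := by
  have : Fact (1 ≤ p) := ⟨hp⟩
  exact norm_zero

theorem continuous_pNorm (hp : 1 ≤ p) : Continuous (pNorm p : Vec d → ℝ) := by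
  have : Fact (1 ≤ p) := ⟨hp⟩
  unfold pNorm
  fun_prop

theorem pNorm_two (x : Vec d) : pNorm 2 x = ‖x‖ := rfl

theorem pNorm_rpow (hp : 1 ≤ p) (hp' : p ≠ ⊤) (x : Vec d) :
    pNorm p x ^ p.toReal = ∑ i, |x i| ^ p.toReal := by
  have := one_le_toReal_of_one_le hp hp'
  rw [pNorm_eq_sum hp hp', ← Real.rpow_mul (Finset.sum_nonneg fun i _ => by positivity),
    one_div, inv_mul_cancel₀ (by linarith), Real.rpow_one]

/-- Each coordinate is at most S = ‖x‖_p, so |x_i|^r ≤ |x_i|^p · S^(r-p), and summation gives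
‖x‖_r^r ≤ S^r. -/
theorem pNorm_antitone (hp : 1 ≤ p) (hpr : p ≤ r) (hr : r ≠ ⊤) (x : Vec d) :
    pNorm r x ≤ pNorm p x := by
  have hp' : p ≠ ⊤ := ne_top_of_le_ne_top hr hpr
  have h1 := one_le_toReal_of_one_le hp hp'
  have h2 : p.toReal ≤ r.toReal := ENNReal.toReal_mono hr hpr
  set a := p.toReal
  set b := r.toReal
  set S := pNorm p x
  have hS : 0 ≤ S := pNorm_nonneg hp x
  have hi : ∀ i, |x i| ≤ S := by
    intro i
    have : |x i| ^ a ≤ S ^ a := by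
      rw [pNorm_rpow hp hp']
      exact Finset.single_le_sum (f := fun i => |x i| ^ a) (fun i _ => by positivity)
        (Finset.mem_univ i)
    exact (Real.rpow_le_rpow_iff (abs_nonneg _) hS (by linarith)).1 this
  have key : pNorm r x ^ b ≤ S ^ b := by
    rw [pNorm_rpow (hp.trans hpr) hr]
    calc ∑ i, |x i| ^ b ≤ ∑ i, |x i| ^ a * S ^ (b - a) := by
          refine Finset.sum_le_sum fun i _ => ?_
          have : |x i| ^ b = |x i| ^ a * |x i| ^ (b - a) := by
            rw [← Real.rpow_add' (abs_nonneg _) (by linarith)]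
            congr 1; ring
          rw [this]
          exact mul_le_mul_of_nonneg_left
            (Real.rpow_le_rpow (abs_nonneg _) (hi i) (by linarith)) (by positivity)
      _ = S ^ a * S ^ (b - a) := by rw [← Finset.sum_mul, pNorm_rpow hp hp']
      _ = S ^ b := by
          rw [← Real.rpow_add' hS (by linarith)]
          congr 1; ring
  exact (Real.rpow_le_rpow_iff (pNorm_nonneg (hp.trans hpr) x) hS (by linarith)).1 key

/-- The power mean inequality with exponent r/p, applied to the numbers |x_i|^p. -/
theorem pNorm_le_card_rpow_mul (hp : 1 ≤ p) (hpr : p ≤ r) (hr : r ≠ ⊤) (x : Vec d) :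
    pNorm p x ≤ (d : ℝ) ^ (1 / p.toReal - 1 / r.toReal) * pNorm r x := by
  have hp' : p ≠ ⊤ := ne_top_of_le_ne_top hr hpr
  have h1 := one_le_toReal_of_one_le hp hp'
  have h2 : p.toReal ≤ r.toReal := ENNReal.toReal_mono hr hpr
  have ha : 0 < p.toReal := by linarith
  have hb : 0 < r.toReal := by linarith
  have key := Real.rpow_sum_le_const_mul_sum_rpow (Finset.univ : Finset (Fin d))
    (fun i => |x i| ^ p.toReal) (p := r.toReal / p.toReal) (by rw [le_div_iff₀ ha]; linarith)
  have e1 : ∀ i : Fin d, |(|x i| ^ p.toReal)| = |x i| ^ p.toReal :=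
    fun i => abs_of_nonneg (by positivity)
  have e2 : ∀ i : Fin d, (|x i| ^ p.toReal) ^ (r.toReal / p.toReal) = |x i| ^ r.toReal := by
    intro i
    rw [← Real.rpow_mul (abs_nonneg _)]
    congr 1; field_simp
  simp only [e1, e2, Finset.card_univ, Fintype.card_fin] at key
  rw [← pNorm_rpow hp hp', ← pNorm_rpow (hp.trans hpr) hr] at key
  have hn := pNorm_nonneg hp x
  have hn' := pNorm_nonneg (hp.trans hpr) x
  rw [← Real.rpow_mul hn, mul_div_cancel₀ _ ha.ne'] at key
  have hd : (0:ℝ) ≤ d := by positivity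
  refine (Real.rpow_le_rpow_iff hn (by positivity) hb).1 (key.trans (le_of_eq ?_))
  rw [Real.mul_rpow (by positivity) hn', ← Real.rpow_mul hd]
  congr 2
  field_simp

theorem inner_le_pNorm_mul_pNorm {s : ℝ≥0∞} (hr : 1 ≤ r) (hr' : r ≠ ⊤) (hs : 1 ≤ s) (hs' : s ≠ ⊤)
    (h : s.toReal.HolderConjugate r.toReal) (g x : Vec d) :
    inner ℝ g x ≤ pNorm s g * pNorm r x := by
  have := Real.inner_le_Lp_mul_Lq Finset.univ (fun i => g i) (fun i => x i) h
  rw [pNorm_eq_sum hr hr', pNorm_eq_sum hs hs', PiLp.inner_apply]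
  refine le_trans (le_of_eq ?_) this
  refine Finset.sum_congr rfl fun i _ => ?_
  simp [mul_comm]

end pNorm

/-! ### 2-uniform convexity of the `r`-norm, `1 < r ≤ 2` -/

section UniformConvexity

/-- The difference of the two sides vanishes at t = 0, and its derivative is s((1+t)^(s-1) +
(1-t)^(s-1) - 2). This is nonnegative by AM-GM, since the product of the two powers is (1-t²)^(s-1)
≥ 1. -/
theorem two_mul_le_one_add_rpow_sub_one_sub_rpow {s t : ℝ} (hs : 0 < s) (hs1 : s ≤ 1) (ht : 0 ≤ t)
    (ht1 : t ≤ 1) : 2 * s * t ≤ (1 + t) ^ s - (1 - t) ^ s := by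
  have hcont : ContinuousOn (fun t : ℝ => (1 + t) ^ s - (1 - t) ^ s - 2 * s * t) (Set.Icc 0 1) := by
    refine ContinuousOn.sub (ContinuousOn.sub ?_ ?_) (by fun_prop)
    · exact ContinuousOn.rpow_const (by fun_prop) fun x hx => Or.inr hs.le
    · exact ContinuousOn.rpow_const (by fun_prop) fun x hx => Or.inr hs.le
  have hderiv : ∀ x ∈ interior (Set.Icc (0:ℝ) 1),
      HasDerivWithinAt (fun t : ℝ => (1 + t) ^ s - (1 - t) ^ s - 2 * s * t)
        (s * ((1 + x) ^ (s - 1) + (1 - x) ^ (s - 1) - 2)) (interior (Set.Icc (0:ℝ) 1)) x := by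
    intro x hx
    rw [interior_Icc] at hx
    have h1 : HasDerivAt (fun t : ℝ => (1 + t) ^ s) (1 * s * (1 + x) ^ (s - 1)) x :=
      ((hasDerivAt_id x).const_add 1).rpow_const (Or.inl (by simp only [id]; linarith [hx.1]))
    have h2 : HasDerivAt (fun t : ℝ => (1 - t) ^ s) (-1 * s * (1 - x) ^ (s - 1)) x :=
      ((hasDerivAt_id x).const_sub 1).rpow_const (Or.inl (by simp only [id]; linarith [hx.2]))
    have h3 : HasDerivAt (fun t : ℝ => 2 * s * t) (2 * s * 1) x := (hasDerivAt_id x).const_mul _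
    exact ((h1.sub h2).sub h3).hasDerivWithinAt.congr_deriv (by ring)
  have hmono := monotoneOn_of_hasDerivWithinAt_nonneg (convex_Icc (0:ℝ) 1) hcont hderiv (by
    intro x hx
    rw [interior_Icc] at hx
    have hu : 0 < 1 + x := by linarith [hx.1]
    have hv : 0 < 1 - x := by linarith [hx.2]
    have hprod : 1 ≤ (1 + x) ^ (s - 1) * (1 - x) ^ (s - 1) := by
      rw [← Real.mul_rpow hu.le hv.le]
      exact Real.one_le_rpow_of_pos_of_le_one_of_nonpos (by positivity)
        (by nlinarith [sq_nonneg x]) (by linarith)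
    have : 2 ≤ (1 + x) ^ (s - 1) + (1 - x) ^ (s - 1) := by
      have ha : 0 < (1 + x) ^ (s - 1) := by positivity
      have hb : 0 < (1 - x) ^ (s - 1) := by positivity
      nlinarith [sq_nonneg ((1 + x) ^ (s - 1) - (1 - x) ^ (s - 1))]
    exact mul_nonneg hs.le (by linarith))
  have := hmono (Set.left_mem_Icc.2 zero_le_one) ⟨ht, ht1⟩ ht
  simp at this
  linarith

/-- The derivative in t of the difference is r times the gap in the preceding inequality with s = r
- 1. -/
theorem one_add_sq_le_rpow_add_rpow {r t : ℝ} (hr : 1 < r) (hr2 : r ≤ 2) (ht : 0 ≤ t) (ht1 : t ≤ 1) :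
    2 + r * (r - 1) * t ^ 2 ≤ (1 + t) ^ r + (1 - t) ^ r := by
  have hr0 : 0 ≤ r := by linarith
  have hcont : ContinuousOn (fun t : ℝ => (1 + t) ^ r + (1 - t) ^ r - r * (r - 1) * t ^ 2)
      (Set.Icc 0 1) := by
    refine ContinuousOn.sub (ContinuousOn.add ?_ ?_) (by fun_prop)
    · exact ContinuousOn.rpow_const (by fun_prop) fun x hx => Or.inr hr0
    · exact ContinuousOn.rpow_const (by fun_prop) fun x hx => Or.inr hr0
  have hderiv : ∀ x ∈ interior (Set.Icc (0:ℝ) 1),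
      HasDerivWithinAt (fun t : ℝ => (1 + t) ^ r + (1 - t) ^ r - r * (r - 1) * t ^ 2)
        (r * ((1 + x) ^ (r - 1) - (1 - x) ^ (r - 1) - 2 * (r - 1) * x))
        (interior (Set.Icc (0:ℝ) 1)) x := by
    intro x hx
    rw [interior_Icc] at hx
    have h1 : HasDerivAt (fun t : ℝ => (1 + t) ^ r) (1 * r * (1 + x) ^ (r - 1)) x :=
      ((hasDerivAt_id x).const_add 1).rpow_const (Or.inl (by simp only [id]; linarith [hx.1]))
    have h2 : HasDerivAt (fun t : ℝ => (1 - t) ^ r) (-1 * r * (1 - x) ^ (r - 1)) x :=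
      ((hasDerivAt_id x).const_sub 1).rpow_const (Or.inl (by simp only [id]; linarith [hx.2]))
    have h3 : HasDerivAt (fun t : ℝ => r * (r - 1) * t ^ 2) (r * (r - 1) * (2 * x)) x := by
      simpa using (hasDerivAt_pow 2 x).const_mul (r * (r - 1))
    exact ((h1.add h2).sub h3).hasDerivWithinAt.congr_deriv (by ring)
  have hmono := monotoneOn_of_hasDerivWithinAt_nonneg (convex_Icc (0:ℝ) 1) hcont hderiv (by
    intro x hx
    rw [interior_Icc] at hx
    have := two_mul_le_one_add_rpow_sub_one_sub_rpow (s := r - 1) (by linarith) (by linarith)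
      hx.1.le hx.2.le
    exact mul_nonneg hr0 (by linarith))
  have := hmono (Set.left_mem_Icc.2 zero_le_one) ⟨ht, ht1⟩ ht
  simp at this
  linarith

/-- By homogeneity y = x·t with t ∈ [0, 1]. Bernoulli's inequality for the exponent r/2 ≤ 1
linearizes the left side, and the quadratic lower bound for (1+t)^r + (1-t)^r finishes. -/
theorem rpow_le_half_of_abs_le {r x y : ℝ} (hr : 1 < r) (hr2 : r ≤ 2) (hx : 0 ≤ x) (hy : 0 ≤ y)
    (hyx : y ≤ x) :
    (x ^ 2 + (r - 1) * y ^ 2) ^ (r / 2) ≤ (|x + y| ^ r + |x - y| ^ r) / 2 := by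
  rcases hx.eq_or_lt with rfl | hx
  · have : y = 0 := le_antisymm hyx hy
    subst this
    simp [Real.zero_rpow (show r ≠ 0 by linarith), Real.zero_rpow (show r / 2 ≠ 0 by linarith)]
  have hr0 : 0 ≤ r := by linarith
  obtain ⟨t, rfl⟩ : ∃ t, y = x * t := ⟨y / x, by field_simp⟩
  have ht : 0 ≤ t := by
    by_contra h
    nlinarith
  have ht1 : t ≤ 1 := by
    by_contra h
    nlinarith
  have h1 : |x + x * t| ^ r = x ^ r * (1 + t) ^ r := by
    rw [abs_of_nonneg (by positivity), ← Real.mul_rpow hx.le (by positivity)]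
    ring_nf
  have h2 : |x - x * t| ^ r = x ^ r * (1 - t) ^ r := by
    rw [abs_of_nonneg (by nlinarith), ← Real.mul_rpow hx.le (by linarith)]
    ring_nf
  have h3 : (x ^ 2 + (r - 1) * (x * t) ^ 2) ^ (r / 2)
      = x ^ r * (1 + (r - 1) * t ^ 2) ^ (r / 2) := by
    have hp : 0 ≤ 1 + (r - 1) * t ^ 2 := by nlinarith [sq_nonneg t]
    have : x ^ r = (x ^ 2) ^ (r / 2) := by
      rw [← Real.rpow_natCast, ← Real.rpow_mul hx.le]
      congr 1
      push_cast
      ring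
    rw [this, ← Real.mul_rpow (by positivity) hp]
    ring_nf
  rw [h1, h2, h3]
  have h4 : (1 + (r - 1) * t ^ 2) ^ (r / 2) ≤ 1 + r / 2 * ((r - 1) * t ^ 2) :=
    rpow_one_add_le_one_add_mul_self (by nlinarith [sq_nonneg t]) (by linarith) (by linarith)
  have h5 := one_add_sq_le_rpow_add_rpow hr hr2 ht ht1
  have : (1 + (r - 1) * t ^ 2) ^ (r / 2) ≤ ((1 + t) ^ r + (1 - t) ^ r) / 2 := by linarith
  calc x ^ r * (1 + (r - 1) * t ^ 2) ^ (r / 2)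
      ≤ x ^ r * (((1 + t) ^ r + (1 - t) ^ r) / 2) := by gcongr
    _ = _ := by ring

/-- The two-point inequality behind the uniform convexity of `ℓ_r`. -/
theorem two_point_inequality {r : ℝ} (hr : 1 < r) (hr2 : r ≤ 2) (x y : ℝ) :
    (x ^ 2 + (r - 1) * y ^ 2) ^ (r / 2) ≤ (|x + y| ^ r + |x - y| ^ r) / 2 := by
  have habs : |x + y| ^ r + |x - y| ^ r = |(|x| + |y|)| ^ r + |(|x| - |y|)| ^ r := by
    rcases abs_cases x with ⟨h1, _⟩ | ⟨h1, _⟩ <;> rcases abs_cases y with ⟨h2, _⟩ | ⟨h2, _⟩ <;>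
      rw [h1, h2]
    · rw [sub_neg_eq_add, ← sub_eq_add_neg, add_comm]
    · rw [show -x + y = -(x - y) by ring, show -x - y = -(x + y) by ring, abs_neg, abs_neg, add_comm]
    · rw [show -x + -y = -(x + y) by ring, show -x - -y = -(x - y) by ring, abs_neg, abs_neg]
  rw [habs, ← sq_abs x, ← sq_abs y]
  rcases le_total |y| |x| with h | h
  · exact rpow_le_half_of_abs_le hr hr2 (abs_nonneg x) (abs_nonneg y) h
  -- Exchanging the roles of x and y leaves the right side unchanged and can only increase the left
  -- side here, because r - 1 ≤ 1 multiplies the larger square.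
  · have key := rpow_le_half_of_abs_le hr hr2 (abs_nonneg y) (abs_nonneg x) h
    have hsq : |x| ^ 2 ≤ |y| ^ 2 := by gcongr
    rw [add_comm |x| |y|, abs_sub_comm |x| |y|]
    refine le_trans (Real.rpow_le_rpow ?_ ?_ (by linarith)) key
    · nlinarith [sq_nonneg |x|, sq_nonneg |y|]
    · nlinarith

/-- The reverse Minkowski inequality in `ℓ_s`, `s ≤ 1`. -/
theorem reverse_minkowski {ι : Type*} (I : Finset ι) {s : ℝ} (hs : 0 < s) (hs1 : s ≤ 1)
    {u v : ι → ℝ} (hu : ∀ i, 0 ≤ u i) (hv : ∀ i, 0 ≤ v i) {U V : ℝ} (hU : 0 ≤ U) (hV : 0 ≤ V)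
    (hUu : U ^ s = ∑ i ∈ I, u i ^ s) (hVv : V ^ s = ∑ i ∈ I, v i ^ s) :
    (U + V) ^ s ≤ ∑ i ∈ I, (u i + v i) ^ s := by
  rcases hU.eq_or_lt with rfl | hU
  · rw [zero_add, hVv]
    refine Finset.sum_le_sum fun i _ => Real.rpow_le_rpow (hv i) ?_ hs.le
    linarith [hu i]
  rcases hV.eq_or_lt with rfl | hV
  · rw [add_zero, hUu]
    refine Finset.sum_le_sum fun i _ => Real.rpow_le_rpow (hu i) ?_ hs.le
    linarith [hv i]
  have hUV : 0 < U + V := by linarith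
  -- With these weights U/t = V/t' = U + V, so concavity of the power s, applied coordinatewise at
  -- u_i/t and v_i/t', sums to exactly (U + V)^s.
  set t := U / (U + V) with ht
  set t' := V / (U + V) with ht'
  have htt : t + t' = 1 := by rw [ht, ht', ← add_div, div_self hUV.ne']
  have ht0 : 0 < t := by positivity
  have ht0' : 0 < t' := by positivity
  have hi : ∀ i, t * (u i / t) ^ s + t' * (v i / t') ^ s ≤ (u i + v i) ^ s := by
    intro i
    have := (Real.concaveOn_rpow hs.le hs1).2 (x := u i / t) (y := v i / t')
      (div_nonneg (hu i) ht0.le) (div_nonneg (hv i) ht0'.le) ht0.le ht0'.le htt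
    simp only [smul_eq_mul] at this
    rwa [mul_div_cancel₀ _ ht0.ne', mul_div_cancel₀ _ ht0'.ne'] at this
  calc (U + V) ^ s = t * (U / t) ^ s + t' * (V / t') ^ s := by
        have h1 : U / t = U + V := by rw [ht]; field_simp
        have h2 : V / t' = U + V := by rw [ht']; field_simp
        rw [h1, h2, ← add_mul, htt, one_mul]
    _ = ∑ i ∈ I, (t * (u i / t) ^ s + t' * (v i / t') ^ s) := by
        rw [Finset.sum_add_distrib, ← Finset.mul_sum, ← Finset.mul_sum]
        congr 2
        · rw [Real.div_rpow hU.le ht0.le, hUu, Finset.sum_div]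
          exact Finset.sum_congr rfl fun i _ => (Real.div_rpow (hu i) ht0.le s).symm
        · rw [Real.div_rpow hV.le ht0'.le, hVv, Finset.sum_div]
          exact Finset.sum_congr rfl fun i _ => (Real.div_rpow (hv i) ht0'.le s).symm
    _ ≤ _ := Finset.sum_le_sum fun i _ => hi i

theorem sq_rpow_half {a r : ℝ} (ha : 0 ≤ a) : (a ^ 2) ^ (r / 2) = a ^ r := by
  rw [← Real.rpow_natCast, ← Real.rpow_mul ha]
  congr 1
  push_cast
  ring

/-- `ℓ_r` is 2-uniformly convex with the constant `r - 1`, for `1 < r ≤ 2`. -/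
theorem pNorm_uniformConvex {d : ℕ} {r : ℝ≥0∞} (hr : 1 < r) (hr2 : r ≤ 2) (x y : Vec d) :
    pNorm r x ^ 2 + (r.toReal - 1) * pNorm r y ^ 2
      ≤ (pNorm r (x + y) ^ 2 + pNorm r (x - y) ^ 2) / 2 := by
  have hrt : r ≠ ⊤ := ne_top_of_le_ne_top (by simp) hr2
  have h1 : 1 < r.toReal := by
    rw [← ENNReal.toReal_one]
    exact (ENNReal.toReal_lt_toReal (by simp) hrt).2 hr
  have h2 : r.toReal ≤ 2 := by
    have := ENNReal.toReal_mono (by simp) hr2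
    simpa using this
  set s := r.toReal
  have hx := pNorm_nonneg hr.le x
  have hy := pNorm_nonneg hr.le y
  have hp := pNorm_nonneg hr.le (x + y)
  have hm := pNorm_nonneg hr.le (x - y)
  -- All quantities are raised to the power r/2 ≤ 1: reverse Minkowski in ℓ_{r/2} for the vectors
  -- x_i² and (r-1)y_i², then the two-point inequality in each coordinate, then concavity of t ↦
  -- t^(r/2).
  have step1 : (pNorm r x ^ 2 + (s - 1) * pNorm r y ^ 2) ^ (s / 2)
      ≤ ∑ i, (x i ^ 2 + (s - 1) * y i ^ 2) ^ (s / 2) := by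
    refine reverse_minkowski Finset.univ (by linarith) (by linarith) (fun i => sq_nonneg _)
      (fun i => mul_nonneg (by linarith) (sq_nonneg _)) (sq_nonneg _)
      (mul_nonneg (by linarith) (sq_nonneg _)) ?_ ?_
    · rw [sq_rpow_half hx, pNorm_rpow hr.le hrt]
      refine Finset.sum_congr rfl fun i _ => ?_
      rw [← sq_abs, sq_rpow_half (abs_nonneg _)]
    · rw [Real.mul_rpow (by linarith) (sq_nonneg _), sq_rpow_half hy, pNorm_rpow hr.le hrt,
        Finset.mul_sum]
      refine Finset.sum_congr rfl fun i _ => ?_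
      rw [Real.mul_rpow (by linarith) (sq_nonneg _), ← sq_abs, sq_rpow_half (abs_nonneg _)]
  have step2 : ∑ i, (x i ^ 2 + (s - 1) * y i ^ 2) ^ (s / 2)
      ≤ (pNorm r (x + y) ^ s + pNorm r (x - y) ^ s) / 2 := by
    rw [pNorm_rpow hr.le hrt, pNorm_rpow hr.le hrt, ← Finset.sum_add_distrib, Finset.sum_div]
    exact Finset.sum_le_sum fun i _ => two_point_inequality h1 h2 (x i) (y i)
  have step3 : (pNorm r (x + y) ^ s + pNorm r (x - y) ^ s) / 2
      ≤ ((pNorm r (x + y) ^ 2 + pNorm r (x - y) ^ 2) / 2) ^ (s / 2) := by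
    have := (Real.concaveOn_rpow (p := s / 2) (by linarith) (by linarith)).2
      (Set.mem_Ici.2 (sq_nonneg (pNorm r (x + y)))) (Set.mem_Ici.2 (sq_nonneg (pNorm r (x - y))))
      (show (0:ℝ) ≤ 1 / 2 by norm_num) (show (0:ℝ) ≤ 1 / 2 by norm_num) (by norm_num)
    simp only [smul_eq_mul, sq_rpow_half hp, sq_rpow_half hm] at this
    calc _ = 1 / 2 * pNorm r (x + y) ^ s + 1 / 2 * pNorm r (x - y) ^ s := by ring
      _ ≤ _ := this
      _ = _ := by congr 1; ring
  refine (Real.rpow_le_rpow_iff ?_ (by positivity) (by linarith)).1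
    ((step1.trans step2).trans step3)
  have : 0 ≤ (s - 1) * pNorm r y ^ 2 := mul_nonneg (by linarith) (sq_nonneg _)
  positivity

end UniformConvexity

/-! ### The prox-step -/

namespace AGMParams

variable {d : ℕ} (P : AGMParams) {Q : Set (Vec d)} {x₀ : Vec d}

theorem r_ne_top : P.r ≠ ⊤ := ne_top_of_le_ne_top (by simp) P.r_le_two

theorem one_lt_toReal_r : 1 < P.r.toReal := by
  rw [← ENNReal.toReal_one]
  exact (ENNReal.toReal_lt_toReal (by simp) P.r_ne_top).2 P.one_lt_r

/-- The modulus of the quadratic growth of the objective of the prox-step. -/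
noncomputable def growth : ℝ := P.β * (P.r.toReal - 1) / 4

theorem growth_pos : 0 < P.growth := by
  have := P.one_lt_toReal_r
  have := P.β_pos
  unfold growth
  exact div_pos (mul_pos P.β_pos (by linarith)) (by norm_num)

theorem norm_le_pNorm_r (x : Vec d) : ‖x‖ ≤ pNorm P.r x := by
  rw [← pNorm_two]
  exact pNorm_antitone P.one_lt_r.le P.r_le_two (by simp) x

theorem proxObjective_midpoint (x₀ G w z : Vec d) :
    P.proxObjective x₀ G ((1 / 2 : ℝ) • w + (1 / 2 : ℝ) • z)
      ≤ (P.proxObjective x₀ G w + P.proxObjective x₀ G z) / 2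
        - P.growth / 2 * pNorm P.r (w - z) ^ 2 := by
  have huc := pNorm_uniformConvex P.one_lt_r P.r_le_two
    ((1 / 2 : ℝ) • w + (1 / 2 : ℝ) • z - x₀) ((1 / 2 : ℝ) • (w - z))
  have e1 : (1 / 2 : ℝ) • w + (1 / 2 : ℝ) • z - x₀ + (1 / 2 : ℝ) • (w - z) = w - x₀ := by module
  have e2 : (1 / 2 : ℝ) • w + (1 / 2 : ℝ) • z - x₀ - (1 / 2 : ℝ) • (w - z) = z - x₀ := by module
  rw [e1, e2, pNorm_smul P.one_lt_r.le, abs_of_nonneg (by norm_num)] at huc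
  unfold proxObjective growth
  rw [inner_add_right, inner_smul_right, inner_smul_right]
  have := mul_le_mul_of_nonneg_left huc P.β_pos.le
  nlinarith

/-- The minimizer is compared with the midpoint of w and z. This loses a factor two against the
sharp strong convexity constant β(r-1)/2, hence the 4 in `growth`. -/
theorem proxObjective_growth (hQ : Convex ℝ Q) {G z w : Vec d} (hz : z ∈ Q)
    (hmin : IsMinOn (P.proxObjective x₀ G) Q z) (hw : w ∈ Q) :
    P.proxObjective x₀ G z + P.growth * pNorm P.r (w - z) ^ 2 ≤ P.proxObjective x₀ G w := by
  have hmem : (1 / 2 : ℝ) • w + (1 / 2 : ℝ) • z ∈ Q :=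
    hQ hw hz (by norm_num) (by norm_num) (by norm_num)
  have h1 := isMinOn_iff.1 hmin _ hmem
  have h2 := P.proxObjective_midpoint x₀ G w z
  linarith

theorem continuous_proxObjective (x₀ G : Vec d) : Continuous (P.proxObjective x₀ G) := by
  unfold proxObjective
  have := continuous_pNorm (d := d) P.one_lt_r.le
  fun_prop

/-- Coercivity: outside the Euclidean ball of radius 2‖G‖/β the quadratic term, at least β‖x -
x⁰‖₂²/2 because r ≤ 2, dominates the linear one, so a minimizer over a compact set suffices. -/
theorem exists_isMinOn_proxObjective (hQ : IsClosed Q) (hx₀ : x₀ ∈ Q) (G : Vec d) :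
    ∃ z ∈ Q, IsMinOn (P.proxObjective x₀ G) Q z := by
  have hβ := P.β_pos
  set ρ := 2 * ‖G‖ / P.β with hρ
  have hcpt : IsCompact (Q ∩ Metric.closedBall x₀ ρ) :=
    (isCompact_closedBall x₀ ρ).inter_left hQ
  have hρ0 : 0 ≤ ρ := by positivity
  obtain ⟨z, hz, hmin⟩ := hcpt.exists_isMinOn ⟨x₀, hx₀, Metric.mem_closedBall_self hρ0⟩
    (P.continuous_proxObjective x₀ G).continuousOn
  refine ⟨z, hz.1, isMinOn_iff.2 fun w hw => ?_⟩
  by_cases hwb : w ∈ Metric.closedBall x₀ ρ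
  · exact isMinOn_iff.1 hmin w ⟨hw, hwb⟩
  · refine (isMinOn_iff.1 hmin x₀ ⟨hx₀, Metric.mem_closedBall_self hρ0⟩).trans ?_
    rw [Metric.mem_closedBall, not_le, dist_eq_norm] at hwb
    unfold proxObjective
    rw [sub_self, pNorm_zero P.one_lt_r.le]
    have h1 := P.norm_le_pNorm_r (w - x₀)
    have h2 : ‖w - x₀‖ ^ 2 ≤ pNorm P.r (w - x₀) ^ 2 := by gcongr
    have h3 : -(‖G‖ * ‖w - x₀‖) ≤ inner ℝ G (w - x₀) := (abs_le.1 (abs_real_inner_le_norm _ _)).1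
    have h4 : 2 * ‖G‖ ≤ ‖w - x₀‖ * P.β := by
      rw [hρ, div_lt_iff₀ hβ] at hwb
      exact hwb.le
    rw [inner_sub_right] at h3
    nlinarith [norm_nonneg (w - x₀), mul_le_mul_of_nonneg_left h4 (norm_nonneg (w - x₀)),
      mul_le_mul_of_nonneg_left h2 hβ.le]

theorem prox_mem (hQ : IsClosed Q) (hx₀ : x₀ ∈ Q) (G : Vec d) : P.prox Q x₀ G ∈ Q := by
  have h := P.exists_isMinOn_proxObjective hQ hx₀ G
  rw [prox, dif_pos h]
  exact h.choose_spec.1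

theorem prox_isMinOn (hQ : IsClosed Q) (hx₀ : x₀ ∈ Q) (G : Vec d) :
    IsMinOn (P.proxObjective x₀ G) Q (P.prox Q x₀ G) := by
  have h := P.exists_isMinOn_proxObjective hQ hx₀ G
  rw [prox, dif_pos h]
  exact h.choose_spec.2

theorem prox_growth (hQ : IsClosed Q) (hQc : Convex ℝ Q) (hx₀ : x₀ ∈ Q) (G : Vec d) {w : Vec d}
    (hw : w ∈ Q) :
    P.proxObjective x₀ G (P.prox Q x₀ G) + P.growth * pNorm P.r (w - P.prox Q x₀ G) ^ 2
      ≤ P.proxObjective x₀ G w :=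
  P.proxObjective_growth hQc (P.prox_mem hQ hx₀ G) (P.prox_isMinOn hQ hx₀ G) hw

/-- Adding the growth inequalities at the two minimizers gives 2·growth·‖z - z'‖² ≤ ⟨G - G', z' -
z⟩. Continuity of the prox-step makes the output a continuous function of the directions, which
range over a compact space, so all expectations exist. -/
theorem continuous_prox (hQ : IsClosed Q) (hQc : Convex ℝ Q) (hx₀ : x₀ ∈ Q) :
    Continuous (P.prox Q x₀) := by
  have hg := P.growth_pos
  refine LipschitzWith.continuous (K := Real.toNNReal (1 / (2 * P.growth)))
    (LipschitzWith.of_dist_le_mul fun G G' => ?_)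
  rw [Real.coe_toNNReal _ (by positivity), dist_eq_norm, dist_eq_norm]
  set z := P.prox Q x₀ G with hz
  set z' := P.prox Q x₀ G' with hz'
  have h1 := P.prox_growth hQ hQc hx₀ G (P.prox_mem hQ hx₀ G')
  have h2 := P.prox_growth hQ hQc hx₀ G' (P.prox_mem hQ hx₀ G)
  rw [← hz, ← hz', pNorm_sub_comm P.one_lt_r.le] at h1
  rw [← hz, ← hz'] at h2
  have h3 := P.norm_le_pNorm_r (z - z')
  have h4 : ‖z - z'‖ ^ 2 ≤ pNorm P.r (z - z') ^ 2 := by gcongr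
  have h5 : inner ℝ (G - G') (z' - z) ≤ ‖G - G'‖ * ‖z - z'‖ := by
    rw [norm_sub_rev z z']
    exact real_inner_le_norm _ _
  unfold proxObjective at h1 h2
  rw [inner_sub_left, inner_sub_right, inner_sub_right] at h5
  have h6 : 2 * P.growth * ‖z - z'‖ * ‖z - z'‖ ≤ ‖G - G'‖ * ‖z - z'‖ := by nlinarith
  rcases (norm_nonneg (z - z')).eq_or_lt with h0 | h0
  · rw [← h0]
    positivity
  · have := le_of_mul_le_mul_right h6 h0
    rw [div_mul_eq_mul_div, one_mul, le_div_iff₀ (by positivity)]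
    linarith

end AGMParams

/-! ### The uniform measure on the sphere and polar coordinates -/

section Polar

variable {d : ℕ}

theorem integral_uniformSphere (φ : UnitSphere d → ℝ) :
    ∫ e, φ e ∂uniformSphere d = ((volume : Measure (Vec d)).toSphere.real Set.univ)⁻¹ *
      ∫ e, φ e ∂(volume : Measure (Vec d)).toSphere := by
  rw [uniformSphere, integral_smul_measure, smul_eq_mul, ENNReal.toReal_inv]
  rfl

variable [NeZero d]

theorem toSphere_real_univ_pos :
    0 < (volume : Measure (Vec d)).toSphere.real Set.univ := by
  rw [Measure.toSphere_real_apply_univ]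
  have h1 : 0 < (volume : Measure (Vec d)).real (Metric.ball 0 1) :=
    ENNReal.toReal_pos (Metric.measure_ball_pos _ _ one_pos).ne' measure_ball_lt_top.ne
  have h2 : 0 < Module.finrank ℝ (Vec d) := Module.finrank_pos
  positivity

instance : IsProbabilityMeasure (uniformSphere d) := by
  refine ⟨?_⟩
  have h := toSphere_real_univ_pos (d := d)
  rw [uniformSphere, Measure.smul_apply, smul_eq_mul]
  refine ENNReal.inv_mul_cancel ?_ (measure_ne_top _ _)
  intro h0
  rw [Measure.real, h0] at h
  simp at h

/-- In polar coordinates Lebesgue measure is the product of surface measure and a radial measure;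
the factor k can carry any radial density. -/
theorem integral_polar (φ : Vec d → ℝ) (k : ℝ → ℝ) :
    ∫ x : Vec d, φ (‖x‖⁻¹ • x) * k ‖x‖ =
      (∫ e : UnitSphere d, φ e ∂(volume : Measure (Vec d)).toSphere) *
        ∫ r : Set.Ioi (0 : ℝ), k r ∂(Measure.volumeIoiPow (Module.finrank ℝ (Vec d) - 1)) := by
  calc ∫ x : Vec d, φ (‖x‖⁻¹ • x) * k ‖x‖
      = ∫ x : ({(0 : Vec d)}ᶜ : Set (Vec d)), φ (‖x.1‖⁻¹ • x.1) * k ‖x.1‖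
          ∂((volume : Measure (Vec d)).comap (↑)) := by
        rw [integral_subtype_comap (measurableSet_singleton _).compl
          fun x : Vec d => φ (‖x‖⁻¹ • x) * k ‖x‖, restrict_compl_singleton]
    _ = ∫ z : UnitSphere d × Set.Ioi (0 : ℝ), φ z.1 * k z.2
          ∂((volume : Measure (Vec d)).toSphere.prod
            (Measure.volumeIoiPow (Module.finrank ℝ (Vec d) - 1))) := by
        simpa using (volume : Measure (Vec d)).measurePreserving_homeomorphUnitSphereProd.integral_comp
          (Homeomorph.measurableEmbedding _)
          (fun z : UnitSphere d × Set.Ioi (0 : ℝ) => φ z.1 * k z.2)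
    _ = _ := integral_prod_mul (fun e : UnitSphere d => φ e) (fun r : Set.Ioi (0 : ℝ) => k r)

/-- The direction `x / ‖x‖` is uniformly distributed and independent of `‖x‖` under every
rotation invariant density. -/
theorem integral_direction_mul_norm (φ : Vec d → ℝ) (k : ℝ → ℝ) :
    ∫ x : Vec d, φ (‖x‖⁻¹ • x) * k ‖x‖ =
      (∫ e : UnitSphere d, φ e ∂uniformSphere d) * ∫ x : Vec d, k ‖x‖ := by
  have h1 := integral_polar (d := d) (fun _ => 1) k
  simp only [one_mul, integral_const, smul_eq_mul, mul_one] at h1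
  rw [integral_polar, h1, integral_uniformSphere]
  have := (toSphere_real_univ_pos (d := d)).ne'
  field_simp

end Polar

/-! ### A divergence inequality for convex functions on the ball -/

section Divergence

variable {d : ℕ}

theorem lineDeriv_le_of_convexOn {F : Vec d → ℝ} (hF : ConvexOn ℝ Set.univ F) {u v : Vec d}
    (h : LineDifferentiableAt ℝ F u v) : lineDeriv ℝ F u v ≤ F (u + v) - F u := by
  have hc : ConvexOn ℝ Set.univ (fun t : ℝ => F (u + t • v)) := by
    refine ⟨convex_univ, fun s _ t _ a b ha hb hab => ?_⟩
    have := hF.2 (Set.mem_univ (u + s • v)) (Set.mem_univ (u + t • v)) ha hb hab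
    have e : u + (a * s + b * t) • v = a • (u + s • v) + b • (u + t • v) := by
      calc u + (a * s + b * t) • v = (a + b) • u + (a * s + b * t) • v := by rw [hab, one_smul]
        _ = _ := by module
    simpa only [smul_eq_mul, e] using this
  have h2 := hc.le_slope_of_hasDerivAt (Set.mem_univ 0) (Set.mem_univ 1) one_pos h.hasLineDerivAt
  simpa [slope_def_field] using h2

/-- The radial cutoff: `1` for `‖x‖ ≤ 1 - δ`, `0` for `‖x‖ ≥ 1`, linear in between. -/
noncomputable def radialCutoff (d : ℕ) (δ : ℝ) (x : Vec d) : ℝ := max 0 (min 1 ((1 - ‖x‖) / δ))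

variable {δ : ℝ}

theorem radialCutoff_nonneg (x : Vec d) : 0 ≤ radialCutoff d δ x := le_max_left _ _

theorem radialCutoff_le_one (x : Vec d) : radialCutoff d δ x ≤ 1 :=
  max_le zero_le_one (min_le_left _ _)

theorem radialCutoff_eq_one (hδ : 0 < δ) {x : Vec d} (hx : ‖x‖ ≤ 1 - δ) :
    radialCutoff d δ x = 1 := by
  unfold radialCutoff
  rw [min_eq_left, max_eq_right zero_le_one]
  rw [le_div_iff₀ hδ]; linarith

theorem radialCutoff_eq_zero (hδ : 0 < δ) {x : Vec d} (hx : 1 ≤ ‖x‖) :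
    radialCutoff d δ x = 0 := by
  unfold radialCutoff
  rw [max_eq_left]
  exact (min_le_right _ _).trans (div_nonpos_of_nonpos_of_nonneg (by linarith) hδ.le)

theorem radialCutoff_eq (hδ : 0 < δ) {x : Vec d} (hx : 1 - δ ≤ ‖x‖) (hx1 : ‖x‖ ≤ 1) :
    radialCutoff d δ x = (1 - ‖x‖) / δ := by
  unfold radialCutoff
  rw [min_eq_right, max_eq_right]
  · exact div_nonneg (by linarith) hδ.le
  · rw [div_le_one hδ]; linarith

theorem lipschitzWith_radialCutoff (hδ : 0 < δ) :
    LipschitzWith (Real.toNNReal (1 / δ)) (radialCutoff d δ) := by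
  have h : LipschitzWith (Real.toNNReal (1 / δ)) (fun x : Vec d => (1 - ‖x‖) / δ) := by
    refine LipschitzWith.of_dist_le_mul fun x y => ?_
    rw [Real.coe_toNNReal _ (by positivity), Real.dist_eq, dist_eq_norm, ← sub_div, abs_div,
      abs_of_pos hδ, div_eq_mul_one_div, mul_comm]
    gcongr
    rw [sub_sub_sub_cancel_left, norm_sub_rev]
    exact abs_norm_sub_norm_le y x
  exact (h.const_min 1).const_max 0

theorem hasCompactSupport_radialCutoff (hδ : 0 < δ) : HasCompactSupport (radialCutoff d δ) := by
  refine HasCompactSupport.intro (isCompact_closedBall (0 : Vec d) 1) fun x hx => ?_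
  rw [Metric.mem_closedBall, dist_zero_right, not_le] at hx
  exact radialCutoff_eq_zero hδ hx.le

/-- The shell `1 - δ < ‖x‖ < 1`. -/
def shell (d : ℕ) (δ : ℝ) : Set (Vec d) := {x | 1 - δ < ‖x‖ ∧ ‖x‖ < 1}

theorem measurableSet_shell : MeasurableSet (shell d δ) := by
  unfold shell
  measurability

theorem shell_subset_ball : shell d δ ⊆ Metric.ball 0 1 := fun x hx => by simpa using hx.2

theorem volume_real_shell (hδ : 0 < δ) (hδ1 : δ < 1) :
    (volume : Measure (Vec d)).real (shell d δ)
      = (1 - (1 - δ) ^ d) * (volume : Measure (Vec d)).real (Metric.ball 0 1) := by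
  have hV : shell d δ = Metric.ball 0 1 \ Metric.closedBall 0 (1 - δ) := by
    ext x
    simp [shell, and_comm]
  have hsub : Metric.closedBall (0 : Vec d) (1 - δ) ⊆ Metric.ball 0 1 :=
    Metric.closedBall_subset_ball (by linarith)
  rw [hV, measureReal_sdiff hsub measurableSet_closedBall measure_ball_lt_top.ne]
  have : (volume : Measure (Vec d)).real (Metric.closedBall 0 (1 - δ))
      = (1 - δ) ^ d * (volume : Measure (Vec d)).real (Metric.ball 0 1) := by
    rw [Measure.real, Measure.addHaar_closedBall _ _ (by linarith), ENNReal.toReal_mul,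
      ENNReal.toReal_ofReal (pow_nonneg (by linarith) _), finrank_euclideanSpace_fin]
    rfl
  rw [this]
  ring

variable [NeZero d]

/-- The direction -v is the one that integration by parts produces. The two spheres where the cutoff
has a kink are null sets. -/
theorem lineDeriv_radialCutoff_ae (hδ : 0 < δ) (hδ1 : δ < 1) (v : Vec d) :
    ∀ᵐ x : Vec d, lineDeriv ℝ (radialCutoff d δ) x (-v)
      = (shell d δ).indicator (fun x => δ⁻¹ * inner ℝ (‖x‖⁻¹ • x) v) x := by
  have h1 : ∀ᵐ x : Vec d, x ∉ Metric.sphere (0 : Vec d) 1 :=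
    compl_mem_ae_iff.2 (Measure.addHaar_sphere _ _ _)
  have h2 : ∀ᵐ x : Vec d, x ∉ Metric.sphere (0 : Vec d) (1 - δ) :=
    compl_mem_ae_iff.2 (Measure.addHaar_sphere _ _ _)
  filter_upwards [h1, h2] with x hx1 hx2
  rw [mem_sphere_zero_iff_norm] at hx1 hx2
  have hcn : ContinuousAt (fun y : Vec d => ‖y‖) x := continuous_norm.continuousAt
  rcases lt_or_gt_of_ne hx1 with hx1 | hx1
  · rcases lt_or_gt_of_ne hx2 with hx2 | hx2
    · rw [Set.indicator_of_notMem (fun h => by have := h.1; linarith)]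
      have : radialCutoff d δ =ᶠ[nhds x] fun _ => 1 := by
        filter_upwards [hcn.eventually (gt_mem_nhds hx2)] with y hy
        exact radialCutoff_eq_one hδ hy.le
      have hd : HasFDerivAt (radialCutoff d δ) (0 : Vec d →L[ℝ] ℝ) x :=
        (hasFDerivAt_const (1:ℝ) x).congr_of_eventuallyEq this
      rw [(hd.hasLineDerivAt (-v)).lineDeriv]
      simp
    · rw [Set.indicator_of_mem (show x ∈ shell d δ from ⟨hx2, hx1⟩)]
      have : radialCutoff d δ =ᶠ[nhds x] fun y => (1 - ‖y‖) / δ := by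
        filter_upwards [hcn.eventually (gt_mem_nhds hx1), hcn.eventually (lt_mem_nhds hx2)]
          with y hy hy'
        exact radialCutoff_eq hδ hy'.le hy.le
      have hx0 : x ≠ 0 := by
        intro h
        rw [h, norm_zero] at hx2
        linarith
      have hd : HasFDerivAt (fun y : Vec d => ‖y‖) (‖x‖⁻¹ • innerSL ℝ x) x := by
        have h := (hasStrictFDerivAt_norm_sq x).hasFDerivAt.sqrt
          (by simpa using hx0)
        simp only [Real.sqrt_sq (norm_nonneg _)] at h
        refine h.congr_fderiv ?_
        ext w
        simp only [_root_.smul_apply, innerSL_apply_apply, smul_eq_mul, nsmul_eq_mul,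
          one_div, mul_inv]
        push_cast
        ring
      have hd2 : HasFDerivAt (radialCutoff d δ) (δ⁻¹ • -(‖x‖⁻¹ • innerSL ℝ x)) x := by
        refine HasFDerivAt.congr_of_eventuallyEq ?_ this
        have := (hd.const_sub 1).const_mul δ⁻¹
        simpa [div_eq_inv_mul] using this
      rw [(hd2.hasLineDerivAt (-v)).lineDeriv]
      simp [inner_smul_left]
  · rw [Set.indicator_of_notMem (fun h => by have := h.2; linarith)]
    have : radialCutoff d δ =ᶠ[nhds x] fun _ => 0 := by
      filter_upwards [hcn.eventually (lt_mem_nhds hx1)] with y hy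
      exact radialCutoff_eq_zero hδ hy.le
    have hd : HasFDerivAt (radialCutoff d δ) (0 : Vec d →L[ℝ] ℝ) x :=
      (hasFDerivAt_const (0:ℝ) x).congr_of_eventuallyEq this
    rw [(hd.hasLineDerivAt (-v)).lineDeriv]
    simp

theorem integral_shell_direction (φ : Vec d → ℝ) :
    ∫ x in shell d δ, φ (‖x‖⁻¹ • x) =
      (∫ e : UnitSphere d, φ e ∂uniformSphere d) * volume.real (shell d δ) := by
  have h1 := integral_direction_mul_norm (d := d) φ ((Set.Ioo (1 - δ) 1).indicator 1)
  have h2 : ∀ x : Vec d, φ (‖x‖⁻¹ • x) * (Set.Ioo (1 - δ) 1).indicator 1 ‖x‖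
      = (shell d δ).indicator (fun x => φ (‖x‖⁻¹ • x)) x := by
    intro x
    by_cases hx : x ∈ shell d δ
    · rw [Set.indicator_of_mem hx, Set.indicator_of_mem (show ‖x‖ ∈ Set.Ioo (1 - δ) 1 from hx)]
      simp
    · rw [Set.indicator_of_notMem hx, Set.indicator_of_notMem (show ‖x‖ ∉ Set.Ioo (1 - δ) 1 from hx)]
      simp
  have h3 : ∀ x : Vec d, (Set.Ioo (1 - δ) 1).indicator (1 : ℝ → ℝ) ‖x‖
      = (shell d δ).indicator 1 x := by
    intro x
    by_cases hx : x ∈ shell d δ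
    · rw [Set.indicator_of_mem hx, Set.indicator_of_mem (show ‖x‖ ∈ Set.Ioo (1 - δ) 1 from hx)]
      simp
    · rw [Set.indicator_of_notMem hx, Set.indicator_of_notMem (show ‖x‖ ∉ Set.Ioo (1 - δ) 1 from hx)]
  rw [integral_congr_ae (.of_forall h2), integral_congr_ae (.of_forall h3),
    integral_indicator measurableSet_shell] at h1
  rw [h1, integral_indicator_one measurableSet_shell]

/-- A divergence theorem for convex functions on the unit ball: the average of `∂_v F` over the
ball, which is at most that of `F (· + v) - F`, is a flux through the sphere. -/
theorem flux_le_integral_ball {F : Vec d → ℝ} (hF : ConvexOn ℝ Set.univ F) {K : NNReal}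
    (hK : LipschitzWith K F) (v : Vec d) :
    d * (∫ e : UnitSphere d, inner ℝ (e : Vec d) v * F e ∂uniformSphere d) *
        (volume : Measure (Vec d)).real (Metric.ball 0 1)
      ≤ ∫ u in Metric.ball (0 : Vec d) 1, (F (u + v) - F u) := by
  set I := ∫ e : UnitSphere d, inner ℝ (e : Vec d) v * F e ∂uniformSphere d with hI
  set W := (volume : Measure (Vec d)).real (Metric.ball 0 1) with hW
  have hFc := hK.continuous
  have hdiff : ∀ u, |F (u + v) - F u| ≤ K * ‖v‖ := by
    intro u
    have := hK.dist_le_mul (u + v) u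
    rwa [Real.dist_eq, dist_eq_norm, add_sub_cancel_left] at this
  -- The error term is twice K‖v‖ times the volume of the shell: once for removing the cutoff on the
  -- right, once for replacing F(u) by F(u/‖u‖) in the shell.
  have main : ∀ δ : ℝ, 0 < δ → δ < 1 →
      δ⁻¹ * (I * volume.real (shell d δ)) - 2 * (K * ‖v‖) * volume.real (shell d δ)
        ≤ ∫ u in Metric.ball (0 : Vec d) 1, (F (u + v) - F u) := by
    intro δ hδ hδ1
    have hχL := lipschitzWith_radialCutoff (d := d) hδ
    have hχc := hχL.continuous
    have hχs := hasCompactSupport_radialCutoff (d := d) hδ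
    have hshell : volume (shell d δ) ≠ ⊤ :=
      (measure_mono shell_subset_ball |>.trans_lt measure_ball_lt_top).ne
    have hfin : IntegrableOn (fun _ : Vec d => (1:ℝ)) (shell d δ) :=
      integrableOn_const hshell
    -- the cutoff is removed
    have stepA : ∫ u, (F (u + v) - F u) * radialCutoff d δ u
        ≤ (∫ u in Metric.ball (0 : Vec d) 1, (F (u + v) - F u))
          + K * ‖v‖ * volume.real (shell d δ) := by
      have e1 : K * ‖v‖ * volume.real (shell d δ)
          = ∫ u, (shell d δ).indicator (fun _ => K * ‖v‖) u := by
        rw [integral_indicator measurableSet_shell, setIntegral_const, smul_eq_mul, mul_comm]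
      have i1 : IntegrableOn (fun u : Vec d => F (u + v) - F u) (Metric.ball 0 1) :=
        (Continuous.continuousOn (by fun_prop)).integrableOn_compact (isCompact_closedBall _ _)
          |>.mono_set Metric.ball_subset_closedBall
      rw [e1, ← integral_indicator measurableSet_ball, ← integral_add]
      · refine integral_mono ?_ ?_ fun u => ?_
        · exact (Continuous.mul (by fun_prop) hχc).integrable_of_hasCompactSupport hχs.mul_left
        · exact ((integrable_indicator_iff measurableSet_ball).2 i1).add
            ((integrable_indicator_iff measurableSet_shell).2 (integrableOn_const hshell))
        · have hD := abs_le.1 (hdiff u)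
          rcases le_or_gt 1 ‖u‖ with h1 | h1
          · rw [Set.indicator_of_notMem (by simpa using h1),
              Set.indicator_of_notMem (fun h => by have := h.2; linarith)]
            simp [radialCutoff_eq_zero hδ h1]
          · rw [Set.indicator_of_mem (by simpa using h1)]
            rcases le_or_gt ‖u‖ (1 - δ) with h2 | h2
            · rw [Set.indicator_of_notMem (fun h => by have := h.1; linarith)]
              simp [radialCutoff_eq_one hδ h2]
            · rw [Set.indicator_of_mem (show u ∈ shell d δ from ⟨h2, h1⟩)]
              have h3 := radialCutoff_nonneg (d := d) (δ := δ) u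
              have h4 := radialCutoff_le_one (d := d) (δ := δ) u
              nlinarith
      · exact (integrable_indicator_iff measurableSet_ball).2 i1
      · exact (integrable_indicator_iff measurableSet_shell).2 (integrableOn_const hshell)
    -- Convexity enters only here: where F has a derivative along v, that is almost everywhere, it
    -- is at most F(u + v) - F(u).
    have stepB : ∫ u, lineDeriv ℝ F u v * radialCutoff d δ u
        ≤ ∫ u, (F (u + v) - F u) * radialCutoff d δ u := by
      refine integral_mono_ae ?_ ?_ ?_
      · exact (hχc.integrable_of_hasCompactSupport hχs).mul_of_top_right (hK.memLp_lineDeriv v)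
      · exact (Continuous.mul (by fun_prop) hχc).integrable_of_hasCompactSupport hχs.mul_left
      · filter_upwards [hK.ae_lineDifferentiableAt v] with u hu
        exact mul_le_mul_of_nonneg_right (lineDeriv_le_of_convexOn hF hu) (radialCutoff_nonneg u)
    -- Integration by parts moves the derivative to the cutoff, where it is a radial flux density of
    -- size 1/δ on the shell.
    have stepC : ∫ u, lineDeriv ℝ F u v * radialCutoff d δ u
        = ∫ u in shell d δ, δ⁻¹ * inner ℝ (‖u‖⁻¹ • u) v * F u := by
      rw [LipschitzWith.integral_lineDeriv_mul_eq hK hχL hχs, ← integral_indicator measurableSet_shell]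
      refine integral_congr_ae ?_
      filter_upwards [lineDeriv_radialCutoff_ae hδ hδ1 v] with u hu
      rw [hu]
      by_cases h : u ∈ shell d δ
      · rw [Set.indicator_of_mem h, Set.indicator_of_mem h]
      · rw [Set.indicator_of_notMem h, Set.indicator_of_notMem h, zero_mul]
    obtain ⟨C, hC⟩ : ∃ C, ∀ u ∈ Metric.closedBall (0 : Vec d) 1, ‖F u‖ ≤ C :=
      (isCompact_closedBall _ _).exists_bound_of_continuousOn hFc.continuousOn
    have hunit : ∀ u ∈ shell d δ, ‖‖u‖⁻¹ • u‖ = 1 := by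
      intro u hu
      have : 0 < ‖u‖ := by linarith [hu.1]
      rw [norm_smul, norm_inv, norm_norm, inv_mul_cancel₀ this.ne']
    have hinner : ∀ u ∈ shell d δ, |inner ℝ (‖u‖⁻¹ • u) v| ≤ ‖v‖ := by
      intro u hu
      refine (abs_real_inner_le_norm _ _).trans ?_
      rw [hunit u hu, one_mul]
    have hmeas : Measurable fun u : Vec d => ‖u‖⁻¹ • u := by fun_prop
    have int1 : IntegrableOn (fun u : Vec d => inner ℝ (‖u‖⁻¹ • u) v * F u) (shell d δ) := by
      refine Measure.integrableOn_of_bounded (M := ‖v‖ * C) hshell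
        (Measurable.aestronglyMeasurable (by fun_prop)) ?_
      refine (ae_restrict_iff' measurableSet_shell).2 (.of_forall fun u hu => ?_)
      rw [norm_mul]
      exact mul_le_mul (hinner u hu) (hC u (by simpa using hu.2.le)) (norm_nonneg _) (norm_nonneg _)
    have int2 : IntegrableOn (fun u : Vec d => inner ℝ (‖u‖⁻¹ • u) v * F (‖u‖⁻¹ • u))
        (shell d δ) := by
      refine Measure.integrableOn_of_bounded (M := ‖v‖ * C) hshell
        (Measurable.aestronglyMeasurable (by fun_prop)) ?_
      refine (ae_restrict_iff' measurableSet_shell).2 (.of_forall fun u hu => ?_)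
      rw [norm_mul]
      exact mul_le_mul (hinner u hu) (hC _ (by simpa using (hunit u hu).le))
        (norm_nonneg _) (norm_nonneg _)
    have stepD : δ⁻¹ * (I * volume.real (shell d δ)) - K * ‖v‖ * volume.real (shell d δ)
        ≤ ∫ u in shell d δ, δ⁻¹ * inner ℝ (‖u‖⁻¹ • u) v * F u := by
      have e1 : δ⁻¹ * (I * volume.real (shell d δ)) - K * ‖v‖ * volume.real (shell d δ)
          = ∫ u in shell d δ, (δ⁻¹ * (inner ℝ (‖u‖⁻¹ • u) v * F (‖u‖⁻¹ • u)) - K * ‖v‖) := by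
        rw [integral_sub (int2.const_mul _) (integrableOn_const hshell), integral_const_mul,
          integral_shell_direction (fun w => inner ℝ w v * F w), setIntegral_const, smul_eq_mul,
          mul_comm (K * ‖v‖)]
      rw [e1]
      simp only [mul_assoc]
      refine setIntegral_mono_on ((int2.const_mul _).sub (integrableOn_const hshell))
        (int1.const_mul _) measurableSet_shell fun u hu => ?_
      have h1 : |F (‖u‖⁻¹ • u) - F u| ≤ K * δ := by
        have := hK.dist_le_mul (‖u‖⁻¹ • u) u
        rw [Real.dist_eq, dist_eq_norm] at this
        refine this.trans (mul_le_mul_of_nonneg_left ?_ K.2)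
        have hu0 : 0 < ‖u‖ := by linarith [hu.1]
        have e : ‖u‖⁻¹ • u - u = (1 - ‖u‖) • (‖u‖⁻¹ • u) := by
          rw [sub_smul, one_smul, smul_smul, mul_inv_cancel₀ hu0.ne', one_smul]
        rw [e, norm_smul, hunit u hu, mul_one, Real.norm_eq_abs, abs_of_nonneg] <;>
          linarith [hu.1, hu.2]
      have h2 : inner ℝ (‖u‖⁻¹ • u) v * (F (‖u‖⁻¹ • u) - F u) ≤ ‖v‖ * (K * δ) := by
        refine (le_abs_self _).trans ?_
        rw [abs_mul]
        exact mul_le_mul (hinner u hu) h1 (abs_nonneg _) (norm_nonneg _)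
      have h3 := mul_le_mul_of_nonneg_left h2 (inv_pos.2 hδ).le
      have h4 : δ⁻¹ * (‖v‖ * (K * δ)) = K * ‖v‖ := by field_simp
      linarith
    linarith
  -- the thickness of the shell tends to zero
  have hlim : Filter.Tendsto (fun δ : ℝ => δ⁻¹ * (I * ((1 - (1 - δ) ^ d) * W))
      - 2 * (K * ‖v‖) * ((1 - (1 - δ) ^ d) * W)) (nhdsWithin 0 (Set.Ioi 0))
      (nhds (d * I * W - 2 * (K * ‖v‖) * (0 * W))) := by
    have hder : HasDerivAt (fun δ : ℝ => 1 - (1 - δ) ^ d) d 0 := by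
      have := (((hasDerivAt_id (0:ℝ)).const_sub 1).pow d).const_sub 1
      refine this.congr_deriv ?_
      simp
    have hs := hder.tendsto_slope_zero_right
    have hc : Filter.Tendsto (fun δ : ℝ => 1 - (1 - δ) ^ d) (nhdsWithin 0 (Set.Ioi 0))
        (nhds 0) := by
      have : Continuous fun δ : ℝ => 1 - (1 - δ) ^ d := by fun_prop
      have h0 := this.tendsto 0
      simp only [sub_zero, one_pow, sub_self] at h0
      exact h0.mono_left nhdsWithin_le_nhds
    refine Filter.Tendsto.sub ?_ ((hc.mul_const W).const_mul _)
    have := (hs.mul_const I).mul_const W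
    refine this.congr fun δ => ?_
    simp
    ring
  rw [zero_mul, mul_zero, sub_zero] at hlim
  refine le_of_tendsto hlim ?_
  filter_upwards [Ioo_mem_nhdsGT one_pos] with δ hδ
  have := main δ hδ.1 hδ.2
  rwa [volume_real_shell hδ.1 hδ.2] at this

end Divergence

/-! ### The standard Gaussian measure on `ℝ^d` -/

section Gaussian

open ProbabilityTheory

variable {d : ℕ}

/-- The density of the standard Gaussian measure as a function of the norm. -/
noncomputable def gaussianRadial (d : ℕ) (t : ℝ) : ℝ :=
  (∫ x : Vec d, Real.exp (-(1 / 2) * ‖x‖ ^ 2))⁻¹ * Real.exp (-(1 / 2) * t ^ 2)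

theorem integrable_exp_neg_mul_sq_norm {b : ℝ} (hb : 0 < b) :
    Integrable fun x : Vec d => Real.exp (-b * ‖x‖ ^ 2) := by
  have h := (GaussianFourier.integrable_cexp_neg_mul_sq_norm_add (V := Vec d) (b := (b : ℂ))
    (by simpa using hb) 0 0).re
  refine h.congr (.of_forall fun x => ?_)
  have : (-(b:ℂ) * ‖x‖ ^ 2 + 0 * (inner ℝ (0 : Vec d) x : ℝ)) = ((-b * ‖x‖ ^ 2 : ℝ) : ℂ) := by
    push_cast; ring
  simp only [this, RCLike.re_to_complex]
  rw [← Complex.ofReal_exp, Complex.ofReal_re]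

theorem gaussianRadial_nonneg (t : ℝ) : 0 ≤ gaussianRadial d t := by
  unfold gaussianRadial
  have : 0 ≤ ∫ x : Vec d, Real.exp (-(1 / 2) * ‖x‖ ^ 2) :=
    integral_nonneg fun x => (Real.exp_pos _).le
  positivity

theorem continuous_gaussianRadial : Continuous (gaussianRadial d) := by
  unfold gaussianRadial
  fun_prop

/-- Both measures have the same characteristic function. The density depends on the norm alone,
which is what makes direction and norm independent. -/
theorem stdGaussian_eq_withDensity :
    stdGaussian (Vec d) = volume.withDensity fun x => ENNReal.ofReal (gaussianRadial d ‖x‖) := by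
  have hint : Integrable fun x : Vec d => gaussianRadial d ‖x‖ :=
    (integrable_exp_neg_mul_sq_norm (by norm_num)).const_mul _
  have hfin : IsFiniteMeasure
      ((volume : Measure (Vec d)).withDensity fun x => ENNReal.ofReal (gaussianRadial d ‖x‖)) :=
    isFiniteMeasure_withDensity_ofReal hint.2
  refine Measure.ext_of_charFun (funext fun t => ?_)
  rw [charFun_stdGaussian, charFun_apply, integral_withDensity_eq_integral_toReal_smul
    (by have := continuous_gaussianRadial (d := d); fun_prop) (.of_forall fun x => ENNReal.ofReal_lt_top)]
  have hb : (0:ℝ) < (1 / 2 : ℂ).re := by norm_num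
  have h1 := GaussianFourier.integral_cexp_neg_mul_sq_norm_add (V := Vec d) hb Complex.I t
  have h0 := GaussianFourier.integral_cexp_neg_mul_sq_norm_add (V := Vec d) hb 0 0
  have hZ : ((∫ x : Vec d, Real.exp (-(1 / 2) * ‖x‖ ^ 2) : ℝ) : ℂ)
      = (Real.pi / (1 / 2) : ℂ) ^ (Module.finrank ℝ (Vec d) / 2 : ℂ) := by
    rw [← integral_complex_ofReal]
    simp only [zero_mul, add_zero] at h0
    convert h0 using 1
    · refine integral_congr_ae (.of_forall fun x => ?_)
      simp
    · simp
  have hZ0 : (Real.pi / (1 / 2) : ℂ) ^ (Module.finrank ℝ (Vec d) / 2 : ℂ) ≠ 0 := by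
    rw [Complex.cpow_ne_zero_iff]
    left
    simp [Real.pi_ne_zero]
  have : ∀ x : Vec d, (ENNReal.ofReal (gaussianRadial d ‖x‖)).toReal •
      Complex.exp ((inner ℝ x t : ℝ) * Complex.I)
      = ((Real.pi / (1 / 2) : ℂ) ^ (Module.finrank ℝ (Vec d) / 2 : ℂ))⁻¹ *
        Complex.exp (-(1 / 2) * ‖x‖ ^ 2 + Complex.I * (inner ℝ t x : ℝ)) := by
    intro x
    rw [ENNReal.toReal_ofReal (gaussianRadial_nonneg _), Complex.real_smul, gaussianRadial,
      Complex.ofReal_mul, Complex.ofReal_inv, hZ, Complex.exp_add, real_inner_comm]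
    push_cast
    ring_nf
  rw [integral_congr_ae (.of_forall this), integral_const_mul, h1, inv_mul_cancel_left₀ hZ0]
  congr 1
  rw [Complex.I_sq]
  ring

theorem integral_stdGaussian (G : Vec d → ℝ) :
    ∫ x, G x ∂stdGaussian (Vec d) = ∫ x : Vec d, G x * gaussianRadial d ‖x‖ := by
  rw [stdGaussian_eq_withDensity, integral_withDensity_eq_integral_toReal_smul
    (by have := continuous_gaussianRadial (d := d); fun_prop) (.of_forall fun x => ENNReal.ofReal_lt_top)]
  refine integral_congr_ae (.of_forall fun x => ?_)
  simp only [ENNReal.toReal_ofReal (gaussianRadial_nonneg _), smul_eq_mul, mul_comm]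

theorem stdGaussian_absolutelyContinuous : stdGaussian (Vec d) ≪ volume := by
  rw [stdGaussian_eq_withDensity]
  exact withDensity_absolutelyContinuous _ _

theorem integrable_exp_sq_norm_stdGaussian {b : ℝ} (hb : b < 1 / 2) :
    Integrable (fun x => Real.exp (b * ‖x‖ ^ 2)) (stdGaussian (Vec d)) := by
  rw [stdGaussian_eq_withDensity, integrable_withDensity_iff_integrable_smul'
    (by have := continuous_gaussianRadial (d := d); fun_prop) (.of_forall fun x => ENNReal.ofReal_lt_top)]
  refine ((integrable_exp_neg_mul_sq_norm (d := d) (b := 1 / 2 - b) (by linarith)).const_mul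
    (∫ x : Vec d, Real.exp (-(1 / 2) * ‖x‖ ^ 2))⁻¹).congr (.of_forall fun x => ?_)
  simp only [ENNReal.toReal_ofReal (gaussianRadial_nonneg _), smul_eq_mul]
  rw [gaussianRadial, mul_assoc, ← Real.exp_add]
  ring_nf

/-- Direction and norm of a standard Gaussian vector are independent. -/
theorem integral_stdGaussian_direction_mul_norm [NeZero d] (φ : Vec d → ℝ) (k : ℝ → ℝ) :
    ∫ x, φ (‖x‖⁻¹ • x) * k ‖x‖ ∂stdGaussian (Vec d) =
      (∫ e : UnitSphere d, φ e ∂uniformSphere d) * ∫ x, k ‖x‖ ∂stdGaussian (Vec d) := by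
  rw [integral_stdGaussian, integral_stdGaussian (fun x => k ‖x‖)]
  simp only [mul_assoc]
  exact integral_direction_mul_norm φ fun t => k t * gaussianRadial d t

theorem integral_inner_sq_stdGaussian (v : Vec d) :
    ∫ x, inner ℝ v x ^ 2 ∂stdGaussian (Vec d) = ‖v‖ ^ 2 := by
  have h := variance_dual_stdGaussian (innerSL ℝ v : StrongDual ℝ (Vec d))
  rw [innerSL_apply_norm, variance_eq_integral (by fun_prop), integral_strongDual_stdGaussian] at h
  simpa using h

theorem integrable_inner_sq_stdGaussian (v : Vec d) :
    Integrable (fun x => inner ℝ v x ^ 2) (stdGaussian (Vec d)) :=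
  (IsGaussian.memLp_dual (stdGaussian (Vec d)) (innerSL ℝ v : StrongDual ℝ (Vec d)) 2
    (by simp)).integrable_sq

theorem integrable_norm_sq_stdGaussian :
    Integrable (fun x => ‖x‖ ^ 2) (stdGaussian (Vec d)) :=
  (IsGaussian.memLp_id (stdGaussian (Vec d)) 2 (by simp)).norm.integrable_sq

theorem integral_norm_sq_stdGaussian : ∫ x, ‖x‖ ^ 2 ∂stdGaussian (Vec d) = d := by
  have h : ∀ x : Vec d, ‖x‖ ^ 2 = ∑ i, inner ℝ (EuclideanSpace.basisFun (Fin d) ℝ i) x ^ 2 :=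
    fun x => ((EuclideanSpace.basisFun (Fin d) ℝ).sum_sq_inner_right x).symm
  simp only [h]
  rw [integral_finsetSum _ fun i _ => integrable_inner_sq_stdGaussian _]
  simp [integral_inner_sq_stdGaussian]

/-- The second moments of the uniform distribution on the sphere. -/
theorem integral_inner_sq_uniformSphere [NeZero d] (v : Vec d) :
    ∫ e : UnitSphere d, inner ℝ v (e : Vec d) ^ 2 ∂uniformSphere d = ‖v‖ ^ 2 / d := by
  have h := integral_stdGaussian_direction_mul_norm (d := d) (fun x => inner ℝ v x ^ 2)
    fun t => t ^ 2
  rw [integral_norm_sq_stdGaussian] at h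
  have hd : (d : ℝ) ≠ 0 := Nat.cast_ne_zero.2 (NeZero.ne d)
  rw [eq_div_iff hd, ← h, ← integral_inner_sq_stdGaussian]
  refine integral_congr_ae (.of_forall fun x => ?_)
  by_cases hx : x = 0
  · simp [hx]
  · have : ‖x‖ ≠ 0 := norm_ne_zero_iff.2 hx
    simp only [inner_smul_right]
    field_simp

theorem integral_odd_stdGaussian {F : Vec d → ℝ} (hF : ∀ x, F (-x) = -F x) :
    ∫ x, F x ∂stdGaussian (Vec d) = 0 := by
  have h := stdGaussian_map (LinearIsometryEquiv.neg ℝ (E := Vec d))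
  have h2 : ∫ x, F x ∂stdGaussian (Vec d) = ∫ x, F (-x) ∂stdGaussian (Vec d) := by
    conv_lhs => rw [← h]
    exact (LinearIsometryEquiv.neg ℝ (E := Vec d)).toHomeomorph.measurableEmbedding.integral_map F
  simp only [hF, integral_neg] at h2
  linarith

/-- For w > 0 the integral equals (1 - 2bw)^(-1/2), and the hypothesis gives 1 - 2bw ≥ 1/2. -/
theorem integral_exp_sq_gaussianReal_le {b : ℝ} {w : NNReal} (hbw : 4 * b * w ≤ 1) :
    ∫ t, Real.exp (b * t ^ 2) ∂gaussianReal 0 w ≤ 2 := by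
  by_cases hw : w = 0
  · rw [hw, gaussianReal_zero_var, integral_dirac]
    norm_num
  have hw0 : (0:ℝ) < w := by positivity
  rw [integral_gaussianReal_eq_integral_smul hw]
  have h1 : ∀ t : ℝ, gaussianPDFReal 0 w t • Real.exp (b * t ^ 2)
      = (√(2 * Real.pi * w))⁻¹ * Real.exp (-(1 / (2 * w) - b) * t ^ 2) := by
    intro t
    rw [gaussianPDFReal, smul_eq_mul, mul_assoc, ← Real.exp_add]
    congr 2
    ring
  simp only [h1]
  rw [integral_const_mul, integral_gaussian, inv_mul_le_iff₀ (by positivity)]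
  have h2 : 1 / (4 * w) ≤ 1 / (2 * w) - b := by
    have : b ≤ 1 / (4 * w) := by
      rw [le_div_iff₀ (by positivity)]
      linarith
    have e : 1 / (2 * (w:ℝ)) = 1 / (4 * w) + 1 / (4 * w) := by field_simp; norm_num
    rw [e]
    linarith
  refine (Real.sqrt_le_sqrt (div_le_div_of_nonneg_left Real.pi_pos.le (by positivity) h2)).trans ?_
  rw [Real.sqrt_le_left (by positivity), mul_pow, Real.sq_sqrt (by positivity)]
  field_simp
  norm_num

theorem integral_exp_inner_sq_stdGaussian_le {b : ℝ} {v : Vec d} (hb : 4 * b * ‖v‖ ^ 2 ≤ 1) :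
    ∫ x, Real.exp (b * inner ℝ v x ^ 2) ∂stdGaussian (Vec d) ≤ 2 := by
  have hmap : (stdGaussian (Vec d)).map (innerSL ℝ v : StrongDual ℝ (Vec d))
      = gaussianReal 0 (Real.toNNReal (‖v‖ ^ 2)) := by
    rw [IsGaussian.map_eq_gaussianReal, integral_strongDual_stdGaussian, variance_dual_stdGaussian,
      innerSL_apply_norm]
  have := integral_exp_sq_gaussianReal_le (w := Real.toNNReal (‖v‖ ^ 2)) (b := b)
    (by rwa [Real.coe_toNNReal _ (sq_nonneg _)])
  rw [← hmap, integral_map (by fun_prop) (by fun_prop)] at this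
  simpa using this

end Gaussian

/-! ### Gaussian concentration for Lipschitz functions -/

section Concentration

open ProbabilityTheory

variable {d : ℕ} {F : Vec d → ℝ}

/-- The increment of `F` along a rotation by the angle `δ` in the plane spanned by `x` and `y`. -/
noncomputable def rotationIncrement (F : Vec d → ℝ) (δ : ℝ) (z : Vec d × Vec d) : ℝ :=
  F (Real.cos δ • z.1 + Real.sin δ • z.2) - F z.1

/-- Rotating by kδ and then by δ is rotating by (k+1)δ, so the increments telescope. For nδ = π/2
the sum is F(y) - F(x). -/
theorem sum_rotationIncrement (F : Vec d → ℝ) (δ : ℝ) (z : Vec d × Vec d) (n : ℕ) :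
    ∑ k ∈ Finset.range n, rotationIncrement F δ (ContinuousLinearMap.rotation (k * δ) z)
      = F (Real.cos (n * δ) • z.1 + Real.sin (n * δ) • z.2) - F z.1 := by
  have h : ∀ k : ℕ, rotationIncrement F δ (ContinuousLinearMap.rotation (k * δ) z)
      = F (Real.cos ((k + 1 : ℕ) * δ) • z.1 + Real.sin ((k + 1 : ℕ) * δ) • z.2)
        - F (Real.cos (k * δ) • z.1 + Real.sin (k * δ) • z.2) := by
    intro k
    rw [rotationIncrement, ContinuousLinearMap.rotation_apply]
    congr 2
    push_cast
    rw [add_mul, one_mul, Real.cos_add, Real.sin_add]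
    module
  rw [Finset.sum_congr rfl fun k _ => h k,
    Finset.sum_range_sub fun k : ℕ => F (Real.cos (k * δ) • z.1 + Real.sin (k * δ) • z.2)]
  simp

/-- Cauchy–Schwarz for the square of the sum, then Jensen for the exponential. -/
theorem exp_sq_sum_le {c : ℝ} (hc : 0 ≤ c) {n : ℕ} (hn : 0 < n) (a : ℕ → ℝ) :
    Real.exp (c * (∑ k ∈ Finset.range n, a k) ^ 2)
      ≤ (n : ℝ)⁻¹ * ∑ k ∈ Finset.range n, Real.exp (c * (n * a k) ^ 2) := by
  have hn' : (n : ℝ) ≠ 0 := by positivity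
  have h1 : c * (∑ k ∈ Finset.range n, a k) ^ 2
      ≤ ∑ k ∈ Finset.range n, (n : ℝ)⁻¹ * (c * (n * a k) ^ 2) := by
    have := sq_sum_le_card_mul_sum_sq (s := Finset.range n) (f := a)
    rw [Finset.card_range] at this
    refine (mul_le_mul_of_nonneg_left this hc).trans (le_of_eq ?_)
    rw [Finset.mul_sum, Finset.mul_sum]
    refine Finset.sum_congr rfl fun k _ => ?_
    field_simp
  refine (Real.exp_le_exp.2 h1).trans ?_
  have := convexOn_exp.map_sum_le (t := Finset.range n) (w := fun _ => (n : ℝ)⁻¹)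
    (p := fun k => c * (n * a k) ^ 2) (fun _ _ => by positivity)
    (by rw [Finset.sum_const, Finset.card_range, nsmul_eq_mul, mul_inv_cancel₀ hn'])
    (fun _ _ => Set.mem_univ _)
  simpa only [smul_eq_mul, ← Finset.mul_sum] using this

theorem abs_rotationIncrement_le (hF : LipschitzWith 3 F) {δ : ℝ} (hδ : 0 ≤ δ) (z : Vec d × Vec d) :
    |rotationIncrement F δ z| ≤ 3 * (δ * (‖z.1‖ + ‖z.2‖)) := by
  have h := hF.dist_le_mul (Real.cos δ • z.1 + Real.sin δ • z.2) z.1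
  rw [Real.dist_eq, dist_eq_norm] at h
  refine h.trans ?_
  push_cast
  gcongr
  have e : Real.cos δ • z.1 + Real.sin δ • z.2 - z.1
      = (Real.cos δ - 1) • z.1 + Real.sin δ • z.2 := by module
  rw [e, mul_add]
  refine (norm_add_le _ _).trans ?_
  rw [norm_smul, norm_smul, Real.norm_eq_abs, Real.norm_eq_abs]
  have h1 : |Real.cos δ - 1| ≤ δ := by
    have := Real.abs_cos_sub_cos_le δ 0
    rwa [Real.cos_zero, sub_zero, abs_of_nonneg hδ] at this
  have h2 : |Real.sin δ| ≤ δ := by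
    have := Real.abs_sin_le_abs (x := δ)
    rwa [abs_of_nonneg hδ] at this
  gcongr

/-- The dominating function of the Gaussian integrals below. -/
noncomputable def gaussianMajorant (z : Vec d × Vec d) : ℝ :=
  Real.exp (1 / 4 * ‖z.1‖ ^ 2) * Real.exp (1 / 4 * ‖z.2‖ ^ 2)

theorem integrable_gaussianMajorant :
    Integrable (gaussianMajorant (d := d)) ((stdGaussian (Vec d)).prod (stdGaussian (Vec d))) :=
  (integrable_exp_sq_norm_stdGaussian (by norm_num)).mul_prod
    (integrable_exp_sq_norm_stdGaussian (by norm_num))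

/-- The bound is uniform in n, as dominated convergence requires. From π² ≤ 10 the exponent is at
most (45/200)(‖x‖² + ‖y‖²), below the rate 1/4, which in turn is below the Gaussian rate 1/2. -/
theorem exp_sq_rotationIncrement_le (hF : LipschitzWith 3 F) {n : ℕ} (hn : 0 < n)
    (z : Vec d × Vec d) :
    Real.exp (1 / 200 * (n * rotationIncrement F (Real.pi / 2 / n) z) ^ 2)
      ≤ gaussianMajorant z := by
  have hn' : (0 : ℝ) < n := by positivity
  rw [gaussianMajorant, ← Real.exp_add, Real.exp_le_exp]
  have h := abs_rotationIncrement_le hF (δ := Real.pi / 2 / n) (by positivity) z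
  have h2 : |n * rotationIncrement F (Real.pi / 2 / n) z| ≤ 3 * (Real.pi / 2) * (‖z.1‖ + ‖z.2‖) := by
    rw [abs_mul, abs_of_pos hn']
    calc (n : ℝ) * |rotationIncrement F (Real.pi / 2 / n) z|
        ≤ n * (3 * (Real.pi / 2 / n * (‖z.1‖ + ‖z.2‖))) := by gcongr
      _ = _ := by field_simp
  have h3 : (n * rotationIncrement F (Real.pi / 2 / n) z) ^ 2
      ≤ (3 * (Real.pi / 2) * (‖z.1‖ + ‖z.2‖)) ^ 2 := by
    rw [← sq_abs]
    gcongr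
  have hpi : Real.pi ^ 2 ≤ 10 := by nlinarith [Real.pi_lt_d2, Real.pi_pos]
  have h4 : (3 * (Real.pi / 2) * (‖z.1‖ + ‖z.2‖)) ^ 2
      ≤ 9 / 4 * 10 * (2 * (‖z.1‖ ^ 2 + ‖z.2‖ ^ 2)) := by
    have : (‖z.1‖ + ‖z.2‖) ^ 2 ≤ 2 * (‖z.1‖ ^ 2 + ‖z.2‖ ^ 2) := add_sq_le
    calc _ = 9 / 4 * Real.pi ^ 2 * (‖z.1‖ + ‖z.2‖) ^ 2 := by ring
      _ ≤ _ := by gcongr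
  nlinarith [sq_nonneg ‖z.1‖, sq_nonneg ‖z.2‖]

theorem continuous_rotationIncrement (hF : Continuous F) (δ : ℝ) :
    Continuous (rotationIncrement F δ) := by
  unfold rotationIncrement
  fun_prop

theorem integrable_exp_sq_rotationIncrement (hF : LipschitzWith 3 F) {n : ℕ} (hn : 0 < n) :
    Integrable (fun z => Real.exp (1 / 200 * (n * rotationIncrement F (Real.pi / 2 / n) z) ^ 2))
      ((stdGaussian (Vec d)).prod (stdGaussian (Vec d))) := by
  have := continuous_rotationIncrement hF.continuous (Real.pi / 2 / n)
  refine integrable_gaussianMajorant.mono' (by fun_prop) (.of_forall fun z => ?_)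
  rw [Real.norm_eq_abs, abs_of_pos (Real.exp_pos _)]
  exact exp_sq_rotationIncrement_le hF hn z

/-- Each increment has the law of the first one, since the product of two standard Gaussian measures
is invariant under rotations that mix the two factors. -/
theorem integral_exp_sq_sub_le_rotationIncrement (hF : LipschitzWith 3 F) {n : ℕ} (hn : 0 < n) :
    ∫ z, Real.exp (1 / 200 * (F z.2 - F z.1) ^ 2) ∂(stdGaussian (Vec d)).prod (stdGaussian (Vec d))
      ≤ ∫ z, Real.exp (1 / 200 * (n * rotationIncrement F (Real.pi / 2 / n) z) ^ 2)
        ∂(stdGaussian (Vec d)).prod (stdGaussian (Vec d)) := by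
  set μ := (stdGaussian (Vec d)).prod (stdGaussian (Vec d)) with hμ
  set δ := Real.pi / 2 / n with hδ
  have hn' : (n : ℝ) ≠ 0 := by positivity
  set g : Vec d × Vec d → ℝ := fun z => Real.exp (1 / 200 * (n * rotationIncrement F δ z) ^ 2) with hg
  have hgc : Continuous g := by
    have := continuous_rotationIncrement hF.continuous δ
    fun_prop
  have hgi : Integrable g μ := integrable_exp_sq_rotationIncrement hF hn
  have hmp : ∀ θ : ℝ, MeasurePreserving (ContinuousLinearMap.rotation θ : _ → Vec d × Vec d) μ μ :=
    fun θ => ⟨(ContinuousLinearMap.rotation θ).continuous.measurable,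
      IsGaussian.map_rotation_eq_self (by simp) θ⟩
  have hrot : ∀ θ : ℝ, ∫ z, g (ContinuousLinearMap.rotation θ z) ∂μ = ∫ z, g z ∂μ := by
    intro θ
    have := integral_map (hmp θ).measurable.aemeasurable (μ := μ) (f := g)
      hgc.aestronglyMeasurable
    rw [(hmp θ).map_eq] at this
    exact this.symm
  have hroti : ∀ θ : ℝ, Integrable (fun z => g (ContinuousLinearMap.rotation θ z)) μ :=
    fun θ => (hmp θ).integrable_comp_of_integrable hgi
  calc ∫ z, Real.exp (1 / 200 * (F z.2 - F z.1) ^ 2) ∂μ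
      ≤ ∫ z, (n : ℝ)⁻¹ * ∑ k ∈ Finset.range n, g (ContinuousLinearMap.rotation (k * δ) z) ∂μ := by
        refine integral_mono_of_nonneg (.of_forall fun z => (Real.exp_pos _).le)
          ((integrable_finsetSum _ fun k _ => hroti _).const_mul _) (.of_forall fun z => ?_)
        have h1 := exp_sq_sum_le (c := 1 / 200) (by norm_num) hn
          (fun k => rotationIncrement F δ (ContinuousLinearMap.rotation (k * δ) z))
        rw [sum_rotationIncrement, hδ, mul_div_cancel₀ _ hn', Real.cos_pi_div_two,
          Real.sin_pi_div_two, zero_smul, one_smul, zero_add] at h1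
        exact h1
    _ = ∫ z, g z ∂μ := by
        rw [integral_const_mul, integral_finsetSum _ fun k _ => hroti _,
          Finset.sum_congr rfl fun k _ => hrot _, Finset.sum_const, Finset.card_range,
          nsmul_eq_mul, inv_mul_cancel_left₀ hn']

/-- The curve δ ↦ cos δ·x + sin δ·y has velocity y at δ = 0; the increments divided by their angle
are difference quotients along it. -/
theorem tendsto_rotationIncrement {x : Vec d} (hx : DifferentiableAt ℝ F x) (y : Vec d) :
    Filter.Tendsto (fun n : ℕ => ((n + 1 : ℕ) : ℝ) *
        rotationIncrement F (Real.pi / 2 / ((n + 1 : ℕ) : ℝ)) (x, y)) Filter.atTop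
      (nhds (Real.pi / 2 * fderiv ℝ F x y)) := by
  have hγ : HasDerivAt (fun δ : ℝ => Real.cos δ • x + Real.sin δ • y) y 0 := by
    have := ((Real.hasDerivAt_cos 0).smul_const x).add ((Real.hasDerivAt_sin 0).smul_const y)
    exact this.congr_deriv (by simp)
  have hx' : HasFDerivAt F (fderiv ℝ F x) (Real.cos 0 • x + Real.sin 0 • y) := by
    simpa using hx.hasFDerivAt
  have hcomp := (hx'.comp_hasDerivAt (0:ℝ) hγ).tendsto_slope_zero
  have hδ : Filter.Tendsto (fun n : ℕ => Real.pi / 2 / ((n + 1 : ℕ) : ℝ)) Filter.atTop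
      (nhdsWithin 0 {0}ᶜ) := by
    refine tendsto_nhdsWithin_iff.2 ⟨?_, .of_forall fun n => ?_⟩
    · exact (tendsto_const_div_atTop_nhds_zero_nat (Real.pi / 2)).comp (Filter.tendsto_add_atTop_nat 1)
    · have : (0:ℝ) < Real.pi / 2 / ((n + 1 : ℕ) : ℝ) := by positivity
      exact this.ne'
  refine ((hcomp.comp hδ).const_mul (Real.pi / 2)).congr fun n => ?_
  have hn : ((n + 1 : ℕ) : ℝ) ≠ 0 := by positivity
  simp [rotationIncrement]
  field_simp

/-- For fixed x the derivative is a centered Gaussian in y with variance ‖∇F(x)‖² ≤ 9. The constant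
1/200 satisfies 4·(1/200)·(π/2)²·9 ≤ 1. -/
theorem integral_exp_sq_fderiv_le (hF : LipschitzWith 3 F) :
    ∫ z, Real.exp (1 / 200 * (Real.pi / 2 * fderiv ℝ F z.1 z.2) ^ 2)
      ∂(stdGaussian (Vec d)).prod (stdGaussian (Vec d)) ≤ 2 := by
  set g : Vec d × Vec d → ℝ := fun z => Real.exp (1 / 200 * (Real.pi / 2 * fderiv ℝ F z.1 z.2) ^ 2)
  -- Without integrability the Bochner integral is 0 by convention, so no measurability of the
  -- derivative has to be proved.
  by_cases hint : Integrable g ((stdGaussian (Vec d)).prod (stdGaussian (Vec d)))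
  · rw [integral_prod _ hint]
    have h : ∀ x, ∫ y, g (x, y) ∂stdGaussian (Vec d) ≤ 2 := by
      intro x
      set v := (InnerProductSpace.toDual ℝ (Vec d)).symm (fderiv ℝ F x) with hv
      have hvn : ‖v‖ ≤ 3 := by
        rw [hv, LinearIsometryEquiv.norm_map]
        exact norm_fderiv_le_of_lipschitz ℝ hF
      have hin : ∀ y, fderiv ℝ F x y = inner ℝ v y := by
        intro y
        rw [hv, InnerProductSpace.toDual_symm_apply]
      have hpi : Real.pi ^ 2 ≤ 10 := by nlinarith [Real.pi_lt_d2, Real.pi_pos]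
      have := integral_exp_inner_sq_stdGaussian_le (v := v) (b := 1 / 200 * (Real.pi / 2) ^ 2) (by
        have : ‖v‖ ^ 2 ≤ 3 ^ 2 := by gcongr
        nlinarith [sq_nonneg ‖v‖, sq_nonneg Real.pi])
      refine le_trans (le_of_eq ?_) this
      refine integral_congr_ae (.of_forall fun y => ?_)
      simp only [g, hin]
      congr 1
      ring
    calc ∫ x, ∫ y, g (x, y) ∂stdGaussian (Vec d) ∂stdGaussian (Vec d)
        ≤ ∫ _x, (2:ℝ) ∂stdGaussian (Vec d) :=
          integral_mono_of_nonneg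
            (.of_forall fun x => integral_nonneg fun y => (Real.exp_pos _).le)
            (integrable_const _) (.of_forall h)
      _ = 2 := by simp
  · rw [integral_undef hint]
    norm_num

/-- The Maurey–Pisier estimate for the difference of two independent copies. -/
theorem integral_exp_sq_sub_le (hF : LipschitzWith 3 F) :
    ∫ z, Real.exp (1 / 200 * (F z.2 - F z.1) ^ 2)
      ∂(stdGaussian (Vec d)).prod (stdGaussian (Vec d)) ≤ 2 := by
  refine le_trans ?_ (integral_exp_sq_fderiv_le hF)
  have hlim : Filter.Tendsto (fun n : ℕ => ∫ z, Real.exp (1 / 200 * (((n + 1 : ℕ) : ℝ) *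
      rotationIncrement F (Real.pi / 2 / ((n + 1 : ℕ) : ℝ)) z) ^ 2)
        ∂(stdGaussian (Vec d)).prod (stdGaussian (Vec d))) Filter.atTop
      (nhds (∫ z, Real.exp (1 / 200 * (Real.pi / 2 * fderiv ℝ F z.1 z.2) ^ 2)
        ∂(stdGaussian (Vec d)).prod (stdGaussian (Vec d)))) := by
    refine tendsto_integral_of_dominated_convergence gaussianMajorant (fun n => ?_)
      integrable_gaussianMajorant (fun n => .of_forall fun z => ?_) ?_
    · exact (integrable_exp_sq_rotationIncrement hF n.succ_pos).aestronglyMeasurable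
    · rw [Real.norm_eq_abs, abs_of_pos (Real.exp_pos _)]
      exact exp_sq_rotationIncrement_le hF n.succ_pos z
    · have hae : ∀ᵐ x ∂stdGaussian (Vec d), DifferentiableAt ℝ F x :=
        stdGaussian_absolutelyContinuous.ae_le hF.ae_differentiableAt
      filter_upwards [Measure.quasiMeasurePreserving_fst.ae hae] with z hz
      have := tendsto_rotationIncrement hz z.2
      exact (Real.continuous_exp.tendsto _).comp ((this.pow 2).const_mul _)
  exact ge_of_tendsto' hlim fun n => integral_exp_sq_sub_le_rotationIncrement hF n.succ_pos

theorem integrable_exp_sq_of_lipschitz (hF : LipschitzWith 3 F) (h0 : F 0 = 0) {c : ℝ}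
    (hc : c ≤ 1 / 40) :
    Integrable (fun x => Real.exp (c * F x ^ 2)) (stdGaussian (Vec d)) := by
  have := hF.continuous
  refine (integrable_exp_sq_norm_stdGaussian (b := 9 / 40) (by norm_num)).mono'
    (by fun_prop) (.of_forall fun x => ?_)
  rw [Real.norm_eq_abs, abs_of_pos (Real.exp_pos _), Real.exp_le_exp]
  have h := hF.dist_le_mul x 0
  rw [Real.dist_eq, h0, sub_zero, dist_zero_right] at h
  push_cast at h
  have h2 : F x ^ 2 ≤ (3 * ‖x‖) ^ 2 := by
    rw [← sq_abs]
    gcongr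
  nlinarith [sq_nonneg (F x)]

/-- Gaussian concentration for odd Lipschitz functions. -/
theorem integral_exp_sq_stdGaussian_le (hF : LipschitzWith 3 F) (hodd : ∀ x, F (-x) = -F x) :
    ∫ x, Real.exp (1 / 200 * F x ^ 2) ∂stdGaussian (Vec d) ≤ 2 := by
  have h0 : F 0 = 0 := by
    have := hodd 0
    rw [neg_zero] at this
    linarith
  have hFc := hF.continuous
  refine le_trans ?_ (integral_exp_sq_sub_le hF)
  set μ := stdGaussian (Vec d)
  have i1 : Integrable (fun x => Real.exp (1 / 200 * F x ^ 2)) μ :=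
    integrable_exp_sq_of_lipschitz hF h0 (by norm_num)
  have i2 : Integrable (fun x => F x * Real.exp (1 / 200 * F x ^ 2)) μ := by
    refine ((integrable_exp_sq_of_lipschitz hF h0 (c := 1 / 40) le_rfl).const_mul
      100).mono' (by fun_prop) (.of_forall fun x => ?_)
    rw [norm_mul, Real.norm_eq_abs, Real.norm_eq_abs, abs_of_pos (Real.exp_pos _)]
    -- The linear factor is absorbed by raising the rate from 1/200 to 1/200 + 1/50 = 1/40, still
    -- integrable because 9/40 < 1/2.
    have h1 : |F x| ≤ 100 * Real.exp (1 / 50 * F x ^ 2) := by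
      have := Real.add_one_le_exp (1 / 50 * F x ^ 2)
      rw [← sq_abs] at this ⊢
      nlinarith [sq_nonneg (|F x| - 1)]
    calc |F x| * Real.exp (1 / 200 * F x ^ 2)
        ≤ 100 * Real.exp (1 / 50 * F x ^ 2) * Real.exp (1 / 200 * F x ^ 2) := by gcongr
      _ = 100 * Real.exp (1 / 40 * F x ^ 2) := by
          rw [mul_assoc, ← Real.exp_add]
          ring_nf
  have i3 : Integrable F μ := by
    refine i1.const_mul 201 |>.mono' (by fun_prop) (.of_forall fun x => ?_)
    have := Real.add_one_le_exp (1 / 200 * F x ^ 2)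
    rw [Real.norm_eq_abs]
    rw [← sq_abs] at this ⊢
    nlinarith [sq_nonneg (|F x| - 1)]
  have e1 : ∫ z : Vec d × Vec d, Real.exp (1 / 200 * F z.2 ^ 2) ∂μ.prod μ
      = ∫ x, Real.exp (1 / 200 * F x ^ 2) ∂μ := by
    have := integral_prod_mul (μ := μ) (ν := μ) (fun _ => (1:ℝ))
      fun y => Real.exp (1 / 200 * F y ^ 2)
    simpa using this
  have e2 : ∫ z : Vec d × Vec d, F z.1 * (F z.2 * Real.exp (1 / 200 * F z.2 ^ 2)) ∂μ.prod μ = 0 := by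
    rw [integral_prod_mul (μ := μ) (ν := μ) F fun y => F y * Real.exp (1 / 200 * F y ^ 2),
      integral_odd_stdGaussian hodd, zero_mul]
  have j1 : Integrable (fun z : Vec d × Vec d => Real.exp (1 / 200 * F z.2 ^ 2)) (μ.prod μ) := by
    simpa using (integrable_const (1:ℝ)).mul_prod (μ := μ) i1
  have j2 : Integrable (fun z : Vec d × Vec d => F z.1 * (F z.2 * Real.exp (1 / 200 * F z.2 ^ 2)))
      (μ.prod μ) := i3.mul_prod i2
  have e3 : ∫ x, Real.exp (1 / 200 * F x ^ 2) ∂μ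
      = ∫ z : Vec d × Vec d, (Real.exp (1 / 200 * F z.2 ^ 2)
        - 1 / 100 * (F z.1 * (F z.2 * Real.exp (1 / 200 * F z.2 ^ 2)))) ∂μ.prod μ := by
    rw [integral_sub j1 (j2.const_mul _), integral_const_mul, e1, e2]
    ring
  rw [e3]
  refine integral_mono (j1.sub (j2.const_mul _)) ?_ fun z => ?_
  · refine integrable_gaussianMajorant.mono' (by fun_prop) (.of_forall fun z => ?_)
    have := exp_sq_rotationIncrement_le hF one_pos z
    rw [Real.norm_eq_abs, abs_of_pos (Real.exp_pos _)]
    simpa [rotationIncrement] using this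
  -- With a = F(x), b = F(y), c = 1/200, one has exp(c(b-a)²) = exp(cb²)·exp(ca² - 2cab) ≥
  -- exp(cb²)(1 - 2cab). The last term has mean zero since F(x) is independent of y and odd; this
  -- removes the second copy.
  · have h1 := Real.add_one_le_exp (1 / 200 * F z.1 ^ 2 - 1 / 100 * (F z.1 * F z.2))
    have h2 : Real.exp (1 / 200 * (F z.2 - F z.1) ^ 2) = Real.exp (1 / 200 * F z.2 ^ 2) *
        Real.exp (1 / 200 * F z.1 ^ 2 - 1 / 100 * (F z.1 * F z.2)) := by
      rw [← Real.exp_add]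
      ring_nf
    simp only [h2]
    have h3 := Real.exp_pos (1 / 200 * F z.2 ^ 2)
    nlinarith [sq_nonneg (F z.1)]

end Concentration

/-! ### Concentration on the sphere -/

section SphereConcentration

open ProbabilityTheory

variable {d : ℕ} {H : Vec d → ℝ}

theorem integrable_of_continuous_of_compactSpace {X : Type*} [TopologicalSpace X] [CompactSpace X]
    [MeasurableSpace X] [OpensMeasurableSpace X] [SecondCountableTopology X]
    {μ : Measure X} [IsFiniteMeasure μ] {g : X → ℝ}
    (hg : Continuous g) : Integrable g μ := by
  obtain ⟨C, hC⟩ := isCompact_univ.exists_bound_of_continuousOn hg.continuousOn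
  exact Integrable.of_bound hg.aestronglyMeasurable C (.of_forall fun x => hC x (Set.mem_univ x))

theorem abs_le_norm_of_lipschitz_odd (hH : LipschitzWith 1 H) (hodd : ∀ x, H (-x) = -H x)
    (x : Vec d) : |H x| ≤ ‖x‖ := by
  have h0 : H 0 = 0 := by
    have := hodd 0
    rw [neg_zero] at this
    linarith
  have h := hH.dist_le_mul x 0
  rw [Real.dist_eq, h0, sub_zero, dist_zero_right] at h
  simpa using h

theorem norm_direction_le (x : Vec d) : ‖‖x‖⁻¹ • x‖ ≤ 1 := by
  rw [norm_smul, norm_inv, norm_norm]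
  exact inv_mul_le_one

theorem norm_smul_direction (x : Vec d) : ‖x‖ • (‖x‖⁻¹ • x) = x := by
  by_cases hx : x = 0
  · simp [hx]
  · rw [smul_smul, mul_inv_cancel₀ (norm_ne_zero_iff.2 hx), one_smul]

/-- The homogeneous extension of the restriction of an odd Lipschitz function to the sphere. -/
theorem lipschitzWith_homogeneous_extension (hH : LipschitzWith 1 H)
    (hodd : ∀ x, H (-x) = -H x) :
    LipschitzWith 3 fun x : Vec d => ‖x‖ * H (‖x‖⁻¹ • x) := by
  refine LipschitzWith.of_dist_le_mul fun x y => ?_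
  rw [Real.dist_eq, dist_eq_norm]
  push_cast
  set u := ‖x‖⁻¹ • x with hu
  set w := ‖y‖⁻¹ • y with hw
  have h1 : |H u| ≤ 1 := (abs_le_norm_of_lipschitz_odd hH hodd u).trans (norm_direction_le x)
  have h2 : |H u - H w| ≤ ‖u - w‖ := by
    have := hH.dist_le_mul u w
    rwa [Real.dist_eq, dist_eq_norm, NNReal.coe_one, one_mul] at this
  -- The scaled direction map contributes 2 and the change of norm contributes 1; this is the origin
  -- of the Lipschitz constant 3 in the Gaussian estimates.
  have h3 : ‖y‖ * ‖u - w‖ ≤ 2 * ‖x - y‖ := by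
    have e : ‖y‖ • (u - w) = (‖y‖ - ‖x‖) • u + (x - y) := by
      calc ‖y‖ • (u - w) = (‖y‖ - ‖x‖) • u + (‖x‖ • u - ‖y‖ • w) := by module
        _ = _ := by rw [hu, hw, norm_smul_direction, norm_smul_direction]
    calc ‖y‖ * ‖u - w‖ = ‖‖y‖ • (u - w)‖ := by rw [norm_smul, norm_norm]
      _ ≤ ‖(‖y‖ - ‖x‖) • u‖ + ‖x - y‖ := by rw [e]; exact norm_add_le _ _
      _ ≤ ‖x - y‖ * 1 + ‖x - y‖ := by
          rw [norm_smul, Real.norm_eq_abs, norm_sub_rev x y]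
          gcongr
          · exact abs_norm_sub_norm_le y x
          · exact norm_direction_le x
      _ = _ := by ring
  have e : ‖x‖ * H u - ‖y‖ * H w = (‖x‖ - ‖y‖) * H u + ‖y‖ * (H u - H w) := by ring
  calc |‖x‖ * H u - ‖y‖ * H w| ≤ |(‖x‖ - ‖y‖) * H u| + |‖y‖ * (H u - H w)| := by
        rw [e]; exact abs_add_le _ _
    _ ≤ ‖x - y‖ * 1 + ‖y‖ * ‖u - w‖ := by
        rw [abs_mul, abs_mul, abs_norm]
        gcongr
        exact abs_norm_sub_norm_le x y
    _ ≤ _ := by linarith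

/-- Concentration on the sphere for odd Lipschitz functions. -/
theorem integral_exp_sq_uniformSphere_le [NeZero d] (hH : LipschitzWith 1 H)
    (hodd : ∀ x, H (-x) = -H x) :
    ∫ e : UnitSphere d, Real.exp (d / 200 * H e ^ 2) ∂uniformSphere d ≤ 2 := by
  set F : Vec d → ℝ := fun x => ‖x‖ * H (‖x‖⁻¹ • x) with hF
  have hFL : LipschitzWith 3 F := lipschitzWith_homogeneous_extension hH hodd
  have hFodd : ∀ x, F (-x) = -F x := by
    intro x
    simp only [hF, norm_neg, smul_neg, hodd, mul_neg]
  refine le_trans ?_ (integral_exp_sq_stdGaussian_le hFL hFodd)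
  set φ : Vec d → ℝ := fun x => Real.exp (d / 200 * H x ^ 2) with hφ
  set ψ : Vec d → ℝ := fun x => 1 / 200 * H x ^ 2 * φ x with hψ
  have hHc := hH.continuous
  have hφb : ∀ x : Vec d, |φ (‖x‖⁻¹ • x)| ≤ Real.exp d := by
    intro x
    rw [abs_of_pos (Real.exp_pos _), Real.exp_le_exp]
    have h1 := (abs_le_norm_of_lipschitz_odd hH hodd (‖x‖⁻¹ • x)).trans (norm_direction_le x)
    have h2 : H (‖x‖⁻¹ • x) ^ 2 ≤ 1 := by rwa [sq_le_one_iff_abs_le_one]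
    have h3 : (0:ℝ) ≤ d := by positivity
    nlinarith
  have hψb : ∀ x : Vec d, |ψ (‖x‖⁻¹ • x)| ≤ Real.exp d := by
    intro x
    have h1 := (abs_le_norm_of_lipschitz_odd hH hodd (‖x‖⁻¹ • x)).trans (norm_direction_le x)
    have h2 : H (‖x‖⁻¹ • x) ^ 2 ≤ 1 := by rwa [sq_le_one_iff_abs_le_one]
    simp only [hψ]
    rw [abs_mul, abs_of_nonneg (a := 1 / 200 * H (‖x‖⁻¹ • x) ^ 2) (by positivity)]
    calc _ ≤ 1 * Real.exp d := by
          gcongr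
          · linarith
          · exact hφb x
      _ = _ := one_mul _
  have hdir : Measurable fun x : Vec d => ‖x‖⁻¹ • x := by fun_prop
  have i1 : Integrable (fun x : Vec d => φ (‖x‖⁻¹ • x)) (stdGaussian (Vec d)) :=
    Integrable.of_bound (Measurable.aestronglyMeasurable (by fun_prop)) _ (.of_forall hφb)
  have i2 : Integrable (fun x : Vec d => ψ (‖x‖⁻¹ • x)) (stdGaussian (Vec d)) :=
    Integrable.of_bound (Measurable.aestronglyMeasurable (by fun_prop)) _ (.of_forall hψb)
  have i3 : Integrable (fun x : Vec d => ψ (‖x‖⁻¹ • x) * ‖x‖ ^ 2) (stdGaussian (Vec d)) :=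
    integrable_norm_sq_stdGaussian.bdd_mul i2.aestronglyMeasurable (.of_forall hψb)
  have e1 := integral_stdGaussian_direction_mul_norm φ fun _ => 1
  have e2 := integral_stdGaussian_direction_mul_norm ψ fun t => t ^ 2
  have e3 := integral_stdGaussian_direction_mul_norm ψ fun _ => 1
  rw [integral_norm_sq_stdGaussian] at e2
  simp only [mul_one, integral_const, probReal_univ, smul_eq_mul] at e1 e3
  -- Jensen in the radial variable, written as a tangent line inequality. By independence and E‖X‖²
  -- = d, the added term ψ·(‖X‖² - d) has mean zero, and φ + ψ·(‖X‖² - d) lies below exp(F²/200)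
  -- pointwise.
  have key : ∫ e : UnitSphere d, φ e ∂uniformSphere d
      = ∫ x : Vec d, (φ (‖x‖⁻¹ • x) + (ψ (‖x‖⁻¹ • x) * ‖x‖ ^ 2 - d * ψ (‖x‖⁻¹ • x)))
        ∂stdGaussian (Vec d) := by
    have i4 : Integrable (fun x : Vec d => ψ (‖x‖⁻¹ • x) * ‖x‖ ^ 2 - d * ψ (‖x‖⁻¹ • x))
        (stdGaussian (Vec d)) := i3.sub (i2.const_mul _)
    rw [integral_add i1 i4, integral_sub i3 (i2.const_mul _),
      integral_const_mul, e1, e2, e3]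
    ring
  rw [show ∫ e : UnitSphere d, Real.exp (d / 200 * H e ^ 2) ∂uniformSphere d
    = ∫ e : UnitSphere d, φ e ∂uniformSphere d from rfl, key]
  refine integral_mono (i1.add (i3.sub (i2.const_mul _))) ?_ fun x => ?_
  · exact integrable_exp_sq_of_lipschitz hFL (by simp [hF]) (by norm_num)
  · set t := H (‖x‖⁻¹ • x) with ht
    have h1 := Real.add_one_le_exp (1 / 200 * t ^ 2 * (‖x‖ ^ 2 - d))
    have h2 : Real.exp (1 / 200 * F x ^ 2)
        = φ (‖x‖⁻¹ • x) * Real.exp (1 / 200 * t ^ 2 * (‖x‖ ^ 2 - d)) := by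
      simp only [hφ, hF, ← ht]
      rw [← Real.exp_add]
      ring_nf
    simp only [h2, hψ]
    have h3 : 0 < φ (‖x‖⁻¹ • x) := Real.exp_pos _
    nlinarith

/-- The coordinates of the two-point estimator have exponential moments. -/
theorem integral_exp_abs_mul_coord_le [NeZero d] (hH : LipschitzWith 1 H)
    (hodd : ∀ x, H (-x) = -H x) (i : Fin d) :
    ∫ e : UnitSphere d, Real.exp (1 / 200 * |d * H e * (e : Vec d) i|) ∂uniformSphere d ≤ 2 := by
  have hcoord : LipschitzWith 1 fun x : Vec d => x i := by
    refine LipschitzWith.of_dist_le_mul fun x y => ?_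
    rw [NNReal.coe_one, one_mul, dist_eq_norm, dist_eq_norm]
    exact PiLp.norm_apply_le (x - y) i
  have h1 := integral_exp_sq_uniformSphere_le hH hodd
  have h2 := integral_exp_sq_uniformSphere_le hcoord (fun x => by simp)
  have hHc := hH.continuous
  have hcc := hcoord.continuous
  have i1 : Integrable (fun e : UnitSphere d => Real.exp (d / 200 * H e ^ 2)) (uniformSphere d) :=
    integrable_of_continuous_of_compactSpace (by fun_prop)
  have i2 : Integrable (fun e : UnitSphere d => Real.exp (d / 200 * (e : Vec d) i ^ 2))
      (uniformSphere d) :=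
    integrable_of_continuous_of_compactSpace (by fun_prop)
  calc _ ≤ ∫ e : UnitSphere d, 1 / 2 * (Real.exp (d / 200 * H e ^ 2)
        + Real.exp (d / 200 * (e : Vec d) i ^ 2)) ∂uniformSphere d := by
        refine integral_mono_of_nonneg (.of_forall fun e => (Real.exp_pos _).le)
          ((i1.add i2).const_mul _) (.of_forall fun e => ?_)
        -- Since 2|H·e_i| ≤ H² + e_i², the exponential splits into two factors, each controlled by
        -- concentration: the coordinate e_i is itself an odd 1-Lipschitz function.
        have hd : (0:ℝ) ≤ d := by positivity
        have ha : 1 / 200 * |d * H e * (e : Vec d) i|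
            ≤ d / 400 * H e ^ 2 + d / 400 * (e : Vec d) i ^ 2 := by
          rw [abs_mul, abs_mul, abs_of_nonneg hd, ← sq_abs (H e), ← sq_abs ((e : Vec d) i)]
          nlinarith [mul_nonneg hd (sq_nonneg (|H e| - |(e : Vec d) i|))]
        refine (Real.exp_le_exp.2 ha).trans ?_
        have e1 : Real.exp (d / 200 * H e ^ 2) = Real.exp (d / 400 * H e ^ 2) ^ 2 := by
          rw [← Real.exp_nat_mul]; push_cast; ring_nf
        have e2 : Real.exp (d / 200 * (e : Vec d) i ^ 2)
            = Real.exp (d / 400 * (e : Vec d) i ^ 2) ^ 2 := by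
          rw [← Real.exp_nat_mul]; push_cast; ring_nf
        simp only [Real.exp_add, e1, e2]
        nlinarith [sq_nonneg (Real.exp (d / 400 * H e ^ 2) - Real.exp (d / 400 * (e : Vec d) i ^ 2))]
    _ ≤ 2 := by
        rw [integral_const_mul, integral_add i1 i2]
        linarith

theorem integral_neg_uniformSphere [NeZero d] (φ : Vec d → ℝ) :
    ∫ e : UnitSphere d, φ (-e) ∂uniformSphere d = ∫ e : UnitSphere d, φ e ∂uniformSphere d := by
  have h1 := integral_stdGaussian_direction_mul_norm φ fun _ => 1
  have h2 := integral_stdGaussian_direction_mul_norm (fun x => φ (-x)) fun _ => 1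
  simp only [mul_one, integral_const, probReal_univ, smul_eq_mul] at h1 h2
  rw [← h1, ← h2]
  have h := stdGaussian_map (LinearIsometryEquiv.neg ℝ (E := Vec d))
  conv_rhs => rw [← h]
  refine Eq.trans ?_ ((LinearIsometryEquiv.neg ℝ
    (E := Vec d)).toHomeomorph.measurableEmbedding.integral_map _).symm
  simp

end SphereConcentration

/-! ### Sums of independent variables with exponential moments -/

section ExpMoments

variable {Ω : Type*} [MeasurableSpace Ω] {μ : Measure Ω} [IsProbabilityMeasure μ]

theorem exp_le_one_add_add_sq_mul_exp_abs (x : ℝ) :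
    Real.exp x ≤ 1 + x + x ^ 2 * Real.exp |x| := by
  have h1 := Real.add_one_le_exp |x|
  rcases le_total |x| 1 with h | h
  · have := (abs_le.1 (Real.abs_exp_sub_one_sub_id_le h)).2
    have h0 := abs_nonneg x
    nlinarith [sq_nonneg x]
  · rcases le_total 0 x with hx | hx
    · rw [abs_of_nonneg hx] at *
      have hx2 : 1 ≤ x ^ 2 := one_le_pow₀ h
      nlinarith [mul_le_mul_of_nonneg_right hx2 (Real.exp_pos x).le]
    · rw [abs_of_nonpos hx] at *
      have := Real.exp_le_one_iff.2 hx
      nlinarith [sq_nonneg x]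

/-- The linear Taylor term has mean zero. In the remainder |lξ| ≤ θ|ξ|/2, so half of the available
exponential rate dominates the square through u² ≤ 8e^(u/2); the constant is 32 = 8·4. -/
theorem integral_exp_mul_le_of_centered {ξ : Ω → ℝ} {θ l : ℝ} (hθ : 0 < θ) (hξ : Integrable ξ μ)
    (h0 : ∫ ω, ξ ω ∂μ = 0) (hexp : Integrable (fun ω => Real.exp (θ * |ξ ω|)) μ)
    (h4 : ∫ ω, Real.exp (θ * |ξ ω|) ∂μ ≤ 4) (hl : |l| ≤ θ / 2) :
    ∫ ω, Real.exp (l * ξ ω) ∂μ ≤ Real.exp (32 * (l / θ) ^ 2) := by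
  have hpt : ∀ ω, Real.exp (l * ξ ω)
      ≤ 1 + l * ξ ω + 8 * (l / θ) ^ 2 * Real.exp (θ * |ξ ω|) := by
    intro ω
    refine (exp_le_one_add_add_sq_mul_exp_abs _).trans ?_
    gcongr 1 + l * ξ ω + ?_
    set u := θ * |ξ ω| with hu
    have hu0 : 0 ≤ u := by positivity
    have e1 : (l * ξ ω) ^ 2 = (l / θ) ^ 2 * u ^ 2 := by
      rw [hu, mul_pow, mul_pow, sq_abs]
      field_simp
    have e2 : |l * ξ ω| ≤ u / 2 := by
      rw [abs_mul, hu]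
      nlinarith [abs_nonneg (ξ ω)]
    have e3 : u ^ 2 ≤ 8 * Real.exp (u / 2) := by
      have := Real.quadratic_le_exp_of_nonneg (x := u / 2) (by positivity)
      nlinarith
    calc (l * ξ ω) ^ 2 * Real.exp |l * ξ ω|
        ≤ (l / θ) ^ 2 * (8 * Real.exp (u / 2)) * Real.exp (u / 2) := by
          rw [e1]
          gcongr
      _ = 8 * (l / θ) ^ 2 * Real.exp u := by
          have : Real.exp u = Real.exp (u / 2) * Real.exp (u / 2) := by
            rw [← Real.exp_add]; ring_nf
          rw [this]
          ring
  have hlin : Integrable (fun ω => 1 + l * ξ ω) μ := (integrable_const _).add (hξ.const_mul _)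
  have hsum : Integrable (fun ω => 1 + l * ξ ω + 8 * (l / θ) ^ 2 * Real.exp (θ * |ξ ω|)) μ :=
    hlin.add (hexp.const_mul _)
  calc ∫ ω, Real.exp (l * ξ ω) ∂μ
      ≤ ∫ ω, (1 + l * ξ ω + 8 * (l / θ) ^ 2 * Real.exp (θ * |ξ ω|)) ∂μ :=
        integral_mono_of_nonneg (.of_forall fun ω => (Real.exp_pos _).le) hsum (.of_forall hpt)
    _ = 1 + 8 * (l / θ) ^ 2 * ∫ ω, Real.exp (θ * |ξ ω|) ∂μ := by
        rw [integral_add hlin (hexp.const_mul _),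
          integral_add (integrable_const _) (hξ.const_mul _), integral_const_mul,
          integral_const_mul, h0]
        simp
    _ ≤ 32 * (l / θ) ^ 2 + 1 := by nlinarith [sq_nonneg (l / θ)]
    _ ≤ _ := Real.add_one_le_exp _

theorem integral_exp_mul_sum_le {B : ℕ} {ξ : Ω → ℝ} {l K : ℝ}
    (h : ∫ ω, Real.exp (l * ξ ω) ∂μ ≤ Real.exp K) :
    ∫ ω : Fin B → Ω, Real.exp (l * ∑ j, ξ (ω j)) ∂Measure.pi (fun _ => μ) ≤ Real.exp (B * K) := by
  have h1 : ∀ ω : Fin B → Ω, Real.exp (l * ∑ j, ξ (ω j)) = ∏ j, Real.exp (l * ξ (ω j)) := by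
    intro ω
    rw [Finset.mul_sum, Real.exp_sum]
  simp only [h1]
  rw [integral_fintype_prod_eq_prod (f := fun _ ω => Real.exp (l * ξ ω)), Finset.prod_const,
    Finset.card_univ, Fintype.card_fin, Real.exp_nat_mul]
  exact pow_le_pow_left₀ (integral_nonneg fun ω => (Real.exp_pos _).le) h B

end ExpMoments

/-! ### Convex Lipschitz extensions -/

section Extension

variable {d : ℕ} {p : ℝ≥0∞}

/-- A convex function that is Lipschitz for a `p`-norm on a convex set extends to the whole space. -/
theorem exists_convex_lipschitz_extension (hp : 1 ≤ p) {S : Set (Vec d)} (hS : S.Nonempty)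
    {f : Vec d → ℝ} (hf : ConvexOn ℝ S f) {M : ℝ} (hM : 0 ≤ M)
    (hL : ∀ x ∈ S, ∀ y ∈ S, |f y - f x| ≤ M * pNorm p (y - x)) :
    ∃ F : Vec d → ℝ, ConvexOn ℝ Set.univ F ∧ (∀ x y, |F y - F x| ≤ M * pNorm p (y - x)) ∧
      ∀ x ∈ S, F x = f x := by
  have : Nonempty S := hS.to_subtype
  obtain ⟨x₀, hx₀⟩ := hS
  -- The infimal convolution of f on S with the multiple M of the norm: convex because both
  -- ingredients are, Lipschitz as an infimum of Lipschitz functions, and equal to f on S by the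
  -- Lipschitz bound there.
  set F : Vec d → ℝ := fun y => ⨅ x : S, (f x + M * pNorm p (y - (x : Vec d))) with hF
  have htri : ∀ a b c : Vec d, pNorm p (a - c) ≤ pNorm p (a - b) + pNorm p (b - c) := by
    intro a b c
    have := pNorm_add_le hp (a - b) (b - c)
    rwa [sub_add_sub_cancel] at this
  have hlow : ∀ y z : Vec d, z ∈ S → ∀ x : S, f z - M * pNorm p (y - z) ≤ f x + M * pNorm p (y - (x : Vec d)) := by
    intro y z hz x
    have h1 := (abs_le.1 (hL z hz x x.2)).1
    have h2 := mul_le_mul_of_nonneg_left (htri x y z) hM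
    rw [pNorm_sub_comm hp (x : Vec d) y] at h2
    linarith
  have hbdd : ∀ y, BddBelow (Set.range fun x : S => f x + M * pNorm p (y - (x : Vec d))) :=
    fun y => ⟨f x₀ - M * pNorm p (y - x₀), by rintro _ ⟨x, rfl⟩; exact hlow y x₀ hx₀ x⟩
  have hone : ∀ x y, F y ≤ F x + M * pNorm p (y - x) := by
    intro x y
    rw [← sub_le_iff_le_add]
    refine le_ciInf fun z => ?_
    have h1 : F y ≤ f z + M * pNorm p (y - (z : Vec d)) := ciInf_le (hbdd y) z
    have h2 := mul_le_mul_of_nonneg_left (htri y x (z : Vec d)) hM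
    linarith
  refine ⟨F, ⟨convex_univ, ?_⟩, ?_, ?_⟩
  · intro y₁ _ y₂ _ a b ha hb hab
    refine le_of_forall_pos_le_add fun ε hε => ?_
    obtain ⟨x₁, h₁⟩ := exists_lt_of_ciInf_lt (show F y₁ < F y₁ + ε by linarith)
    obtain ⟨x₂, h₂⟩ := exists_lt_of_ciInf_lt (show F y₂ < F y₂ + ε by linarith)
    have hmem : a • (x₁ : Vec d) + b • (x₂ : Vec d) ∈ S := hf.1 x₁.2 x₂.2 ha hb hab
    have h3 : F (a • y₁ + b • y₂) ≤ f (a • (x₁ : Vec d) + b • (x₂ : Vec d))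
        + M * pNorm p (a • y₁ + b • y₂ - (a • (x₁ : Vec d) + b • (x₂ : Vec d))) :=
      ciInf_le (hbdd _) (⟨_, hmem⟩ : S)
    have h4 := hf.2 x₁.2 x₂.2 ha hb hab
    have h5 : pNorm p (a • y₁ + b • y₂ - (a • (x₁ : Vec d) + b • (x₂ : Vec d)))
        ≤ a * pNorm p (y₁ - (x₁ : Vec d)) + b * pNorm p (y₂ - (x₂ : Vec d)) := by
      have e : a • y₁ + b • y₂ - (a • (x₁ : Vec d) + b • (x₂ : Vec d))
          = a • (y₁ - (x₁ : Vec d)) + b • (y₂ - (x₂ : Vec d)) := by module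
      rw [e]
      refine (pNorm_add_le hp _ _).trans (le_of_eq ?_)
      rw [pNorm_smul hp, pNorm_smul hp, abs_of_nonneg ha, abs_of_nonneg hb]
    have h6 := mul_le_mul_of_nonneg_left h5 hM
    simp only [smul_eq_mul] at h4 ⊢
    have h7 := mul_le_mul_of_nonneg_left h₁.le ha
    have h8 := mul_le_mul_of_nonneg_left h₂.le hb
    have h9 : a * (F y₁ + ε) + b * (F y₂ + ε) = a * F y₁ + b * F y₂ + ε := by
      linear_combination ε * hab
    nlinarith
  · intro x y
    rw [abs_le]
    have h1 := hone x y
    have h2 := hone y x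
    rw [pNorm_sub_comm hp] at h2
    constructor <;> linarith
  · intro x hx
    refine le_antisymm ?_ (le_ciInf fun z => ?_)
    · have := ciInf_le (hbdd x) (⟨x, hx⟩ : S)
      simpa [pNorm_zero hp] using this
    · have := hlow x x hx z
      simpa [pNorm_zero hp] using this

end Extension

/-! ### The smoothed function and the spherical gradient estimator -/

section Smoothing

variable {d : ℕ} {γ : ℝ} {F : Vec d → ℝ}

/-- The average of `F` over the ball of radius `γ` about `x`. -/
noncomputable def ballAverage (γ : ℝ) (F : Vec d → ℝ) (x : Vec d) : ℝ :=
  ((volume : Measure (Vec d)).real (Metric.ball 0 1))⁻¹ *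
    ∫ u in Metric.ball (0 : Vec d) 1, F (x + γ • u)

/-- The expectation of the two-point estimator of the gradient. -/
noncomputable def sphereGradient (γ : ℝ) (F : Vec d → ℝ) (x : Vec d) : Vec d :=
  ∫ e : UnitSphere d, ((d : ℝ) * ((F (x + γ • (e : Vec d)) - F (x - γ • (e : Vec d))) / (2 * γ))) •
    (e : Vec d) ∂uniformSphere d

theorem ballAverage_congr {G : Vec d → ℝ} {x : Vec d}
    (h : ∀ u : Vec d, ‖u‖ ≤ 1 → F (x + γ • u) = G (x + γ • u)) :
    ballAverage γ F x = ballAverage γ G x := by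
  unfold ballAverage
  congr 1
  refine setIntegral_congr_fun measurableSet_ball fun u hu => h u ?_
  simpa using (Metric.mem_ball.1 hu).le

theorem sphereGradient_congr {G : Vec d → ℝ} {x : Vec d}
    (h : ∀ u : Vec d, ‖u‖ ≤ 1 → F (x + γ • u) = G (x + γ • u)) :
    sphereGradient γ F x = sphereGradient γ G x := by
  unfold sphereGradient
  refine integral_congr_ae (.of_forall fun e => ?_)
  have he : ‖(e : Vec d)‖ = 1 := by simp
  have h1 := h e he.le
  have h2 := h (-e) (by rw [norm_neg, he])
  rw [smul_neg, ← sub_eq_add_neg] at h2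
  simp only [h1, h2]

theorem volume_real_ball_pos : 0 < (volume : Measure (Vec d)).real (Metric.ball 0 1) :=
  ENNReal.toReal_pos (Metric.measure_ball_pos _ _ one_pos).ne' measure_ball_lt_top.ne

theorem integrableOn_ball {G : Vec d → ℝ} (hG : Continuous G) :
    IntegrableOn G (Metric.ball (0 : Vec d) 1) :=
  (hG.continuousOn.integrableOn_compact (isCompact_closedBall _ _)).mono_set
    Metric.ball_subset_closedBall

theorem ballAverage_mono {G : Vec d → ℝ} (hF : Continuous F) (hG : Continuous G) {x y : Vec d}
    {c : ℝ} (h : ∀ u : Vec d, ‖u‖ ≤ 1 → F (x + γ • u) ≤ G (y + γ • u) + c) :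
    ballAverage γ F x ≤ ballAverage γ G y + c := by
  have hV := volume_real_ball_pos (d := d)
  have h1 : ∫ u in Metric.ball (0 : Vec d) 1, F (x + γ • u)
      ≤ (∫ u in Metric.ball (0 : Vec d) 1, G (y + γ • u))
        + (volume : Measure (Vec d)).real (Metric.ball 0 1) * c := by
    have e : (volume : Measure (Vec d)).real (Metric.ball 0 1) * c
        = ∫ _u in Metric.ball (0 : Vec d) 1, c := by
      rw [setIntegral_const, smul_eq_mul]
    rw [e, ← integral_add (integrableOn_ball (by fun_prop)) (integrableOn_ball (by fun_prop))]
    refine setIntegral_mono_on (integrableOn_ball (by fun_prop)) (integrableOn_ball (by fun_prop))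
      measurableSet_ball fun u hu => h u ?_
    simpa using (Metric.mem_ball.1 hu).le
  unfold ballAverage
  have h2 := mul_le_mul_of_nonneg_left h1 (inv_pos.2 hV).le
  rwa [mul_add, inv_mul_cancel_left₀ hV.ne'] at h2

theorem ballAverage_le {K : NNReal} (hK : LipschitzWith K F) (hγ : 0 ≤ γ) (x : Vec d) :
    ballAverage γ F x ≤ F x + γ * K := by
  have hV := volume_real_ball_pos (d := d)
  have h := ballAverage_mono (d := d) (γ := γ) (F := F) (G := fun _ => F x) hK.continuous
    continuous_const (x := x) (y := x) (c := γ * K) fun u hu => by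
      have := hK.dist_le_mul (x + γ • u) x
      rw [Real.dist_eq, dist_eq_norm, add_sub_cancel_left, norm_smul, Real.norm_eq_abs,
        abs_of_nonneg hγ] at this
      have h1 := (abs_le.1 this).2
      have h2 : γ * ‖u‖ ≤ γ := by nlinarith
      have h3 := mul_le_mul_of_nonneg_left h2 K.2
      simp only [NNReal.val_eq_coe] at h3
      linarith
  refine h.trans (le_of_eq ?_)
  unfold ballAverage
  rw [setIntegral_const, smul_eq_mul, inv_mul_cancel_left₀ hV.ne']

/-- The ball is symmetric, so the average may be taken over the pairs x ± γu, whose midpoint is x.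
-/
theorem le_ballAverage (hF : ConvexOn ℝ Set.univ F) (hFc : Continuous F) (x : Vec d) :
    F x ≤ ballAverage γ F x := by
  have hV := volume_real_ball_pos (d := d)
  have hsymm : ∫ u in Metric.ball (0 : Vec d) 1, F (x + γ • (-u))
      = ∫ u in Metric.ball (0 : Vec d) 1, F (x + γ • u) := by
    have h : ∀ u : Vec d, (Metric.ball (0 : Vec d) 1).indicator (fun u => F (x + γ • (-u))) u
        = (Metric.ball (0 : Vec d) 1).indicator (fun u => F (x + γ • u)) (-u) := by
      intro u
      simp [Set.indicator]
    rw [← integral_indicator measurableSet_ball, ← integral_indicator measurableSet_ball,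
      integral_congr_ae (.of_forall h)]
    exact integral_neg_eq_self (fun u => (Metric.ball (0 : Vec d) 1).indicator
      (fun u => F (x + γ • u)) u) volume
  have h1 : ∫ _u in Metric.ball (0 : Vec d) 1, F x
      ≤ ∫ u in Metric.ball (0 : Vec d) 1, 1 / 2 * (F (x + γ • u) + F (x + γ • (-u))) := by
    refine setIntegral_mono_on (integrableOn_ball (by fun_prop)) (integrableOn_ball (by fun_prop))
      measurableSet_ball fun u _ => ?_
    have := hF.2 (Set.mem_univ (x + γ • u)) (Set.mem_univ (x + γ • (-u)))
      (show (0:ℝ) ≤ 1 / 2 by norm_num) (show (0:ℝ) ≤ 1 / 2 by norm_num) (by norm_num)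
    have e : (1 / 2 : ℝ) • (x + γ • u) + (1 / 2 : ℝ) • (x + γ • (-u)) = x := by module
    rw [e] at this
    simp only [smul_eq_mul] at this
    linarith
  rw [integral_const_mul, integral_add (integrableOn_ball (by fun_prop))
    (integrableOn_ball (by fun_prop)), hsymm, setIntegral_const, smul_eq_mul] at h1
  unfold ballAverage
  rw [le_inv_mul_iff₀ hV]
  linarith

variable [NeZero d]

theorem inner_sphereGradient (hF : Continuous F) (x v : Vec d) :
    inner ℝ (sphereGradient γ F x) v = ∫ e : UnitSphere d,
      (d : ℝ) * ((F (x + γ • (e : Vec d)) - F (x - γ • (e : Vec d))) / (2 * γ)) *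
        inner ℝ (e : Vec d) v ∂uniformSphere d := by
  have hi : Integrable (fun e : UnitSphere d => ((d : ℝ) * ((F (x + γ • (e : Vec d))
      - F (x - γ • (e : Vec d))) / (2 * γ))) • (e : Vec d)) (uniformSphere d) := by
    obtain ⟨C, hC⟩ := (isCompact_univ (X := UnitSphere d)).exists_bound_of_continuousOn
      (f := fun e : UnitSphere d => ((d : ℝ) * ((F (x + γ • (e : Vec d))
        - F (x - γ • (e : Vec d))) / (2 * γ))) • (e : Vec d)) (by fun_prop)
    exact Integrable.of_bound (Continuous.aestronglyMeasurable (by fun_prop)) C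
      (.of_forall fun x => hC x (Set.mem_univ x))
  rw [real_inner_comm, sphereGradient, ← integral_inner hi]
  refine integral_congr_ae (.of_forall fun e => ?_)
  simp only [inner_smul_right, real_inner_comm]

/-- The sphere is symmetric, so both halves of the two-point difference contribute equally. -/
theorem inner_sphereGradient_eq (hF : Continuous F) (hγ : 0 < γ) (x v : Vec d) :
    inner ℝ (sphereGradient γ F x) v =
      d / γ * ∫ e : UnitSphere d, inner ℝ (e : Vec d) v * F (x + γ • (e : Vec d)) ∂uniformSphere d := by
  have hneg := integral_neg_uniformSphere (d := d) fun e => inner ℝ e v * F (x + γ • e)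
  have i1 : Integrable (fun e : UnitSphere d => inner ℝ (e : Vec d) v * F (x + γ • (e : Vec d)))
      (uniformSphere d) := integrable_of_continuous_of_compactSpace (by fun_prop)
  have i2 : Integrable (fun e : UnitSphere d => inner ℝ (-(e : Vec d)) v * F (x + γ • (-(e : Vec d))))
      (uniformSphere d) := integrable_of_continuous_of_compactSpace (by fun_prop)
  have h : ∀ e : UnitSphere d, (d : ℝ) * ((F (x + γ • (e : Vec d)) - F (x - γ • (e : Vec d))) / (2 * γ)) *
        inner ℝ (e : Vec d) v = d / (2 * γ) * (inner ℝ (e : Vec d) v * F (x + γ • (e : Vec d))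
          + inner ℝ (-(e : Vec d)) v * F (x + γ • (-(e : Vec d)))) := by
    intro e
    rw [inner_neg_left, smul_neg, ← sub_eq_add_neg]
    field_simp
    ring
  rw [inner_sphereGradient hF, integral_congr_ae (.of_forall h), integral_const_mul,
    integral_add i1 i2, hneg]
  field_simp
  ring

/-- The spherical gradient is a subgradient of the ball average. -/
theorem inner_sphereGradient_le (hF : ConvexOn ℝ Set.univ F) {K : NNReal} (hK : LipschitzWith K F)
    (hγ : 0 < γ) (x v : Vec d) :
    inner ℝ (sphereGradient γ F x) v ≤ ballAverage γ F (x + v) - ballAverage γ F x := by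
  have hV := volume_real_ball_pos (d := d)
  have hFc := hK.continuous
  have hGconv : ConvexOn ℝ Set.univ fun u : Vec d => F (x + γ • u) := by
    refine ⟨convex_univ, fun u _ w _ a b ha hb hab => ?_⟩
    have := hF.2 (Set.mem_univ (x + γ • u)) (Set.mem_univ (x + γ • w)) ha hb hab
    have e : x + γ • (a • u + b • w) = a • (x + γ • u) + b • (x + γ • w) := by
      calc x + γ • (a • u + b • w) = (a + b) • x + γ • (a • u + b • w) := by rw [hab, one_smul]
        _ = _ := by module
    simpa only [e] using this
  have hGL : LipschitzWith (K * Real.toNNReal γ) fun u : Vec d => F (x + γ • u) := by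
    refine hK.comp (LipschitzWith.of_dist_le_mul fun u w => ?_)
    rw [dist_eq_norm, dist_eq_norm, add_sub_add_left_eq_sub, ← smul_sub, norm_smul,
      Real.coe_toNNReal _ hγ.le, Real.norm_eq_abs, abs_of_pos hγ]
  -- The divergence inequality is applied to u ↦ F(x + γu); the shift v/γ in u becomes the shift v
  -- of the argument of F.
  have h := flux_le_integral_ball hGconv hGL (γ⁻¹ • v)
  have e1 : ∀ u : Vec d, x + γ • (u + γ⁻¹ • v) = x + v + γ • u := by
    intro u
    rw [smul_add, smul_smul, mul_inv_cancel₀ hγ.ne', one_smul]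
    abel
  simp only [e1, inner_smul_right] at h
  rw [integral_sub (integrableOn_ball (by fun_prop)) (integrableOn_ball (by fun_prop))] at h
  rw [inner_sphereGradient_eq hFc hγ]
  unfold ballAverage
  rw [← mul_sub, le_inv_mul_iff₀ hV]
  refine le_trans (le_of_eq ?_) h
  simp only [mul_assoc]
  rw [integral_const_mul]
  ring

/-- The first moment is bounded by the root of the second, which is ‖v‖²/d. This gain of √d over
|⟨e, v⟩| ≤ ‖v‖ leads to √d in the smoothness constant and so to d^(1/4) in the iteration count. -/
theorem integral_abs_inner_uniformSphere_le (v : Vec d) :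
    ∫ e : UnitSphere d, |inner ℝ (e : Vec d) v| ∂uniformSphere d ≤ ‖v‖ / √d := by
  rcases eq_or_ne v 0 with rfl | hv
  · simp
  have hd : (0:ℝ) < d := Nat.cast_pos.2 (NeZero.pos d)
  set s := ‖v‖ / √d with hs
  have hv' : 0 < ‖v‖ := norm_pos_iff.2 hv
  have hs0 : 0 < s := by positivity
  have i1 : Integrable (fun e : UnitSphere d => inner ℝ v (e : Vec d) ^ 2) (uniformSphere d) :=
    integrable_of_continuous_of_compactSpace (by fun_prop)
  calc ∫ e : UnitSphere d, |inner ℝ (e : Vec d) v| ∂uniformSphere d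
      ≤ ∫ e : UnitSphere d, (1 / (2 * s) * inner ℝ v (e : Vec d) ^ 2 + s / 2) ∂uniformSphere d := by
        refine integral_mono_of_nonneg (.of_forall fun e => abs_nonneg _)
          ((i1.const_mul _).add (integrable_const _)) (.of_forall fun e => ?_)
        simp only [real_inner_comm v]
        rw [← sq_abs]
        set t := |inner ℝ v (e : Vec d)|
        have : 1 / (2 * s) * t ^ 2 + s / 2 - t = 1 / (2 * s) * (t - s) ^ 2 := by
          field_simp
          ring
        have h2 : 0 ≤ 1 / (2 * s) * (t - s) ^ 2 := by positivity
        linarith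
    _ = s := by
        rw [integral_add (i1.const_mul _) (integrable_const _), integral_const_mul,
          integral_inner_sq_uniformSphere]
        simp only [integral_const, probReal_univ, one_smul]
        have : ‖v‖ ^ 2 / d = s ^ 2 := by
          rw [hs, div_pow, Real.sq_sqrt hd.le]
        rw [this]
        field_simp
        norm_num

/-- The smoothed function has a Lipschitz gradient. -/
theorem inner_sphereGradient_sub_le (hFc : Continuous F) (hγ : 0 < γ) {c : ℝ} (hc : 0 ≤ c)
    {x y : Vec d} (h : ∀ u, |F (y + u) - F (x + u)| ≤ c) (v : Vec d) :
    inner ℝ (sphereGradient γ F y - sphereGradient γ F x) v ≤ √d / γ * c * ‖v‖ := by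
  have hd : (0:ℝ) < d := Nat.cast_pos.2 (NeZero.pos d)
  rw [inner_sub_left, inner_sphereGradient_eq hFc hγ, inner_sphereGradient_eq hFc hγ, ← mul_sub,
    ← integral_sub (integrable_of_continuous_of_compactSpace (by fun_prop))
      (integrable_of_continuous_of_compactSpace (by fun_prop))]
  have i1 : Integrable (fun e : UnitSphere d => |inner ℝ (e : Vec d) v|) (uniformSphere d) :=
    integrable_of_continuous_of_compactSpace (by fun_prop)
  have h1 : ∫ e : UnitSphere d, (inner ℝ (e : Vec d) v * F (y + γ • (e : Vec d))
      - inner ℝ (e : Vec d) v * F (x + γ • (e : Vec d))) ∂uniformSphere d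
        ≤ ∫ e : UnitSphere d, c * |inner ℝ (e : Vec d) v| ∂uniformSphere d := by
    refine integral_mono (integrable_of_continuous_of_compactSpace (by fun_prop))
      (i1.const_mul c) fun e => ?_
    simp only [← mul_sub]
    refine (le_abs_self _).trans ?_
    rw [abs_mul, mul_comm]
    exact mul_le_mul_of_nonneg_right (h _) (abs_nonneg _)
  rw [integral_const_mul] at h1
  have h2 := mul_le_mul_of_nonneg_left (integral_abs_inner_uniformSphere_le v) hc
  calc _ ≤ d / γ * (c * (‖v‖ / √d)) := by
        gcongr
        exact h1.trans h2
    _ = √d / γ * c * ‖v‖ := by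
        have : (d:ℝ) = √d * √d := (Real.mul_self_sqrt hd.le).symm
        have h3 : √(d:ℝ) ≠ 0 := by positivity
        field_simp
        rw [sq, ← this]
        ring

end Smoothing

/-! ### The variance of the batch gradient -/

section Variance

variable {d : ℕ} {γ : ℝ} {F : Vec d → ℝ}

/-- The numerical constant in the bound for the variance of the batch gradient. -/
noncomputable def varianceConst : ℝ := 4 * Real.exp 16 * 800 ^ 2

theorem varianceConst_pos : 0 < varianceConst := by
  unfold varianceConst
  positivity

/-- A bound for a `ρ`-norm by exponentials of the coordinates. -/
theorem pNorm_sq_le_exp {ρ l T : ℝ} (hρ : 2 ≤ ρ) (hl : 0 < l) (hT : 0 < T) (s : Vec d) :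
    pNorm (ENNReal.ofReal ρ) s ^ 2 ≤ (ρ / l) ^ 2 * (T ^ (2 / ρ) *
      (1 + (∑ i, (Real.exp (l * s i) + Real.exp (-l * s i))) / T)) := by
  have hρ0 : 0 < ρ := by linarith
  have hρ1 : (1 : ℝ≥0∞) ≤ ENNReal.ofReal ρ := by
    rw [ENNReal.one_le_ofReal]; linarith
  have htoReal : (ENNReal.ofReal ρ).toReal = ρ := ENNReal.toReal_ofReal hρ0.le
  set W := ∑ i, (Real.exp (l * s i) + Real.exp (-l * s i)) with hW
  have hW0 : 0 ≤ W := Finset.sum_nonneg fun i _ => by positivity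
  have hcoord : ∀ i, |s i| ^ ρ ≤ (ρ / l) ^ ρ * (Real.exp (l * s i) + Real.exp (-l * s i)) := by
    intro i
    -- From t ≤ e^t with t = l|s_i|/ρ: the ρ-th power then has the rate l exactly.
    have h1 : |s i| ≤ ρ / l * Real.exp (l * |s i| / ρ) := by
      have := Real.add_one_le_exp (l * |s i| / ρ)
      calc |s i| = ρ / l * (l * |s i| / ρ) := by field_simp
        _ ≤ ρ / l * Real.exp (l * |s i| / ρ) := by gcongr; linarith
    calc |s i| ^ ρ ≤ (ρ / l * Real.exp (l * |s i| / ρ)) ^ ρ :=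
          Real.rpow_le_rpow (abs_nonneg _) h1 hρ0.le
      _ = (ρ / l) ^ ρ * Real.exp (l * |s i|) := by
          rw [Real.mul_rpow (by positivity) (Real.exp_pos _).le, ← Real.exp_mul]
          congr 2
          field_simp
      _ ≤ _ := by
          gcongr
          rcases abs_cases (s i) with ⟨h, _⟩ | ⟨h, _⟩ <;> rw [h]
          · linarith [Real.exp_pos (-l * s i)]
          · rw [mul_neg, ← neg_mul]
            linarith [Real.exp_pos (l * s i)]
  have h2 : pNorm (ENNReal.ofReal ρ) s ^ ρ ≤ (ρ / l) ^ ρ * W := by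
    have := pNorm_rpow hρ1 ENNReal.ofReal_ne_top s
    rw [htoReal] at this
    rw [this, hW, Finset.mul_sum]
    exact Finset.sum_le_sum fun i _ => hcoord i
  have hn := pNorm_nonneg hρ1 s
  have h3 : pNorm (ENNReal.ofReal ρ) s ^ 2 ≤ (ρ / l) ^ 2 * W ^ (2 / ρ) := by
    have := Real.rpow_le_rpow (by positivity) h2 (show (0:ℝ) ≤ 2 / ρ by positivity)
    rw [← Real.rpow_mul hn, Real.mul_rpow (by positivity) hW0, ← Real.rpow_mul (by positivity),
      mul_div_cancel₀ _ hρ0.ne'] at this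
    exact_mod_cast this
  -- Because 2/ρ ≤ 1, the power of W is dominated by an affine function of W, so only the mean of W
  -- is needed later. The best T is of the order of that mean.
  have h4 : W ^ (2 / ρ) ≤ T ^ (2 / ρ) * (1 + W / T) := by
    have h5 : W ^ (2 / ρ) = T ^ (2 / ρ) * (W / T) ^ (2 / ρ) := by
      rw [← Real.mul_rpow hT.le (by positivity), mul_div_cancel₀ _ hT.ne']
    rw [h5]
    gcongr
    calc (W / T) ^ (2 / ρ) ≤ (1 + W / T) ^ (2 / ρ) := by
          refine Real.rpow_le_rpow (by positivity) (by linarith) (by positivity)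
      _ ≤ (1 + W / T) ^ (1:ℝ) := by
          refine Real.rpow_le_rpow_of_exponent_le ?_ ?_
          · have : 0 ≤ W / T := by positivity
            linarith
          · rw [div_le_one hρ0]; exact hρ
      _ = _ := Real.rpow_one _
  exact h3.trans (by gcongr)

variable [NeZero d]

/-- The mean is at most 200 in modulus, so subtracting it costs a factor e^(1/2) at half the rate.
-/
theorem integral_exp_centered_le {X : UnitSphere d → ℝ} (hX : Continuous X)
    (h : ∫ e, Real.exp (1 / 200 * |X e|) ∂uniformSphere d ≤ 2) :
    ∫ e, Real.exp (1 / 400 * |X e - ∫ e, X e ∂uniformSphere d|) ∂uniformSphere d ≤ 4 := by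
  set m := ∫ e, X e ∂uniformSphere d with hm
  have i1 : Integrable (fun e => Real.exp (1 / 200 * |X e|)) (uniformSphere d) :=
    integrable_of_continuous_of_compactSpace (by fun_prop)
  have hm200 : |m| ≤ 200 := by
    have h1 : |m| ≤ ∫ e, (200 * Real.exp (1 / 200 * |X e|) - 200) ∂uniformSphere d := by
      refine (abs_integral_le_integral_abs).trans (integral_mono
        (integrable_of_continuous_of_compactSpace (by fun_prop))
        (integrable_of_continuous_of_compactSpace (by fun_prop)) fun e => ?_)
      have := Real.add_one_le_exp (1 / 200 * |X e|)
      simp only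
      linarith
    rw [integral_sub (i1.const_mul _) (integrable_const _), integral_const_mul] at h1
    simp at h1
    linarith
  have he : Real.exp (1 / 2) ≤ 2 := by
    have h1 : Real.exp (1 / 2) ^ 2 = Real.exp 1 := by
      rw [← Real.exp_nat_mul]; norm_num
    have h2 := Real.exp_one_lt_d9
    nlinarith [Real.exp_pos (1 / 2)]
  calc ∫ e, Real.exp (1 / 400 * |X e - m|) ∂uniformSphere d
      ≤ ∫ e, (1 + Real.exp (1 / 200 * |X e|)) ∂uniformSphere d := by
        refine integral_mono (integrable_of_continuous_of_compactSpace (by fun_prop))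
          (integrable_of_continuous_of_compactSpace (by fun_prop)) fun e => ?_
        have h1 : 1 / 400 * |X e - m| ≤ 1 / 2 + 1 / 400 * |X e| := by
          have := abs_sub (X e) m
          linarith
        refine (Real.exp_le_exp.2 h1).trans ?_
        rw [Real.exp_add]
        have h2 : Real.exp (1 / 200 * |X e|) = Real.exp (1 / 400 * |X e|) ^ 2 := by
          rw [← Real.exp_nat_mul]; push_cast; ring_nf
        simp only [h2]
        have h3 := Real.exp_pos (1 / 400 * |X e|)
        nlinarith [sq_nonneg (Real.exp (1 / 400 * |X e|) - 1)]
    _ ≤ 4 := by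
        rw [integral_add (integrable_const _) i1]
        simp
        linarith

/-- Mean squared `ρ`-norm of the sum of `B ≥ ρ` independent copies of a centered random vector
whose coordinates have exponential moments. -/
theorem integral_pNorm_sq_sum_le {ρ : ℝ} (hρ : 2 ≤ ρ) {B : ℕ} (hB : ρ ≤ B)
    {ξ : Fin d → UnitSphere d → ℝ} (hξ : ∀ i, Continuous (ξ i))
    (h0 : ∀ i, ∫ e, ξ i e ∂uniformSphere d = 0)
    (h4 : ∀ i, ∫ e, Real.exp (1 / 400 * |ξ i e|) ∂uniformSphere d ≤ 4) :
    ∫ ω : Fin B → UnitSphere d, pNorm (ENNReal.ofReal ρ) (WithLp.toLp 2 fun i => ∑ j, ξ i (ω j)) ^ 2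
      ∂Measure.pi (fun _ => uniformSphere d) ≤ varianceConst * ρ * (d : ℝ) ^ (2 / ρ) * B := by
  have hρ0 : 0 < ρ := by linarith
  have hB0 : (0:ℝ) < B := by linarith
  have hd : (0:ℝ) < d := Nat.cast_pos.2 (NeZero.pos d)
  -- This l makes the exponent of the moment generating function of the sum equal to 32·B·(400·l)² =
  -- 8ρ. The admissibility condition l ≤ 1/800 is exactly ρ ≤ B.
  set l := √(ρ / B) / 800 with hl
  have hl0 : 0 < l := by positivity
  have hl2 : l ^ 2 = ρ / B / 800 ^ 2 := by
    rw [hl, div_pow, Real.sq_sqrt (by positivity)]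
  have hl1 : l ≤ 1 / 400 / 2 := by
    have : √(ρ / B) ≤ 1 := by
      rw [Real.sqrt_le_left zero_le_one, one_pow, div_le_one hB0]
      exact hB
    rw [hl]
    linarith
  -- The bound for the mean of the 2d exponentials. Its power 2/ρ is at most 2·d^(2/ρ)·e^16, so the
  -- union over coordinates costs only d^(2/ρ).
  set T : ℝ := 2 * d * Real.exp (8 * ρ) with hT
  have hT0 : 0 < T := by positivity
  have hmgf : ∀ i, ∀ l' : ℝ, |l'| = l →
      ∫ ω : Fin B → UnitSphere d, Real.exp (l' * ∑ j, ξ i (ω j))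
        ∂Measure.pi (fun _ => uniformSphere d) ≤ Real.exp (8 * ρ) := by
    intro i l' hl'
    have hξi := hξ i
    have h1 := integral_exp_mul_le_of_centered (μ := uniformSphere d) (ξ := ξ i) (θ := 1 / 400)
      (l := l') (by norm_num) (integrable_of_continuous_of_compactSpace (hξ i)) (h0 i)
      (integrable_of_continuous_of_compactSpace (by fun_prop)) (h4 i) (by rw [hl']; exact hl1)
    refine (integral_exp_mul_sum_le h1).trans (Real.exp_le_exp.2 (le_of_eq ?_))
    have : l' ^ 2 = l ^ 2 := by rw [← hl', sq_abs]
    rw [div_pow, this, hl2]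
    field_simp
    norm_num
  have hWint : ∫ ω : Fin B → UnitSphere d, ∑ i, (Real.exp (l * ∑ j, ξ i (ω j))
      + Real.exp (-l * ∑ j, ξ i (ω j))) ∂Measure.pi (fun _ => uniformSphere d) ≤ T := by
    rw [integral_finsetSum _ fun i _ => integrable_of_continuous_of_compactSpace (by fun_prop)]
    calc _ ≤ ∑ _i : Fin d, 2 * Real.exp (8 * ρ) := by
          refine Finset.sum_le_sum fun i _ => ?_
          rw [integral_add (integrable_of_continuous_of_compactSpace (by fun_prop))
            (integrable_of_continuous_of_compactSpace (by fun_prop))]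
          have h1 := hmgf i l (abs_of_pos hl0)
          have h2 := hmgf i (-l) (by rw [abs_neg, abs_of_pos hl0])
          linarith
      _ = T := by
          rw [Finset.sum_const, Finset.card_univ, Fintype.card_fin, nsmul_eq_mul, hT]
          ring
  have hiW : Integrable (fun ω : Fin B → UnitSphere d => ∑ i, (Real.exp (l * ∑ j, ξ i (ω j))
      + Real.exp (-l * ∑ j, ξ i (ω j)))) (Measure.pi (fun _ => uniformSphere d)) :=
    integrable_of_continuous_of_compactSpace (by fun_prop)
  have hTpow : T ^ (2 / ρ) ≤ 2 * (d : ℝ) ^ (2 / ρ) * Real.exp 16 := by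
    rw [hT, Real.mul_rpow (by positivity) (by positivity), Real.mul_rpow (by positivity) hd.le,
      ← Real.exp_mul]
    have h1 : (2:ℝ) ^ (2 / ρ) ≤ 2 := by
      calc (2:ℝ) ^ (2 / ρ) ≤ 2 ^ (1:ℝ) := Real.rpow_le_rpow_of_exponent_le (by norm_num) (by
            rw [div_le_one hρ0]; exact hρ)
        _ = 2 := Real.rpow_one _
    have h2 : 8 * ρ * (2 / ρ) = 16 := by field_simp; norm_num
    rw [h2]
    gcongr
  calc _ ≤ ∫ ω : Fin B → UnitSphere d, (ρ / l) ^ 2 * (T ^ (2 / ρ) *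
        (1 + (∑ i, (Real.exp (l * ∑ j, ξ i (ω j)) + Real.exp (-l * ∑ j, ξ i (ω j)))) / T))
        ∂Measure.pi (fun _ => uniformSphere d) := by
        refine integral_mono_of_nonneg (.of_forall fun ω => sq_nonneg _)
          (integrable_of_continuous_of_compactSpace (by fun_prop)) (.of_forall fun ω => ?_)
        exact pNorm_sq_le_exp hρ hl0 hT0 (WithLp.toLp 2 fun i => ∑ j, ξ i (ω j))
    _ ≤ (ρ / l) ^ 2 * (T ^ (2 / ρ) * 2) := by
        rw [integral_const_mul, integral_const_mul, integral_add (integrable_const _)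
          (hiW.div_const _), integral_div]
        have : (∫ ω : Fin B → UnitSphere d, ∑ i, (Real.exp (l * ∑ j, ξ i (ω j))
          + Real.exp (-l * ∑ j, ξ i (ω j))) ∂Measure.pi (fun _ => uniformSphere d)) / T ≤ 1 := by
          rw [div_le_one hT0]; exact hWint
        gcongr
        simp only [integral_const, probReal_univ, one_smul]
        linarith
    _ ≤ (ρ / l) ^ 2 * (2 * (d : ℝ) ^ (2 / ρ) * Real.exp 16 * 2) := by gcongr
    _ = _ := by
        rw [div_pow, hl2, varianceConst]
        field_simp
        norm_num

/-- The variance of the batch gradient in the `ρ`-norm for a batch size `B ≥ ρ`. -/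
theorem integral_pNorm_sq_batchGradient_sub_le {K : NNReal} (hK0 : 0 < K) (hK : LipschitzWith K F)
    (hγ : 0 < γ) (x : Vec d) {ρ : ℝ} (hρ : 2 ≤ ρ) {B : ℕ} (hB : ρ ≤ B) :
    ∫ ω : Fin B → UnitSphere d, pNorm (ENNReal.ofReal ρ) (batchGradient γ ω
        (fun j => F (x + γ • (ω j : Vec d))) (fun j => F (x - γ • (ω j : Vec d)))
          - sphereGradient γ F x) ^ 2 ∂Measure.pi (fun _ => uniformSphere d)
      ≤ varianceConst * ρ * (d : ℝ) ^ (2 / ρ) * (K : ℝ) ^ 2 / B := by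
  have hFc := hK.continuous
  have hK0' : (0:ℝ) < K := hK0
  have hB0 : (0:ℝ) < B := by linarith
  -- The two-point difference is automatically odd, and after division by 2γK it is 1-Lipschitz, so
  -- spherical concentration applies without subtracting a mean.
  set H : Vec d → ℝ := fun u => (F (x + γ • u) - F (x - γ • u)) / (2 * γ * K) with hH
  have hHodd : ∀ u, H (-u) = -H u := by
    intro u
    simp only [hH, smul_neg, sub_neg_eq_add, ← sub_eq_add_neg]
    rw [← neg_div, neg_sub]
  have hHL : LipschitzWith 1 H := by
    refine LipschitzWith.of_dist_le_mul fun u w => ?_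
    rw [NNReal.coe_one, one_mul, Real.dist_eq, dist_eq_norm]
    simp only [hH]
    rw [← sub_div, abs_div, abs_of_pos (show (0:ℝ) < 2 * γ * K by positivity), div_le_iff₀ (by positivity)]
    have h1 := hK.dist_le_mul (x + γ • u) (x + γ • w)
    have h2 := hK.dist_le_mul (x - γ • u) (x - γ • w)
    rw [Real.dist_eq, dist_eq_norm] at h1 h2
    have e1 : x + γ • u - (x + γ • w) = γ • (u - w) := by module
    have e2 : x - γ • u - (x - γ • w) = (-γ) • (u - w) := by module
    rw [e1, norm_smul, Real.norm_eq_abs, abs_of_pos hγ] at h1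
    rw [e2, norm_smul, Real.norm_eq_abs, abs_neg, abs_of_pos hγ] at h2
    have e3 : F (x + γ • u) - F (x - γ • u) - (F (x + γ • w) - F (x - γ • w))
      = (F (x + γ • u) - F (x + γ • w)) - (F (x - γ • u) - F (x - γ • w)) := by ring
    rw [e3]
    refine (abs_sub _ _).trans ?_
    linarith
  have hHc := hHL.continuous
  set X : Fin d → UnitSphere d → ℝ := fun i e => d * H e * (e : Vec d) i with hX
  have hXc : ∀ i, Continuous (X i) := fun i => by fun_prop
  set ξ : Fin d → UnitSphere d → ℝ := fun i e => X i e - ∫ e, X i e ∂uniformSphere d with hξ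
  have hξc : ∀ i, Continuous (ξ i) := fun i => by fun_prop
  have hξ0 : ∀ i, ∫ e, ξ i e ∂uniformSphere d = 0 := by
    intro i
    simp only [hξ]
    rw [integral_sub (integrable_of_continuous_of_compactSpace (hXc i)) (integrable_const _)]
    simp
  have hξ4 : ∀ i, ∫ e, Real.exp (1 / 400 * |ξ i e|) ∂uniformSphere d ≤ 4 := fun i =>
    integral_exp_centered_le (hXc i) (integral_exp_abs_mul_coord_le hHL hHodd i)
  have hgrad : ∀ i, sphereGradient γ F x i = K * ∫ e, X i e ∂uniformSphere d := by
    intro i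
    have h1 := inner_sphereGradient (γ := γ) hFc x (EuclideanSpace.single i (1:ℝ))
    simp only [EuclideanSpace.inner_single_right, one_mul, conj_trivial] at h1
    rw [h1, ← integral_const_mul]
    refine integral_congr_ae (.of_forall fun e => ?_)
    simp only [hX, hH]
    field_simp
  have hvec : ∀ ω : Fin B → UnitSphere d, batchGradient γ ω
        (fun j => F (x + γ • (ω j : Vec d))) (fun j => F (x - γ • (ω j : Vec d)))
          - sphereGradient γ F x = ((K : ℝ) / B) • (WithLp.toLp 2 fun i => ∑ j, ξ i (ω j) : Vec d) := by
    intro ω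
    ext i
    simp only [PiLp.sub_apply, PiLp.smul_apply, smul_eq_mul, batchGradient, hgrad, hξ, hX, hH,
      WithLp.ofLp_sum, Finset.sum_apply, Finset.sum_sub_distrib, Finset.sum_const, Finset.card_univ,
      Fintype.card_fin, nsmul_eq_mul]
    rw [mul_sub, Finset.mul_sum, Finset.mul_sum]
    congr 1
    · refine Finset.sum_congr rfl fun j _ => ?_
      field_simp
    · field_simp
  have hρ1 : (1 : ℝ≥0∞) ≤ ENNReal.ofReal ρ := by
    rw [ENNReal.one_le_ofReal]; linarith
  have hmain := integral_pNorm_sq_sum_le hρ hB hξc hξ0 hξ4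
  calc _ = ∫ ω : Fin B → UnitSphere d, ((K : ℝ) / B) ^ 2 *
        pNorm (ENNReal.ofReal ρ) (WithLp.toLp 2 fun i => ∑ j, ξ i (ω j)) ^ 2
        ∂Measure.pi (fun _ => uniformSphere d) := by
        refine integral_congr_ae (.of_forall fun ω => ?_)
        simp only [hvec]
        rw [pNorm_smul hρ1, mul_pow, sq_abs]
    _ ≤ ((K : ℝ) / B) ^ 2 * (varianceConst * ρ * (d : ℝ) ^ (2 / ρ) * B) := by
        rw [integral_const_mul]
        gcongr
    _ = _ := by field_simp

end Variance

/-! ### The batched accelerated gradient method -/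

/-- The two-point batch estimator as a function of the point and of the directions. -/
noncomputable def batchEstimate {d B : ℕ} (γ : ℝ) (f : Vec d → ℝ) (x : Vec d)
    (ω : Fin B → UnitSphere d) : Vec d :=
  batchGradient γ ω (fun j => f (x + γ • (ω j : Vec d))) (fun j => f (x - γ • (ω j : Vec d)))

theorem continuous_batchEstimate {d B : ℕ} {γ : ℝ} {F : Vec d → ℝ} (hF : Continuous F) :
    Continuous fun z : Vec d × (Fin B → UnitSphere d) => batchEstimate γ F z.1 z.2 := by
  unfold batchEstimate batchGradient
  fun_prop

section Unbiased

variable {d : ℕ} [NeZero d] {γ : ℝ} {F : Vec d → ℝ}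

theorem integral_inner_batchEstimate_sub {B : ℕ} (hB : 0 < B) (hF : Continuous F) (x v : Vec d) :
    ∫ ω : Fin B → UnitSphere d, inner ℝ (batchEstimate γ F x ω - sphereGradient γ F x) v
      ∂Measure.pi (fun _ => uniformSphere d) = 0 := by
  set X : UnitSphere d → ℝ := fun e =>
    (d : ℝ) * ((F (x + γ • (e : Vec d)) - F (x - γ • (e : Vec d))) / (2 * γ)) *
        inner ℝ (e : Vec d) v with hX
  have hXc : Continuous X := by fun_prop
  have h1 : ∀ ω : Fin B → UnitSphere d, inner ℝ (batchEstimate γ F x ω - sphereGradient γ F x) v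
      = (B : ℝ)⁻¹ * ∑ j, X (ω j) - inner ℝ (sphereGradient γ F x) v := by
    intro ω
    rw [inner_sub_left, batchEstimate, batchGradient, real_inner_smul_left, sum_inner]
    simp only [real_inner_smul_left, hX]
  have h2 : ∀ j : Fin B, ∫ ω : Fin B → UnitSphere d, X (ω j) ∂Measure.pi (fun _ => uniformSphere d)
      = inner ℝ (sphereGradient γ F x) v := by
    intro j
    rw [inner_sphereGradient hF]
    exact integral_comp_eval (μ := fun _ : Fin B => uniformSphere d) (f := X)
      hXc.aestronglyMeasurable
  simp only [h1]
  rw [integral_sub (integrable_of_continuous_of_compactSpace (by fun_prop)) (integrable_const _),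
    integral_const_mul,
    integral_finsetSum _ fun j _ => integrable_of_continuous_of_compactSpace (by fun_prop)]
  simp only [h2, Finset.sum_const, Finset.card_univ, Fintype.card_fin, nsmul_eq_mul, integral_const,
    probReal_univ, one_smul]
  have : (B : ℝ) ≠ 0 := by positivity
  field_simp
  ring

end Unbiased

namespace AGMParams

variable {d : ℕ} (P : AGMParams) {γ : ℝ} {Q : Set (Vec d)} {x₀ : Vec d} {f : Vec d → ℝ}

theorem A_succ (k : ℕ) : P.A (k + 1) = P.A k + P.a k := Finset.sum_range_succ _ _

theorem A_nonneg (k : ℕ) : 0 ≤ P.A k := Finset.sum_nonneg fun i _ => (P.a_pos i).le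

theorem A_succ_pos (k : ℕ) : 0 < P.A (k + 1) := by
  rw [A_succ]
  linarith [P.A_nonneg k, P.a_pos k]

theorem combine_mem (hQ : Convex ℝ Q) (k : ℕ) {y z : Vec d} (hy : y ∈ Q) (hz : z ∈ Q) :
    P.combine k y z ∈ Q := by
  have hA := P.A_succ_pos k
  have h := hQ hy hz (a := (P.A (k + 1))⁻¹ * P.A k) (b := (P.A (k + 1))⁻¹ * P.a k)
    (mul_nonneg (inv_nonneg.2 hA.le) (P.A_nonneg k)) (mul_nonneg (inv_nonneg.2 hA.le) (P.a_pos k).le)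
    (by rw [← mul_add, ← A_succ, inv_mul_cancel₀ hA.ne'])
  rwa [mul_smul, mul_smul, ← smul_add] at h

theorem smul_combine (k : ℕ) (y z : Vec d) :
    P.A (k + 1) • P.combine k y z = P.A k • y + P.a k • z := by
  rw [combine, smul_smul, mul_inv_cancel₀ (P.A_succ_pos k).ne', one_smul]

theorem run_fgmLoop_succ (n : ℕ) (e : Fin (n + 1) → Fin P.B → UnitSphere d) (k : ℕ) (y G : Vec d) :
    (fgmLoop P γ Q x₀ (n + 1) e k y G).run f =
      (fgmLoop P γ Q x₀ n (fun i => e i.succ) (k + 1)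
        (P.combine k y (P.prox Q x₀
          (G + P.a k • batchEstimate γ f (P.combine k y (P.prox Q x₀ G)) (e 0))))
        (G + P.a k • batchEstimate γ f (P.combine k y (P.prox Q x₀ G)) (e 0))).run f := by
  simp only [fgmLoop, ZOMethod.run, Fin.append_left, Fin.append_right, batchEstimate]

theorem iterations_fgmLoop (n : ℕ) (e : Fin n → Fin P.B → UnitSphere d) (k : ℕ) (y G : Vec d) :
    (fgmLoop P γ Q x₀ n e k y G).iterations f = n := by
  induction n generalizing k y G with
  | zero => rfl
  | succ n ih => simp only [fgmLoop, ZOMethod.iterations, ih]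

theorem oracleCalls_fgmLoop (n : ℕ) (e : Fin n → Fin P.B → UnitSphere d) (k : ℕ) (y G : Vec d) :
    (fgmLoop P γ Q x₀ n e k y G).oracleCalls f = n * (P.B + P.B) := by
  induction n generalizing k y G with
  | zero => simp [fgmLoop, ZOMethod.oracleCalls]
  | succ n ih =>
    simp only [fgmLoop, ZOMethod.oracleCalls, ih]
    ring

theorem run_fgmLoop_mem (hQ : IsClosed Q) (hQc : Convex ℝ Q) (hx₀ : x₀ ∈ Q) (n : ℕ)
    (e : Fin n → Fin P.B → UnitSphere d) (k : ℕ) {y : Vec d} (hy : y ∈ Q) (G : Vec d) :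
    (fgmLoop P γ Q x₀ n e k y G).run f ∈ Q := by
  induction n generalizing k y G with
  | zero => exact hy
  | succ n ih =>
    rw [run_fgmLoop_succ]
    exact ih _ _ (P.combine_mem hQc k hy (P.prox_mem hQ hx₀ _)) _

theorem add_smul_mem_cthickening (hγ : 0 ≤ γ) {x u : Vec d} (hx : x ∈ Q) (hu : ‖u‖ ≤ 1) :
    x + γ • u ∈ Metric.cthickening γ Q := by
  refine Metric.mem_cthickening_of_dist_le _ x _ _ hx ?_
  rw [dist_eq_norm, add_sub_cancel_left, norm_smul, Real.norm_eq_abs, abs_of_nonneg hγ]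
  exact mul_le_of_le_one_right hγ hu

theorem batchEstimate_congr {B : ℕ} {F : Vec d → ℝ} (hγ : 0 ≤ γ)
    (h : ∀ x ∈ Metric.cthickening γ Q, F x = f x) {x : Vec d} (hx : x ∈ Q)
    (ω : Fin B → UnitSphere d) : batchEstimate γ f x ω = batchEstimate γ F x ω := by
  have h1 : ∀ j, F (x + γ • (ω j : Vec d)) = f (x + γ • (ω j : Vec d)) := fun j =>
    h _ (add_smul_mem_cthickening hγ hx (by simp))
  have h2 : ∀ j, F (x - γ • (ω j : Vec d)) = f (x - γ • (ω j : Vec d)) := fun j => by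
    rw [sub_eq_add_neg, ← smul_neg]
    exact h _ (add_smul_mem_cthickening hγ hx (by simp))
  simp only [batchEstimate, h1, h2]

/-- The method uses the objective only on the `γ`-neighbourhood of `Q`. -/
theorem run_fgmLoop_congr {F : Vec d → ℝ} (hγ : 0 ≤ γ) (hQ : IsClosed Q) (hQc : Convex ℝ Q)
    (hx₀ : x₀ ∈ Q) (h : ∀ x ∈ Metric.cthickening γ Q, F x = f x) (n : ℕ)
    (e : Fin n → Fin P.B → UnitSphere d) (k : ℕ) {y : Vec d} (hy : y ∈ Q) (G : Vec d) :
    (fgmLoop P γ Q x₀ n e k y G).run f = (fgmLoop P γ Q x₀ n e k y G).run F := by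
  induction n generalizing k y G with
  | zero => rfl
  | succ n ih =>
    rw [run_fgmLoop_succ, run_fgmLoop_succ, batchEstimate_congr hγ h
      (P.combine_mem hQc k hy (P.prox_mem hQ hx₀ _))]
    exact ih _ _ (P.combine_mem hQc k hy (P.prox_mem hQ hx₀ _)) _

theorem continuous_run_fgmLoop (hf : Continuous f) (hQ : IsClosed Q) (hQc : Convex ℝ Q)
    (hx₀ : x₀ ∈ Q) (n k : ℕ) :
    Continuous fun z : (Fin n → Fin P.B → UnitSphere d) × Vec d × Vec d =>
      (fgmLoop P γ Q x₀ n z.1 k z.2.1 z.2.2).run f := by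
  induction n generalizing k with
  | zero => exact continuous_snd.fst
  | succ n ih =>
    simp only [run_fgmLoop_succ]
    have hp := P.continuous_prox hQ hQc hx₀
    have hb := continuous_batchEstimate (γ := γ) (B := P.B) hf
    have hc : ∀ g h : (Fin (n + 1) → Fin P.B → UnitSphere d) × Vec d × Vec d → Vec d,
        Continuous g → Continuous h → Continuous fun z => P.combine k (g z) (h z) := by
      intro g h hg hh
      unfold combine
      fun_prop
    have hG : Continuous fun z : (Fin (n + 1) → Fin P.B → UnitSphere d) × Vec d × Vec d =>
        z.2.2 + P.a k • batchEstimate γ f (P.combine k z.2.1 (P.prox Q x₀ z.2.2)) (z.1 0) := by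
      have hx := hc _ _ continuous_snd.fst (hp.comp continuous_snd.snd)
      have he : Continuous fun z : (Fin (n + 1) → Fin P.B → UnitSphere d) × Vec d × Vec d =>
          z.1 0 := by fun_prop
      have hg := hb.comp (hx.prodMk he)
      exact continuous_snd.snd.add (hg.const_smul (P.a k))
    have hY := hc _ _ (continuous_snd.fst) (hp.comp hG)
    refine (ih (k + 1)).comp (Continuous.prodMk ?_ (hY.prodMk hG))
    fun_prop

/-- The potential function of the analysis. -/
noncomputable def potential (Q : Set (Vec d)) (x₀ : Vec d) (φ : Vec d → ℝ) (xs : Vec d) (k : ℕ)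
    (y G : Vec d) : ℝ :=
  P.A k * (φ y - φ xs) + (P.proxObjective x₀ G xs - P.proxObjective x₀ G (P.prox Q x₀ G))

theorem le_potential (hQ : IsClosed Q) (hx₀ : x₀ ∈ Q) {φ : Vec d → ℝ} {xs : Vec d} (hxs : xs ∈ Q)
    (k : ℕ) (y G : Vec d) : P.A k * (φ y - φ xs) ≤ P.potential Q x₀ φ xs k y G := by
  have := isMinOn_iff.1 (P.prox_isMinOn hQ hx₀ G) xs hxs
  unfold potential
  linarith

/-- One step of the method with an arbitrary gradient estimate `g`. -/
theorem potential_step (hQ : IsClosed Q) (hQc : Convex ℝ Q) (hx₀ : x₀ ∈ Q) {φ : Vec d → ℝ}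
    {grad : Vec d → Vec d} {xs : Vec d} (hxs : xs ∈ Q) {s : ℝ≥0∞} (hs : 1 ≤ s) (hs' : s ≠ ⊤)
    (hconj : s.toReal.HolderConjugate P.r.toReal)
    (hconv : ∀ x ∈ Q, ∀ z ∈ Q, φ x + inner ℝ (grad x) (z - x) ≤ φ z) {k : ℕ} {L τ : ℝ}
    (hsmooth : ∀ x ∈ Q, ∀ z ∈ Q,
      φ z ≤ φ x + inner ℝ (grad x) (z - x) + L * pNorm P.r (z - x) ^ 2 + τ)
    (hL : L * P.a k ^ 2 ≤ P.growth / 2 * P.A (k + 1)) {y : Vec d} (hy : y ∈ Q) (G g : Vec d) :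
    P.potential Q x₀ φ xs (k + 1) (P.combine k y (P.prox Q x₀ (G + P.a k • g))) (G + P.a k • g)
      ≤ P.potential Q x₀ φ xs k y G
        + P.a k * inner ℝ (g - grad (P.combine k y (P.prox Q x₀ G))) (xs - P.prox Q x₀ G)
        + P.a k ^ 2 / (2 * P.growth)
          * pNorm s (g - grad (P.combine k y (P.prox Q x₀ G))) ^ 2
        + P.A (k + 1) * τ := by
  have hA := P.A_succ_pos k
  have hA0 := P.A_nonneg k
  have ha := P.a_pos k
  have hgr := P.growth_pos
  have hAs := P.A_succ k
  set z := P.prox Q x₀ G with hz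
  set G' := G + P.a k • g with hG'
  set z' := P.prox Q x₀ G' with hz'
  set x := P.combine k y z with hx
  set y' := P.combine k y z' with hy'
  have hzQ : z ∈ Q := P.prox_mem hQ hx₀ G
  have hzQ' : z' ∈ Q := P.prox_mem hQ hx₀ G'
  have hxQ : x ∈ Q := P.combine_mem hQc k hy hzQ
  have hyQ' : y' ∈ Q := P.combine_mem hQc k hy hzQ'
  set D := pNorm P.r (z' - z) with hD
  have hD0 : 0 ≤ D := pNorm_nonneg P.one_lt_r.le _
  set ξ := g - grad x with hξ
  set E := pNorm s ξ with hE
  have hE0 : 0 ≤ E := pNorm_nonneg hs _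
  -- the point `y'` differs from `x` by a multiple of `z' - z`
  have hyx : y' - x = (P.a k / P.A (k + 1)) • (z' - z) := by
    rw [hy', hx, combine, combine, ← smul_sub, div_eq_inv_mul, mul_smul]
    congr 1
    module
  have hN : pNorm P.r (y' - x) = P.a k / P.A (k + 1) * D := by
    rw [hyx, pNorm_smul P.one_lt_r.le, abs_of_pos (by positivity)]
  have s1 := hsmooth x hxQ y' hyQ'
  rw [hN, hyx, inner_smul_right] at s1
  have s2 := hconv x hxQ y hy
  have s3 := hconv x hxQ xs hxs
  -- The point x_{k+1} is the weighted mean of y_k and z_k, so convexity at y_k, weighted by A_k,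
  -- turns into a linear term at z_k.
  have s4 : P.A k * inner ℝ (grad x) (y - x) = -(P.a k * inner ℝ (grad x) (z - x)) := by
    have e : P.A k • (y - x) = -(P.a k • (z - x)) := by
      have h1 := P.smul_combine k y z
      rw [← hx, hAs, add_smul] at h1
      have h2 : P.A k • (y - x) + P.a k • (z - x)
        = (P.A k • y + P.a k • z) - (P.A k • x + P.a k • x) := by module
      rw [h1, sub_self] at h2
      exact eq_neg_of_add_eq_zero_left h2
    rw [← inner_smul_right, e, inner_neg_right, inner_smul_right]
  -- quadratic growth of the prox objective
  have s5 := P.prox_growth hQ hQc hx₀ G hzQ'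
  rw [← hz, ← hD] at s5
  have s6 : ∀ w, P.proxObjective x₀ G' w = P.proxObjective x₀ G w + P.a k * inner ℝ g w := by
    intro w
    rw [hG', proxObjective, proxObjective, inner_add_left, real_inner_smul_left]
    ring
  -- the noise
  have s7 : inner ℝ ξ (z - z') ≤ E * D := by
    have := inner_le_pNorm_mul_pNorm P.one_lt_r.le P.r_ne_top hs hs' hconj ξ (z - z')
    rwa [pNorm_sub_comm P.one_lt_r.le z z'] at this
  -- Half of the growth term pays for the correlation of the noise with z_{k+1}; the other half pays
  -- for the quadratic smoothness term.
  have s8 : P.a k * (E * D) ≤ P.growth / 2 * D ^ 2 + P.a k ^ 2 / (2 * P.growth) * E ^ 2 := by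
    have : P.growth / 2 * D ^ 2 + P.a k ^ 2 / (2 * P.growth) * E ^ 2 - P.a k * (E * D)
        = (P.growth * D - P.a k * E) ^ 2 / (2 * P.growth) := by
      field_simp
      ring
    have h2 : 0 ≤ (P.growth * D - P.a k * E) ^ 2 / (2 * P.growth) := by positivity
    linarith
  have s9 : P.A (k + 1) * (L * (P.a k / P.A (k + 1) * D) ^ 2) ≤ P.growth / 2 * D ^ 2 := by
    have e : P.A (k + 1) * (L * (P.a k / P.A (k + 1) * D) ^ 2)
        = L * P.a k ^ 2 / P.A (k + 1) * D ^ 2 := by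
      field_simp
    rw [e]
    exact mul_le_mul_of_nonneg_right (by rw [div_le_iff₀ hA]; exact hL) (sq_nonneg D)
  have t1 : P.A (k + 1) * φ y' ≤ P.A (k + 1) * φ x + P.a k * inner ℝ (grad x) (z' - z)
      + P.growth / 2 * D ^ 2 + P.A (k + 1) * τ := by
    have := mul_le_mul_of_nonneg_left s1 hA.le
    have e : P.A (k + 1) * (P.a k / P.A (k + 1) * inner ℝ (grad x) (z' - z))
        = P.a k * inner ℝ (grad x) (z' - z) := by field_simp
    linarith
  have t2 := mul_le_mul_of_nonneg_left s2 hA0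
  have t3 := mul_le_mul_of_nonneg_left s3 ha.le
  have t4 := mul_le_mul_of_nonneg_left s7 ha.le
  have hin : inner ℝ ξ (xs - z) + inner ℝ ξ (z - z') = inner ℝ g (xs - z') - inner ℝ (grad x) (xs - z') := by
    rw [← inner_add_right, sub_add_sub_cancel, hξ, inner_sub_left]
  unfold potential
  rw [← hz', s6, s6, ← hz, hAs] at *
  simp only [inner_sub_right] at *
  nlinarith

end AGMParams

/-! ### The expected potential -/

theorem integral_pi_fin_succ {X : Type*} [TopologicalSpace X] [CompactSpace X]
    [SecondCountableTopology X] [MeasurableSpace X] [BorelSpace X] (μ : Measure X)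
    [IsProbabilityMeasure μ] {n : ℕ} {h : (Fin (n + 1) → X) → ℝ} (hh : Continuous h) :
    Integrable (fun x => ∫ e, h (Fin.cons x e) ∂Measure.pi fun _ : Fin n => μ) μ ∧
      ∫ e, h e ∂Measure.pi (fun _ => μ)
        = ∫ x, ∫ e, h (Fin.cons x e) ∂Measure.pi (fun _ : Fin n => μ) ∂μ := by
  have hc : Continuous fun z : X × (Fin n → X) => h (Fin.cons z.1 z.2) := by fun_prop
  have hi : Integrable (fun z : X × (Fin n → X) => h (Fin.cons z.1 z.2))
      (μ.prod (Measure.pi fun _ : Fin n => μ)) :=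
    integrable_of_continuous_of_compactSpace hc
  refine ⟨hi.integral_prod_left, ?_⟩
  rw [← integral_prod _ hi,
    ← (measurePreserving_piFinSuccAbove (fun _ : Fin (n + 1) => μ) 0).integral_comp'
      (fun z : X × (Fin n → X) => h (Fin.cons z.1 z.2))]
  congr 1
  ext e
  congr 1
  exact (Fin.cons_self_tail e).symm

namespace AGMParams

theorem potential_zero_le {d : ℕ} (P : AGMParams) (Q : Set (Vec d)) (x₀ : Vec d) (φ : Vec d → ℝ) (xs : Vec d) :
    P.potential Q x₀ φ xs 0 x₀ 0 ≤ P.β * pNorm P.r (x₀ - xs) ^ 2 / 2 := by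
  have h := P.β_pos
  have h1 : 0 ≤ P.proxObjective x₀ 0 (P.prox Q x₀ 0) := by
    unfold proxObjective
    rw [inner_zero_left]
    positivity
  have h2 : P.proxObjective x₀ 0 xs = P.β * pNorm P.r (x₀ - xs) ^ 2 / 2 := by
    unfold proxObjective
    rw [inner_zero_left, pNorm_sub_comm P.one_lt_r.le x₀ xs]
    ring
  have h3 : P.A 0 = 0 := Finset.sum_range_zero _
  unfold potential
  rw [h3]
  linarith

variable {d : ℕ} [NeZero d] (P : AGMParams) {γ : ℝ} {Q : Set (Vec d)} {x₀ : Vec d} {f : Vec d → ℝ}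

/-- Induction on the remaining number of iterations from an arbitrary state: Fubini splits off the
first batch, so the state is deterministic while that batch is averaged and no conditional
expectations are needed. -/
theorem integral_run_fgmLoop_le (hf : Continuous f) (hQ : IsClosed Q) (hQc : Convex ℝ Q)
    (hx₀ : x₀ ∈ Q) {φ : Vec d → ℝ} (hφ : Continuous φ) {grad : Vec d → Vec d} {xs : Vec d}
    (hxs : xs ∈ Q) {s : ℝ≥0∞} (hs : 1 ≤ s) (hs' : s ≠ ⊤)
    (hconj : s.toReal.HolderConjugate P.r.toReal)
    (hconv : ∀ x ∈ Q, ∀ z ∈ Q, φ x + inner ℝ (grad x) (z - x) ≤ φ z) {L τ : ℕ → ℝ}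
    (hsmooth : ∀ k, ∀ x ∈ Q, ∀ z ∈ Q,
      φ z ≤ φ x + inner ℝ (grad x) (z - x) + L k * pNorm P.r (z - x) ^ 2 + τ k)
    (hL : ∀ k, L k * P.a k ^ 2 ≤ P.growth / 2 * P.A (k + 1))
    (hmean : ∀ x v, ∫ ω : Fin P.B → UnitSphere d, inner ℝ (batchEstimate γ f x ω - grad x) v
      ∂Measure.pi (fun _ => uniformSphere d) = 0) {V : ℝ}
    (hvar : ∀ x, ∫ ω : Fin P.B → UnitSphere d, pNorm s (batchEstimate γ f x ω - grad x) ^ 2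
      ∂Measure.pi (fun _ => uniformSphere d) ≤ V)
    (n k : ℕ) {y : Vec d} (hy : y ∈ Q) (G : Vec d) :
    P.A (k + n) * (∫ e, φ ((fgmLoop P γ Q x₀ n e k y G).run f) ∂directionLaw d n P.B - φ xs)
      ≤ P.potential Q x₀ φ xs k y G
        + ∑ i ∈ Finset.range n, (P.a (k + i) ^ 2 / (2 * P.growth) * V
          + P.A (k + i + 1) * τ (k + i)) := by
  induction n generalizing k y G with
  | zero =>
    have : IsProbabilityMeasure (directionLaw d 0 P.B) := by unfold directionLaw; infer_instance
    simp only [fgmLoop, ZOMethod.run, integral_const, probReal_univ, one_smul, Finset.range_zero,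
      Finset.sum_empty, add_zero]
    exact P.le_potential hQ hx₀ hxs k y G
  | succ n ih =>
    set μ : Measure (Fin P.B → UnitSphere d) := Measure.pi fun _ => uniformSphere d with hμ
    set z := P.prox Q x₀ G with hz
    set x := P.combine k y z with hx
    set S := ∑ i ∈ Finset.range n, (P.a (k + 1 + i) ^ 2 / (2 * P.growth) * V
          + P.A (k + 1 + i + 1) * τ (k + 1 + i)) with hS
    have hcont : Continuous fun e : Fin (n + 1) → Fin P.B → UnitSphere d =>
        φ ((fgmLoop P γ Q x₀ (n + 1) e k y G).run f) := by
      have hpair : Continuous fun e : Fin (n + 1) → Fin P.B → UnitSphere d => (e, y, G) := by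
        fun_prop
      exact hφ.comp ((P.continuous_run_fgmLoop (γ := γ) hf hQ hQc hx₀ (n + 1) k).comp hpair)
    obtain ⟨hint, heq⟩ := integral_pi_fin_succ μ hcont
    set H : (Fin P.B → UnitSphere d) → ℝ := fun ω =>
      ∫ e, φ ((fgmLoop P γ Q x₀ (n + 1) (Fin.cons ω e) k y G).run f)
        ∂Measure.pi fun _ : Fin n => μ with hH
    have hst : ∀ ω, P.A (k + (n + 1)) * (H ω - φ xs) ≤ P.potential Q x₀ φ xs k y G
        + P.a k * inner ℝ (batchEstimate γ f x ω - grad x) (xs - z)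
        + P.a k ^ 2 / (2 * P.growth) * pNorm s (batchEstimate γ f x ω - grad x) ^ 2
        + P.A (k + 1) * τ k + S := by
      intro ω
      have h1 := ih (k + 1) (P.combine_mem hQc k hy
        (P.prox_mem hQ hx₀ (G + P.a k • batchEstimate γ f x ω)))
        (G + P.a k • batchEstimate γ f x ω)
      have h2 := P.potential_step hQ hQc hx₀ hxs hs hs' hconj hconv (hsmooth k) (hL k) hy G
        (batchEstimate γ f x ω)
      have h3 : H ω = ∫ e, φ ((fgmLoop P γ Q x₀ n e (k + 1)
          (P.combine k y (P.prox Q x₀ (G + P.a k • batchEstimate γ f x ω)))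
          (G + P.a k • batchEstimate γ f x ω)).run f) ∂directionLaw d n P.B := by
        simp only [hH, run_fgmLoop_succ, Fin.cons_zero, Fin.cons_succ]
        rfl
      rw [h3, show k + (n + 1) = k + 1 + n by ring]
      linarith
    have hb : Continuous fun ω : Fin P.B → UnitSphere d => batchEstimate γ f x ω - grad x :=
      ((continuous_batchEstimate hf).comp (continuous_const.prodMk continuous_id)).sub
        continuous_const
    have hpn := continuous_pNorm (d := d) hs
    have i1 : Integrable (fun ω : Fin P.B → UnitSphere d =>
        inner ℝ (batchEstimate γ f x ω - grad x) (xs - z)) μ :=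
      integrable_of_continuous_of_compactSpace (hb.inner continuous_const)
    have i2 : Integrable (fun ω : Fin P.B → UnitSphere d =>
        pNorm s (batchEstimate γ f x ω - grad x) ^ 2) μ :=
      integrable_of_continuous_of_compactSpace ((hpn.comp hb).pow 2)
    -- The point z_k does not depend on the current batch, so the inner product of the noise with
    -- x_* - z_k integrates to zero by `hmean`.
    have hmono := integral_mono ((hint.sub (integrable_const (φ xs))).const_mul
      (P.A (k + (n + 1)))) (((((integrable_const (P.potential Q x₀ φ xs k y G)).add
        (i1.const_mul (P.a k))).add (i2.const_mul (P.a k ^ 2 / (2 * P.growth)))).add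
        (integrable_const (P.A (k + 1) * τ k))).add (integrable_const S)) hst
    simp only [Pi.add_apply, Pi.sub_apply] at hmono
    rw [integral_const_mul, integral_sub hint (integrable_const _),
      integral_add (by fun_prop) (by fun_prop), integral_add (by fun_prop) (by fun_prop),
      integral_add (by fun_prop) (by fun_prop), integral_add (by fun_prop) (by fun_prop),
      integral_const_mul, integral_const_mul, hmean] at hmono
    simp only [integral_const, probReal_univ, one_smul, mul_zero, add_zero] at hmono
    have hV := mul_le_mul_of_nonneg_left (hvar x)
      (div_nonneg (sq_nonneg (P.a k)) (mul_nonneg zero_le_two P.growth_pos.le))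
    rw [Finset.sum_range_succ', directionLaw, heq]
    have hS' : ∑ i ∈ Finset.range n, (P.a (k + (i + 1)) ^ 2 / (2 * P.growth) * V
          + P.A (k + (i + 1) + 1) * τ (k + (i + 1))) = S := by
      refine Finset.sum_congr rfl fun i _ => ?_
      rw [show k + (i + 1) = k + 1 + i by ring]
    rw [hS']
    simp only [add_zero]
    linarith

end AGMParams

/-! ### Convergence in terms of the parameters -/

section Smoothing

variable {d : ℕ} {γ M : ℝ} {F : Vec d → ℝ} {r : ℝ≥0∞}

theorem exists_lipschitzWith_of_le_pNorm (hr : 1 ≤ r) (hr2 : r ≤ 2) (hM : 0 ≤ M)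
    (hF : ∀ x y, |F y - F x| ≤ M * pNorm r (y - x)) : ∃ K, LipschitzWith K F := by
  set c := M * (d : ℝ) ^ (1 / r.toReal - 1 / (2 : ℝ≥0∞).toReal)
  have hc : 0 ≤ c := by positivity
  refine ⟨c.toNNReal, LipschitzWith.of_dist_le_mul fun x y => ?_⟩
  rw [Real.coe_toNNReal _ hc, Real.dist_eq, dist_eq_norm, mul_assoc]
  refine (hF y x).trans (mul_le_mul_of_nonneg_left ?_ hM)
  have := pNorm_le_card_rpow_mul hr hr2 (by simp) (x - y)
  rwa [pNorm_two] at this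

theorem ballAverage_sub_le (hFc : Continuous F) (hF : ∀ x y, |F y - F x| ≤ M * pNorm r (y - x))
    (x z : Vec d) : ballAverage γ F z - ballAverage γ F x ≤ M * pNorm r (z - x) := by
  rw [sub_le_iff_le_add']
  refine ballAverage_mono hFc hFc fun u _ => ?_
  have := (abs_le.1 (hF (x + γ • u) (z + γ • u))).2
  rw [add_sub_add_right_eq_sub] at this
  linarith

theorem continuous_ballAverage {K : NNReal} (hF : LipschitzWith K F) :
    Continuous (ballAverage γ F) := by
  refine (LipschitzWith.of_dist_le_mul (K := K) fun x y => ?_).continuous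
  have h : ∀ x y : Vec d, |F y - F x| ≤ K * pNorm 2 (y - x) := fun x y => by
    have := hF.dist_le_mul y x
    rwa [Real.dist_eq, dist_eq_norm, ← pNorm_two] at this
  have h1 := ballAverage_sub_le (γ := γ) hF.continuous h x y
  have h2 := ballAverage_sub_le (γ := γ) hF.continuous h y x
  rw [pNorm_two, norm_sub_rev] at h1
  rw [pNorm_two] at h2
  rw [Real.dist_eq, dist_eq_norm]
  exact abs_sub_le_iff.2 ⟨h2, h1⟩

variable [NeZero d]

/-- The subgradient inequality at z bounds the increment by ⟨g(z), z - x⟩, and the Lipschitz bound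
replaces g(z) by g(x). The Lipschitz property in ‖·‖_r and ‖·‖₂ ≤ ‖·‖_r yield a constant for the
r-norm on both sides. -/
theorem ballAverage_le_quadratic (hr : 1 ≤ r) (hr2 : r ≤ 2) (hM : 0 ≤ M)
    (hFconv : ConvexOn ℝ Set.univ F) (hF : ∀ x y, |F y - F x| ≤ M * pNorm r (y - x)) (hγ : 0 < γ)
    (x z : Vec d) :
    ballAverage γ F z ≤ ballAverage γ F x + inner ℝ (sphereGradient γ F x) (z - x)
      + √d * M / γ * pNorm r (z - x) ^ 2 := by
  obtain ⟨K, hK⟩ := exists_lipschitzWith_of_le_pNorm hr hr2 hM hF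
  have hN : 0 ≤ pNorm r (z - x) := pNorm_nonneg hr _
  have h1 := inner_sphereGradient_le hFconv hK hγ z (x - z)
  have h2 := inner_sphereGradient_sub_le (c := M * pNorm r (z - x)) (x := x) (y := z)
    hK.continuous hγ (by positivity)
    (fun u => by simpa only [add_sub_add_right_eq_sub] using hF (x + u) (z + u)) (z - x)
  have h3 : ‖z - x‖ ≤ pNorm r (z - x) := by
    rw [← pNorm_two]
    exact pNorm_antitone hr hr2 (by simp) _
  have h4 : √d / γ * (M * pNorm r (z - x)) * ‖z - x‖
      ≤ √d / γ * (M * pNorm r (z - x)) * pNorm r (z - x) := by gcongr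
  have h5 : √d / γ * (M * pNorm r (z - x)) * pNorm r (z - x)
      = √d * M / γ * pNorm r (z - x) ^ 2 := by ring
  rw [add_sub_cancel, ← neg_sub z x, inner_neg_right] at h1
  rw [inner_sub_left] at h2
  linarith

/-- No smoothness is used: the increment and -⟨g(x), z - x⟩ are both at most M‖z - x‖_r, and 2Mt ≤
Lt² + M²/L for any L > 0. -/
theorem ballAverage_le_quadratic_add (hr : 1 ≤ r) (hr2 : r ≤ 2) (hM : 0 ≤ M)
    (hFconv : ConvexOn ℝ Set.univ F) (hF : ∀ x y, |F y - F x| ≤ M * pNorm r (y - x)) (hγ : 0 < γ)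
    {L : ℝ} (hL : 0 < L) (x z : Vec d) :
    ballAverage γ F z ≤ ballAverage γ F x + inner ℝ (sphereGradient γ F x) (z - x)
      + L * pNorm r (z - x) ^ 2 + M ^ 2 / L := by
  obtain ⟨K, hK⟩ := exists_lipschitzWith_of_le_pNorm hr hr2 hM hF
  have h1 := inner_sphereGradient_le hFconv hK hγ x (x - z)
  have h2 := ballAverage_sub_le (γ := γ) hK.continuous hF x z
  have h3 := ballAverage_sub_le (γ := γ) hK.continuous hF x (x + (x - z))
  rw [add_sub_cancel_left, pNorm_sub_comm hr] at h3
  have h4 : L * pNorm r (z - x) ^ 2 + M ^ 2 / L - 2 * (M * pNorm r (z - x))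
      = (L * pNorm r (z - x) - M) ^ 2 / L := by
    field_simp
    ring
  have h5 : 0 ≤ (L * pNorm r (z - x) - M) ^ 2 / L := by positivity
  rw [← neg_sub z x, inner_neg_right] at h1
  rw [← neg_sub z x] at h3
  linarith

end Smoothing

namespace AGMParams

variable {d : ℕ} [NeZero d] (P : AGMParams) {γ M M₂ ρ : ℝ} {Q : Set (Vec d)} {x₀ xs : Vec d}
  {f : Vec d → ℝ}

/-- The error bound of the method, for step sizes that satisfy the smoothness condition or
its substitute for nonsmooth objectives. -/
theorem integral_fgm_le (hρ : 2 ≤ ρ) (hconj : ρ.HolderConjugate P.r.toReal) (hρB : ρ ≤ P.B)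
    (hγ : 0 < γ) (hM : 0 ≤ M) (hM₂ : 0 < M₂) (hQ : IsClosed Q) (hQc : Convex ℝ Q) (hx₀ : x₀ ∈ Q)
    (hxs : xs ∈ Q) (hf : ConvexOn ℝ (Metric.cthickening γ Q) f)
    (hfM : ∀ x ∈ Metric.cthickening γ Q, ∀ y ∈ Metric.cthickening γ Q,
      |f y - f x| ≤ M * pNorm P.r (y - x))
    (hfM₂ : ∀ x ∈ Metric.cthickening γ Q, ∀ y ∈ Metric.cthickening γ Q,
      |f y - f x| ≤ M₂ * ‖y - x‖)
    {L τ : ℕ → ℝ} (hLτ : ∀ k, (L k = √d * M / γ ∧ τ k = 0) ∨ (0 < L k ∧ τ k = M ^ 2 / L k))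
    (hL : ∀ k, L k * P.a k ^ 2 ≤ P.growth / 2 * P.A (k + 1)) :
    Integrable (fun e => f ((fgm P γ Q x₀ e).run f)) (directionLaw d P.N P.B) ∧
      P.A P.N * (∫ e, f ((fgm P γ Q x₀ e).run f) ∂directionLaw d P.N P.B - f xs - γ * M₂)
        ≤ P.β * pNorm P.r (x₀ - xs) ^ 2 / 2
          + ∑ k ∈ Finset.range P.N, (P.a k ^ 2 / (2 * P.growth)
              * (varianceConst * ρ * (d : ℝ) ^ (2 / ρ) * M₂ ^ 2 / P.B) + P.A (k + 1) * τ k) := by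
  have hr := P.one_lt_r.le
  have hne : (Metric.cthickening γ Q).Nonempty := ⟨x₀, Metric.self_subset_cthickening Q hx₀⟩
  -- Each extension keeps one of the two Lipschitz constants: F₁ serves the smoothness estimate, F
  -- the variance and the smoothing bias. They agree on the γ-neighbourhood of Q, so their ball
  -- averages and spherical gradients agree on Q.
  obtain ⟨F₁, hF₁c, hF₁M, hF₁f⟩ := exists_convex_lipschitz_extension hr hne hf hM hfM
  obtain ⟨F, hFc, hFM, hFf⟩ := exists_convex_lipschitz_extension (p := 2) one_le_two hne hf hM₂.le
    (by simpa only [pNorm_two] using hfM₂)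
  have hQs : ∀ x ∈ Q, F x = f x := fun x hx => hFf x (Metric.self_subset_cthickening Q hx)
  set K := M₂.toNNReal with hKdef
  have hKM : (K : ℝ) = M₂ := Real.coe_toNNReal _ hM₂.le
  have hK : LipschitzWith K F := LipschitzWith.of_dist_le_mul fun x y => by
    rw [hKM, Real.dist_eq, dist_eq_norm, ← pNorm_two]
    exact hFM y x
  have hcongr : ∀ x ∈ Q, ∀ u : Vec d, ‖u‖ ≤ 1 → F₁ (x + γ • u) = F (x + γ • u) := by
    intro x hx u hu
    have := add_smul_mem_cthickening hγ.le hx hu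
    rw [hF₁f _ this, hFf _ this]
  set φ := ballAverage γ F with hφ
  have hφc : Continuous φ := continuous_ballAverage hK
  have hsmooth : ∀ k, ∀ x ∈ Q, ∀ z ∈ Q, φ z ≤ φ x + inner ℝ (sphereGradient γ F x) (z - x)
      + L k * pNorm P.r (z - x) ^ 2 + τ k := by
    intro k x hx z hz
    rw [hφ, ← ballAverage_congr (hcongr x hx), ← ballAverage_congr (hcongr z hz),
      ← sphereGradient_congr (hcongr x hx)]
    rcases hLτ k with ⟨h1, h2⟩ | ⟨h1, h2⟩
    · rw [h1, h2, add_zero]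
      exact ballAverage_le_quadratic hr P.r_le_two hM hF₁c hF₁M hγ x z
    · rw [h2]
      exact ballAverage_le_quadratic_add hr P.r_le_two hM hF₁c hF₁M hγ h1 x z
  have hrun : ∀ e, (fgm P γ Q x₀ e).run f = (fgm P γ Q x₀ e).run F := fun e =>
    P.run_fgmLoop_congr hγ.le hQ hQc hx₀ hFf P.N e 0 hx₀ 0
  have hmem : ∀ e, (fgm P γ Q x₀ e).run F ∈ Q := fun e =>
    P.run_fgmLoop_mem hQ hQc hx₀ P.N e 0 hx₀ 0
  have hfrun : ∀ e, f ((fgm P γ Q x₀ e).run f) = F ((fgm P γ Q x₀ e).run F) := fun e => by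
    rw [hrun, hQs _ (hmem e)]
  have hpair : Continuous fun e : Fin P.N → Fin P.B → UnitSphere d => (e, x₀, (0 : Vec d)) := by
    fun_prop
  have hcont : Continuous fun e : Fin P.N → Fin P.B → UnitSphere d => (fgm P γ Q x₀ e).run F :=
    (P.continuous_run_fgmLoop (γ := γ) hK.continuous hQ hQc hx₀ P.N 0).comp hpair
  have : IsProbabilityMeasure (directionLaw d P.N P.B) := by unfold directionLaw; infer_instance
  have hint : Integrable (fun e => F ((fgm P γ Q x₀ e).run F)) (directionLaw d P.N P.B) :=
    integrable_of_continuous_of_compactSpace (hK.continuous.comp hcont)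
  have hint' : Integrable (fun e => φ ((fgm P γ Q x₀ e).run F)) (directionLaw d P.N P.B) :=
    integrable_of_continuous_of_compactSpace (hφc.comp hcont)
  simp only [hfrun]
  refine ⟨hint, ?_⟩
  have hs1 : (1 : ℝ≥0∞) ≤ ENNReal.ofReal ρ := by
    rw [← ENNReal.ofReal_one]
    exact ENNReal.ofReal_le_ofReal (by linarith)
  have hmain := P.integral_run_fgmLoop_le (γ := γ) hK.continuous hQ hQc hx₀ hφc hxs hs1
    ENNReal.ofReal_ne_top (by rwa [ENNReal.toReal_ofReal (by linarith)])
    (fun x _ z _ => by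
      have := inner_sphereGradient_le hFc hK hγ x (z - x)
      rw [add_sub_cancel] at this
      linarith)
    hsmooth hL (fun x v => integral_inner_batchEstimate_sub P.B_pos hK.continuous x v)
    (fun x => integral_pNorm_sq_batchGradient_sub_le (by rwa [Real.toNNReal_pos]) hK hγ x hρ hρB)
    P.N 0 hx₀ 0
  simp only [zero_add, hKM] at hmain
  have h1 : ∫ e, F ((fgm P γ Q x₀ e).run F) ∂directionLaw d P.N P.B
      ≤ ∫ e, φ ((fgm P γ Q x₀ e).run F) ∂directionLaw d P.N P.B :=
    integral_mono hint hint' fun e => le_ballAverage hFc hK.continuous _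
  have h2 := ballAverage_le hK hγ.le xs
  rw [hQs xs hxs, hKM] at h2
  have h3 := P.potential_zero_le Q x₀ φ xs
  have h4 : P.A P.N * (∫ e, F ((fgm P γ Q x₀ e).run F) ∂directionLaw d P.N P.B - f xs - γ * M₂)
      ≤ P.A P.N * (∫ e, φ ((fgm P γ Q x₀ e).run F) ∂directionLaw d P.N P.B - φ xs) :=
    mul_le_mul_of_nonneg_left (by linarith) (P.A_nonneg _)
  have h5 := h4.trans hmain
  linarith

end AGMParams

/-! ### The choice of the parameters -/

namespace AGMParams

/-- The parameters with prox-exponent conjugate to `ρ` and growth modulus `g`. -/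
noncomputable def ofGrowth (N B : ℕ) (a : ℕ → ℝ) (ρ g : ℝ) (hB : 0 < B) (ha : ∀ k, 0 < a k)
    (hρ : 2 ≤ ρ) (hg : 0 < g) : AGMParams where
  N := N
  B := B
  a := a
  -- Since r - 1 = 1/(ρ - 1), this weight gives the growth modulus β(r-1)/4 = g.
  β := 4 * g * (ρ - 1)
  r := ENNReal.ofReal (ρ / (ρ - 1))
  B_pos := hB
  a_pos := ha
  β_pos := mul_pos (by positivity) (by linarith)
  one_lt_r := by
    rw [← ENNReal.ofReal_one]
    refine (ENNReal.ofReal_lt_ofReal_iff (div_pos (by linarith) (by linarith))).2 ?_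
    rw [lt_div_iff₀ (by linarith)]
    linarith
  r_le_two := by
    rw [← ENNReal.ofReal_ofNat]
    refine ENNReal.ofReal_le_ofReal ?_
    rw [div_le_iff₀ (by linarith)]
    linarith

theorem growth_ofGrowth {N B : ℕ} {a : ℕ → ℝ} {ρ g : ℝ} (hB : 0 < B) (ha : ∀ k, 0 < a k)
    (hρ : 2 ≤ ρ) (hg : 0 < g) : (ofGrowth N B a ρ g hB ha hρ hg).growth = g := by
  have h : 0 < ρ - 1 := by linarith
  unfold growth ofGrowth
  simp only
  rw [ENNReal.toReal_ofReal (by positivity)]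
  field_simp
  ring

theorem bias_ofGrowth_le {N B : ℕ} {a : ℕ → ℝ} {ρ g κ R : ℝ} (hB : 0 < B) (ha : ∀ k, 0 < a k)
    (hρ : 2 ≤ ρ) (hg : 0 < g) (hρκ : ρ ≤ 3 * κ) :
    (ofGrowth N B a ρ g hB ha hρ hg).β * (R ^ 2 / κ) / 2 ≤ 6 * g * R ^ 2 := by
  have hκ : 0 < κ := by linarith
  unfold ofGrowth
  simp only
  rw [mul_div_assoc', div_div, div_le_iff₀ (by positivity)]
  have : 0 ≤ g * R ^ 2 := by positivity
  nlinarith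

/-- Weights k + 1 and growth 4L satisfy the step condition, and A_N ≥ N²/2. The bias 24LR² and the
noise are each at most N²ε/8: the first fixes N² ≥ 192LR²/ε, the second B ≥ NW/(Lε). The hypothesis
`hX` keeps the rounding of N within a factor two. -/
theorem exists_accelerated {ρ κ L W R ε : ℝ} (hρ : 2 ≤ ρ) (hρκ : ρ ≤ 3 * κ) (hL : 0 < L)
    (hW : 0 < W) (hε : 0 < ε) (hX : 1 ≤ 192 * L * R ^ 2 / ε) :
    ∃ P : AGMParams, P.r = ENNReal.ofReal (ρ / (ρ - 1)) ∧ ρ ≤ P.B ∧ 0 < P.N ∧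
      (∀ k, L * P.a k ^ 2 ≤ P.growth / 2 * P.A (k + 1)) ∧
      P.β * (R ^ 2 / κ) / 2 + ∑ k ∈ Finset.range P.N, P.a k ^ 2 / (2 * P.growth) * (W / P.B)
        ≤ P.A P.N * (ε / 2) ∧
      (P.N : ℝ) ^ 2 ≤ 768 * L * R ^ 2 / ε ∧
      (P.N : ℝ) * (P.B + P.B) ≤ 4 * ρ * P.N + 1536 * W * R ^ 2 / ε ^ 2 := by
  set X := 192 * L * R ^ 2 / ε with hXdef
  set N := ⌈√X⌉₊ with hN
  have hs1 : 1 ≤ √X := Real.one_le_sqrt.2 hX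
  have hXN : √X ≤ N := Nat.le_ceil _
  have hNX : (N : ℝ) ≤ 2 * √X := by
    have := Nat.ceil_lt_add_one (Real.sqrt_nonneg X)
    linarith
  have hsq : √X ^ 2 = X := Real.sq_sqrt (by linarith)
  have hN1 : (1 : ℝ) ≤ N := hs1.trans hXN
  have hXN2 : X ≤ (N : ℝ) ^ 2 := by
    rw [← hsq]
    gcongr
  have hNX2 : (N : ℝ) ^ 2 ≤ 4 * X := by
    have : (N : ℝ) ^ 2 ≤ (2 * √X) ^ 2 := by gcongr
    rw [mul_pow, hsq] at this
    linarith
  set b := max ρ (N * W / (L * ε)) with hb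
  set B := ⌈b⌉₊ with hBdef
  have hb0 : 0 < b := lt_of_lt_of_le (by linarith) (le_max_left _ _)
  have hbB : b ≤ B := Nat.le_ceil _
  have hB : 0 < B := Nat.ceil_pos.2 hb0
  have hB' : (0 : ℝ) < B := by exact_mod_cast hB
  have hBb : (B : ℝ) ≤ ρ + N * W / (L * ε) + 1 := by
    have h1 := Nat.ceil_lt_add_one hb0.le
    have h2 : b ≤ ρ + N * W / (L * ε) := max_le_add_of_nonneg (by linarith) (by positivity)
    linarith
  have ha : ∀ k : ℕ, (0 : ℝ) < (k : ℝ) + 1 := fun k => by positivity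
  refine ⟨ofGrowth N B (fun k => (k : ℝ) + 1) ρ (4 * L) hB ha hρ (by positivity), rfl,
    (le_max_left _ _).trans hbB, ?_, ?_, ?_, ?_, ?_⟩
  · exact Nat.ceil_pos.2 (by linarith)
  · intro k
    rw [growth_ofGrowth]
    have hA : ∀ n : ℕ, ∑ i ∈ Finset.range n, ((i : ℝ) + 1) = n * (n + 1) / 2 := by
      intro n
      induction n with
      | zero => simp
      | succ n ih =>
        rw [Finset.sum_range_succ, ih]
        push_cast
        ring
    simp only [ofGrowth, A, hA]
    push_cast
    have : 0 ≤ L * ((k : ℝ) + 1) := by positivity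
    nlinarith
  · have hA : (N : ℝ) ^ 2 / 2
        ≤ (ofGrowth N B (fun k => (k : ℝ) + 1) ρ (4 * L) hB ha hρ (by positivity)).A N := by
      have hA : ∀ n : ℕ, (n : ℝ) ^ 2 / 2 ≤ ∑ i ∈ Finset.range n, ((i : ℝ) + 1) := by
        intro n
        induction n with
        | zero => simp
        | succ n ih =>
          rw [Finset.sum_range_succ]
          push_cast
          linarith
      exact hA N
    have hbias := bias_ofGrowth_le (N := N) (R := R) (a := fun k : ℕ => (k : ℝ) + 1) hB ha hρ
      (mul_pos four_pos hL) hρκ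
    have hsum : ∑ k ∈ Finset.range N, ((k : ℝ) + 1) ^ 2 / (2 * (4 * L)) * (W / B)
        ≤ N * ((N : ℝ) ^ 2 / (2 * (4 * L)) * (W / B)) := by
      have := Finset.sum_le_card_nsmul (Finset.range N)
        (fun k : ℕ => ((k : ℝ) + 1) ^ 2 / (2 * (4 * L)) * (W / B))
        ((N : ℝ) ^ 2 / (2 * (4 * L)) * (W / B)) (fun k hk => by
          have : (k : ℝ) + 1 ≤ N := by exact_mod_cast Finset.mem_range.1 hk
          gcongr)
      rwa [Finset.card_range, nsmul_eq_mul] at this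
    have hnoise : N * ((N : ℝ) ^ 2 / (2 * (4 * L)) * (W / B)) ≤ (N : ℝ) ^ 2 * (ε / 8) := by
      have h1 : N * W / (L * ε) ≤ B := (le_max_right _ _).trans hbB
      rw [div_le_iff₀ (by positivity)] at h1
      have e : N * ((N : ℝ) ^ 2 / (2 * (4 * L)) * (W / B))
          = (N : ℝ) ^ 2 * ((N * W) / (8 * L * B)) := by
        field_simp
        ring
      rw [e]
      refine mul_le_mul_of_nonneg_left ?_ (by positivity)
      rw [div_le_iff₀ (by positivity)]
      linarith
    have hbias2 : 6 * (4 * L) * R ^ 2 ≤ (N : ℝ) ^ 2 * (ε / 8) := by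
      rw [hXdef, div_le_iff₀ hε] at hXN2
      linarith
    have hA2 := mul_le_mul_of_nonneg_right hA (half_pos hε).le
    rw [growth_ofGrowth]
    refine (add_le_add hbias (hsum.trans hnoise)).trans ?_
    refine le_trans ?_ hA2
    linarith
  · refine hNX2.trans (le_of_eq ?_)
    rw [hXdef]
    ring
  · have h1 : (N : ℝ) * (B + B) ≤ N * (2 * (2 * ρ + N * W / (L * ε))) :=
      mul_le_mul_of_nonneg_left (by linarith) (by linarith)
    have h2 : (N : ℝ) * (2 * (2 * ρ + N * W / (L * ε)))
        = 4 * ρ * N + 2 * (N : ℝ) ^ 2 * W / (L * ε) := by ring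
    have h3 : 2 * (N : ℝ) ^ 2 * W / (L * ε) ≤ 2 * (4 * X) * W / (L * ε) := by gcongr
    have h4 : 2 * (4 * X) * W / (L * ε) = 1536 * W * R ^ 2 / ε ^ 2 := by
      rw [hXdef]
      field_simp
      ring
    change (N : ℝ) * (B + B) ≤ 4 * ρ * N + 1536 * W * R ^ 2 / ε ^ 2
    linarith

/-- With unit weights A_k = k, and the surrogate L_k = g(k+1)/2, the largest one allowed by the step
condition, makes A_{k+1}τ_k = 2M²/g constant. Each step then costs at most K/g = ε/4, and N ≥
96KR²/ε² brings the bias to Nε/4. -/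
theorem exists_robust {ρ κ K M W R ε : ℝ} (hρ : 2 ≤ ρ) (hρκ : ρ ≤ 3 * κ) (hK : 0 < K)
    (hW : 0 ≤ W) (hWK : W / ρ / 2 + 2 * M ^ 2 ≤ K) (hε : 0 < ε) (hR : 0 < R) :
    ∃ (P : AGMParams) (L τ : ℕ → ℝ), P.r = ENNReal.ofReal (ρ / (ρ - 1)) ∧ ρ ≤ P.B ∧ 0 < P.N ∧
      (∀ k, 0 < L k ∧ τ k = M ^ 2 / L k) ∧
      (∀ k, L k * P.a k ^ 2 ≤ P.growth / 2 * P.A (k + 1)) ∧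
      P.β * (R ^ 2 / κ) / 2 + ∑ k ∈ Finset.range P.N,
          (P.a k ^ 2 / (2 * P.growth) * (W / P.B) + P.A (k + 1) * τ k)
        ≤ P.A P.N * (ε / 2) ∧
      (P.N : ℝ) ≤ 96 * K * R ^ 2 / ε ^ 2 + 1 ∧
      (P.N : ℝ) * (P.B + P.B) ≤ 4 * ρ * P.N := by
  set X := 96 * K * R ^ 2 / ε ^ 2 with hXdef
  have hX0 : 0 < X := by positivity
  set N := ⌈X⌉₊ with hN
  have hXN : X ≤ N := Nat.le_ceil _
  set B := ⌈ρ⌉₊ with hBdef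
  have hρB : ρ ≤ B := Nat.le_ceil _
  have hB : 0 < B := Nat.ceil_pos.2 (by linarith)
  have hBρ : (B : ℝ) ≤ 2 * ρ := by
    have := Nat.ceil_lt_add_one (show 0 ≤ ρ by linarith)
    linarith
  set g := 4 * K / ε with hg
  have hg0 : 0 < g := by positivity
  have ha : ∀ k : ℕ, (0 : ℝ) < 1 := fun _ => one_pos
  have hA : ∀ k, (ofGrowth N B (fun _ => (1 : ℝ)) ρ g hB ha hρ hg0).A k = k := fun k => by
    simp [A, ofGrowth]
  refine ⟨ofGrowth N B (fun _ => (1 : ℝ)) ρ g hB ha hρ hg0, fun k => g / 2 * (k + 1),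
    fun k => M ^ 2 / (g / 2 * (k + 1)), rfl, hρB, Nat.ceil_pos.2 hX0,
    fun k => ⟨by positivity, rfl⟩, ?_, ?_, ?_, ?_⟩
  · intro k
    rw [growth_ofGrowth, hA]
    simp only [ofGrowth]
    push_cast
    linarith
  · have hbias := bias_ofGrowth_le (N := N) (R := R) (a := fun _ : ℕ => (1 : ℝ)) hB ha hρ hg0 hρκ
    have hterm : ∀ k ∈ Finset.range N, (1 : ℝ) ^ 2 / (2 * g) * (W / B)
        + ((k + 1 : ℕ) : ℝ) * (M ^ 2 / (g / 2 * (k + 1))) ≤ ε / 4 := by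
      intro k _
      have e : (1 : ℝ) ^ 2 / (2 * g) * (W / B) + ((k + 1 : ℕ) : ℝ) * (M ^ 2 / (g / 2 * (k + 1)))
          = (W / B / 2 + 2 * M ^ 2) / g := by
        push_cast
        field_simp
      have h1 : W / B ≤ W / ρ := by gcongr
      rw [e, div_le_iff₀ hg0]
      have : ε / 4 * g = K := by
        rw [hg]
        field_simp
      linarith
    have hsum := Finset.sum_le_card_nsmul (Finset.range N) _ _ hterm
    rw [Finset.card_range, nsmul_eq_mul] at hsum
    have hb2 : 6 * g * R ^ 2 ≤ N * (ε / 4) := by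
      have : 6 * g * R ^ 2 = X * (ε / 4) := by
        rw [hg, hXdef]
        field_simp
        ring
      rw [this]
      gcongr
    rw [growth_ofGrowth]
    simp only [hA]
    refine (add_le_add hbias hsum).trans ?_
    change _ ≤ (N : ℝ) * (ε / 2)
    linarith
  · exact (Nat.ceil_lt_add_one hX0.le).le
  · change (N : ℝ) * (B + B) ≤ 4 * ρ * N
    have : (0 : ℝ) ≤ N := by positivity
    nlinarith

end AGMParams

/-! ### The exponent of the prox-function -/

section Exponent

variable {d : ℕ} {p q : ℝ≥0∞}

theorem toReal_inv_add_toReal_inv (hpq : 1 / p + 1 / q = 1) :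
    p.toReal⁻¹ + (q⁻¹).toReal = 1 := by
  rw [one_div, one_div] at hpq
  have hp' : p⁻¹ ≠ ⊤ := ne_top_of_le_ne_top ENNReal.one_ne_top (hpq ▸ le_self_add)
  have hq' : q⁻¹ ≠ ⊤ := ne_top_of_le_ne_top ENNReal.one_ne_top (hpq ▸ le_add_self)
  rw [← ENNReal.toReal_inv, ← ENNReal.toReal_add hp' hq', hpq, ENNReal.toReal_one]

theorem two_le_of_conjugate (hp : 1 ≤ p) (hp2 : p ≤ 2) (hpq : 1 / p + 1 / q = 1) : 2 ≤ q := by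
  by_contra! hq
  have h := toReal_inv_add_toReal_inv hpq
  have hpr : p.toReal ≤ 2 := by simpa using ENNReal.toReal_mono (by simp) hp2
  have hp1 := one_le_toReal_of_one_le hp (ne_top_of_le_ne_top (by simp) hp2)
  have h1 : (2 : ℝ)⁻¹ ≤ p.toReal⁻¹ := inv_anti₀ (by linarith) hpr
  have hqt : q ≠ ⊤ := ne_top_of_lt hq
  have hq0 : q ≠ 0 := by
    rintro rfl
    simp at hpq
  have h2 : q.toReal < 2 := by simpa using (ENNReal.toReal_lt_toReal hqt (by simp)).2 hq
  have h3 : (2 : ℝ)⁻¹ < q.toReal⁻¹ := inv_strictAnti₀ (ENNReal.toReal_pos hq0 hqt) h2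
  rw [ENNReal.toReal_inv] at h
  linarith

theorem two_le_three_mul_log (hd : 2 ≤ d) : 2 ≤ 3 * Real.log d := by
  have h1 : Real.log 2 ≤ Real.log d := Real.log_le_log two_pos (by exact_mod_cast hd)
  have := Real.log_two_gt_d9
  linarith

theorem rpow_inv_le_exp_one (hd : 2 ≤ d) {s : ℝ} (hs : s * Real.log d ≤ 1) :
    (d : ℝ) ^ s ≤ Real.exp 1 := by
  have hd0 : (0 : ℝ) < d := by exact_mod_cast (by omega : 0 < d)
  rw [Real.rpow_def_of_pos hd0, mul_comm]
  exact Real.exp_le_exp.2 hs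

/-- An exponent `ρ` comparable with `min {q, ln d}` such that `d ^ (1 / ρ - 1 / q)` is bounded. -/
theorem exists_conjugate_exponent (hd : 2 ≤ d) (hq : 2 ≤ q) :
    ∃ ρ : ℝ, 2 ≤ ρ ∧ ρ ≤ 3 * minQLog q d ∧ (q⁻¹).toReal ≤ 1 / ρ ∧
      (d : ℝ) ^ (1 / ρ - (q⁻¹).toReal) ≤ Real.exp 1 := by
  have hlog := two_le_three_mul_log hd
  -- Either ρ = q, or ρ = max {2, ln d} when q is larger; in the latter case d^(1/ρ) ≤ e. The factor
  -- 3 covers small d, where ln d < 2 but 3·ln 2 ≥ 2.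
  by_cases hqd : q ≤ ENNReal.ofReal (max 2 (Real.log d))
  · have hqt : q ≠ ⊤ := ne_top_of_le_ne_top ENNReal.ofReal_ne_top hqd
    have h2 : 2 ≤ q.toReal := by simpa using ENNReal.toReal_mono hqt hq
    have h3 : q.toReal ≤ max 2 (Real.log d) := ENNReal.toReal_le_of_le_ofReal (by positivity) hqd
    refine ⟨q.toReal, h2, ?_, by rw [ENNReal.toReal_inv, one_div], ?_⟩
    · rw [minQLog, ENNReal.toReal_min hqt ENNReal.ofReal_ne_top,
        ENNReal.toReal_ofReal (by linarith)]
      rcases min_cases q.toReal (Real.log d) with ⟨h, _⟩ | ⟨h, _⟩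
      · rw [h]
        linarith
      · rw [h]
        exact h3.trans (max_le hlog (by linarith))
    · rw [ENNReal.toReal_inv, one_div, sub_self, Real.rpow_zero]
      exact Real.one_le_exp zero_le_one
  · push Not at hqd
    have hρ : 2 ≤ max 2 (Real.log d) := le_max_left _ _
    have h1 : ENNReal.ofReal (Real.log d) ≤ q :=
      (ENNReal.ofReal_le_ofReal (le_max_right _ _)).trans hqd.le
    have hinv : (q⁻¹).toReal ≤ 1 / max 2 (Real.log d) := by
      have := ENNReal.toReal_mono (by simp) (ENNReal.inv_le_inv.2 hqd.le)
      rwa [ENNReal.toReal_inv (ENNReal.ofReal _), ENNReal.toReal_ofReal (by linarith),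
        inv_eq_one_div (max _ _)] at this
    refine ⟨max 2 (Real.log d), hρ, ?_, hinv, rpow_inv_le_exp_one hd ?_⟩
    · rw [minQLog, min_eq_right h1, ENNReal.toReal_ofReal (by linarith)]
      exact max_le hlog (by linarith)
    · have h4 : (1 / max 2 (Real.log d)) * Real.log d ≤ 1 := by
        rw [one_div_mul_eq_div, div_le_one (by linarith)]
        exact le_max_right _ _
      have h5 : 0 ≤ (q⁻¹).toReal * Real.log d := mul_nonneg ENNReal.toReal_nonneg (by linarith)
      linarith

theorem holderConjugate_div_sub_one {ρ : ℝ} (hρ : 2 ≤ ρ) : ρ.HolderConjugate (ρ / (ρ - 1)) := by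
  exact Real.HolderConjugate.conjExponent (by linarith)

theorem toReal_ofReal_div_sub_one {ρ : ℝ} (hρ : 2 ≤ ρ) :
    (ENNReal.ofReal (ρ / (ρ - 1))).toReal = ρ / (ρ - 1) :=
  ENNReal.toReal_ofReal (div_nonneg (by linarith) (by linarith))

theorem le_ofReal_div_sub_one (hp : 1 ≤ p) (hp2 : p ≤ 2) (hpq : 1 / p + 1 / q = 1) {ρ : ℝ}
    (hρ : 2 ≤ ρ) (hqρ : (q⁻¹).toReal ≤ 1 / ρ) : p ≤ ENNReal.ofReal (ρ / (ρ - 1)) := by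
  have hpt : p ≠ ⊤ := ne_top_of_le_ne_top (by simp) hp2
  have h := toReal_inv_add_toReal_inv hpq
  have hp1 := one_le_toReal_of_one_le hp hpt
  have hp0 : 0 < p.toReal := by linarith
  rw [ENNReal.le_ofReal_iff_toReal_le hpt (div_nonneg (by linarith) (by linarith))]
  have h1 : 1 - 1 / ρ ≤ p.toReal⁻¹ := by linarith
  have h2 : 1 - 1 / ρ = (ρ - 1) / ρ := by
    have : ρ ≠ 0 := by linarith
    field_simp
  rw [h2, ← one_div, le_div_iff₀ hp0, div_mul_eq_mul_div, div_le_one (by linarith)] at h1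
  rw [le_div_iff₀ (by linarith)]
  linarith

/-- By conjugacy 1/p - 1/r = 1/ρ - 1/q, so the comparison constant of the two norms is at most e. -/
theorem pNorm_le_exp_one_mul (hp : 1 ≤ p) (hp2 : p ≤ 2) (hpq : 1 / p + 1 / q = 1)
    {ρ : ℝ} (hρ : 2 ≤ ρ) (hqρ : (q⁻¹).toReal ≤ 1 / ρ)
    (hdρ : (d : ℝ) ^ (1 / ρ - (q⁻¹).toReal) ≤ Real.exp 1) (x : Vec d) :
    pNorm p x ≤ Real.exp 1 * pNorm (ENNReal.ofReal (ρ / (ρ - 1))) x := by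
  have hle := le_ofReal_div_sub_one hp hp2 hpq hρ hqρ
  have h := pNorm_le_card_rpow_mul hp hle ENNReal.ofReal_ne_top x
  have hadd := toReal_inv_add_toReal_inv hpq
  have e : 1 / p.toReal - 1 / (ENNReal.ofReal (ρ / (ρ - 1))).toReal
      = 1 / ρ - (q⁻¹).toReal := by
    have h1 : ρ ≠ 0 := by linarith
    have h2 : 1 / (ρ / (ρ - 1)) = 1 - 1 / ρ := by
      rw [one_div_div]
      field_simp
    rw [toReal_ofReal_div_sub_one hρ, h2, one_div p.toReal]
    linarith
  rw [e] at h
  exact h.trans (mul_le_mul_of_nonneg_right hdρ (pNorm_nonneg (hp.trans hle) x))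

theorem rpow_two_div_le (hd : 2 ≤ d) {ρ t : ℝ} (hdρ : (d : ℝ) ^ (1 / ρ - t) ≤ Real.exp 1) :
    (d : ℝ) ^ (2 / ρ) ≤ Real.exp 1 ^ 2 * (d : ℝ) ^ (2 * t) := by
  have hd0 : (0 : ℝ) < d := by exact_mod_cast (by omega : 0 < d)
  have e : (d : ℝ) ^ (2 / ρ) = ((d : ℝ) ^ (1 / ρ - t)) ^ 2 * (d : ℝ) ^ (2 * t) := by
    rw [← Real.rpow_mul_natCast hd0.le, ← Real.rpow_add hd0]
    congr 1
    push_cast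
    ring
  rw [e]
  gcongr

end Exponent

/-! ### Accuracy ε from the error bound -/

namespace AGMParams

variable {d : ℕ} [NeZero d] (P : AGMParams) {M M₂ ρ ε S : ℝ} {Q : Set (Vec d)} {x₀ xs : Vec d}
  {f : Vec d → ℝ}

/-- The choice γ = ε/(2M₂) makes the smoothing bias γM₂ = ε/2; `hbound` leaves the other ε/2 to the
method. -/
theorem integral_fgm_sub_le (hρ : 2 ≤ ρ) (hPr : P.r = ENNReal.ofReal (ρ / (ρ - 1))) (hρB : ρ ≤ P.B)
    (hε : 0 < ε) (hM : 0 ≤ M) (hM₂ : 0 < M₂) (hQ : IsClosed Q) (hQc : Convex ℝ Q) (hx₀ : x₀ ∈ Q)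
    (hxs : xs ∈ Q) (hf : ConvexOn ℝ (Metric.cthickening (ε / (2 * M₂)) Q) f)
    (hfM : ∀ x ∈ Metric.cthickening (ε / (2 * M₂)) Q, ∀ y ∈ Metric.cthickening (ε / (2 * M₂)) Q,
      |f y - f x| ≤ M * pNorm P.r (y - x))
    (hfM₂ : ∀ x ∈ Metric.cthickening (ε / (2 * M₂)) Q, ∀ y ∈ Metric.cthickening (ε / (2 * M₂)) Q,
      |f y - f x| ≤ M₂ * ‖y - x‖)
    {L τ : ℕ → ℝ}
    (hLτ : ∀ k, (L k = √d * M / (ε / (2 * M₂)) ∧ τ k = 0) ∨ (0 < L k ∧ τ k = M ^ 2 / L k))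
    (hL : ∀ k, L k * P.a k ^ 2 ≤ P.growth / 2 * P.A (k + 1))
    (hS : pNorm P.r (x₀ - xs) ^ 2 ≤ S) (hN : 0 < P.N)
    (hbound : P.β * S / 2 + ∑ k ∈ Finset.range P.N, (P.a k ^ 2 / (2 * P.growth)
              * (varianceConst * ρ * (d : ℝ) ^ (2 / ρ) * M₂ ^ 2 / P.B) + P.A (k + 1) * τ k)
      ≤ P.A P.N * (ε / 2)) :
    Integrable (fun e => f ((fgm P (ε / (2 * M₂)) Q x₀ e).run f)) (directionLaw d P.N P.B) ∧
      ∫ e, f ((fgm P (ε / (2 * M₂)) Q x₀ e).run f) ∂directionLaw d P.N P.B - f xs ≤ ε := by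
  have hconj : ρ.HolderConjugate P.r.toReal := by
    rw [hPr, toReal_ofReal_div_sub_one hρ]
    exact holderConjugate_div_sub_one hρ
  obtain ⟨h1, h2⟩ := P.integral_fgm_le hρ hconj hρB (div_pos hε (mul_pos two_pos hM₂)) hM hM₂ hQ
    hQc hx₀ hxs hf hfM hfM₂ hLτ hL
  refine ⟨h1, ?_⟩
  have hA : 0 < P.A P.N := by
    obtain ⟨n, hn⟩ := Nat.exists_eq_succ_of_ne_zero hN.ne'
    rw [hn]
    exact P.A_succ_pos n
  have h3 : P.β * pNorm P.r (x₀ - xs) ^ 2 / 2 ≤ P.β * S / 2 := by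
    have := P.β_pos
    gcongr
  have h4 := le_of_mul_le_mul_left (h2.trans ((add_le_add_left h3 _).trans hbound)) hA
  have h5 : ε / (2 * M₂) * M₂ = ε / 2 := by
    field_simp
  linarith

end AGMParams

theorem minQLog_two_le (d : ℕ) : minQLog 2 d ≤ 2 := by
  have := ENNReal.toReal_mono (by simp) (min_le_left (2 : ℝ≥0∞) (ENNReal.ofReal (Real.log d)))
  rwa [ENNReal.toReal_ofNat] at this

theorem minQLog_top {d : ℕ} (hd : 2 ≤ d) : minQLog ⊤ d = Real.log d := by
  rw [minQLog, min_eq_right le_top, ENNReal.toReal_ofReal]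
  exact Real.log_nonneg (by exact_mod_cast (by omega : 1 ≤ d))

/-! ### The accelerated and the robust choice of parameters -/

namespace AGMParams

/-- The constant in the complexity bounds. -/
noncomputable def complexityConst : ℝ :=
  960 + 4608 * Real.exp 1 ^ 2 * varianceConst
    + 12 * (96 * (varianceConst / 2 + 2 * Real.exp 1 ^ 2) * Real.exp 1 ^ 2 + 3 / 2)

/-- Here n is the claimed iteration count. The minimal batch of size ρ costs a multiple of κ·n calls
in total, and `hnh` keeps this within the claimed number of calls; `hκ` makes the count large enough
for rounding. -/
theorem exists_accelerated_of_le {d : ℕ} (hd : 2 ≤ d) {ρ κ m M₂ R ε h n : ℝ} (hρ : 2 ≤ ρ)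
    (hρκ : ρ ≤ 3 * κ) (hm : 0 < m) (hM₂ : 0 < M₂) (hε : 0 < ε)
    (hh : (d : ℝ) ^ (2 / ρ) ≤ Real.exp 1 ^ 2 * h)
    (hn0 : 0 ≤ n) (hn : √d * m * M₂ * R ^ 2 / ε ^ 2 ≤ n ^ 2) (hκ : κ * ε ^ 2 ≤ m * M₂ * R ^ 2)
    (hnh : n ≤ h * M₂ ^ 2 * R ^ 2 / ε ^ 2) :
    ∃ (P : AGMParams) (L τ : ℕ → ℝ), P.r = ENNReal.ofReal (ρ / (ρ - 1)) ∧ ρ ≤ P.B ∧ 0 < P.N ∧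
      (∀ k, (L k = √d * (Real.exp 1 * m) / (ε / (2 * M₂)) ∧ τ k = 0) ∨
        (0 < L k ∧ τ k = (Real.exp 1 * m) ^ 2 / L k)) ∧
      (∀ k, L k * P.a k ^ 2 ≤ P.growth / 2 * P.A (k + 1)) ∧
      P.β * (R ^ 2 / κ) / 2 + ∑ k ∈ Finset.range P.N, (P.a k ^ 2 / (2 * P.growth)
              * (varianceConst * ρ * (d : ℝ) ^ (2 / ρ) * M₂ ^ 2 / P.B) + P.A (k + 1) * τ k)
        ≤ P.A P.N * (ε / 2) ∧
      (P.N : ℝ) ≤ complexityConst * n ∧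
      (P.N : ℝ) * (P.B + P.B) ≤ complexityConst * (κ * (h * M₂ ^ 2 * R ^ 2 / ε ^ 2)) := by
  have hv := varianceConst_pos
  have hd0 : (0 : ℝ) < d := by exact_mod_cast (by omega : 0 < d)
  have hsd : 1 ≤ √(d : ℝ) := Real.one_le_sqrt.2 (by exact_mod_cast (by omega : 1 ≤ d))
  have he1 : 1 ≤ Real.exp 1 := Real.one_le_exp zero_le_one
  have he3 : Real.exp 1 ≤ 3 := by
    have := Real.exp_one_lt_d9
    linarith
  set c := Real.exp 1 with hc
  have hκ0 : 0 < κ := by linarith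
  set L := √d * (c * m) / (ε / (2 * M₂)) with hLdef
  have hL : 0 < L := by positivity
  have eL : L * R ^ 2 / ε = 2 * c * (√d * m * M₂ * R ^ 2 / ε ^ 2) := by
    rw [hLdef]
    field_simp
  have hX : 1 ≤ 192 * L * R ^ 2 / ε := by
    have h1 : κ ≤ m * M₂ * R ^ 2 / ε ^ 2 := by rwa [le_div_iff₀ (by positivity)]
    have h2 : m * M₂ * R ^ 2 / ε ^ 2 ≤ √d * (m * M₂ * R ^ 2 / ε ^ 2) :=
      le_mul_of_one_le_left (by positivity) hsd
    have h3 : √d * (m * M₂ * R ^ 2 / ε ^ 2) = √d * m * M₂ * R ^ 2 / ε ^ 2 := by ring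
    have h4 : 192 * L * R ^ 2 / ε = 192 * (L * R ^ 2 / ε) := by ring
    rw [h4, eL, ← h3]
    nlinarith
  set W := varianceConst * ρ * (d : ℝ) ^ (2 / ρ) * M₂ ^ 2 with hW
  have hW0 : 0 < W := by positivity
  obtain ⟨P, h1, h2, h3, h4, h5, h6, h7⟩ :=
    exists_accelerated (R := R) hρ hρκ hL hW0 hε hX
  have hN : (P.N : ℝ) ≤ 80 * n := by
    refine le_of_sq_le_sq (h6.trans ?_) (by positivity)
    have e : 768 * L * R ^ 2 / ε = 1536 * c * (√d * m * M₂ * R ^ 2 / ε ^ 2) := by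
      rw [show 768 * L * R ^ 2 / ε = 768 * (L * R ^ 2 / ε) by ring, eL]
      ring
    rw [e]
    calc _ ≤ 1536 * c * n ^ 2 := by gcongr
      _ ≤ 1536 * 3 * n ^ 2 := by gcongr
      _ ≤ (80 * n) ^ 2 := by nlinarith [sq_nonneg n]
  have hC : 80 ≤ complexityConst := by
    unfold complexityConst
    have : 0 ≤ 4608 * Real.exp 1 ^ 2 * varianceConst := by positivity
    have : 0 ≤ 12 * (96 * (varianceConst / 2 + 2 * Real.exp 1 ^ 2) * Real.exp 1 ^ 2 + 3 / 2) := by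
      positivity
    linarith
  refine ⟨P, fun _ => L, fun _ => 0, h1, h2, h3, fun _ => Or.inl ⟨rfl, rfl⟩, h4, ?_, ?_, ?_⟩
  · simpa only [mul_zero, add_zero] using h5
  · exact hN.trans (mul_le_mul_of_nonneg_right hC hn0)
  · set T := h * M₂ ^ 2 * R ^ 2 / ε ^ 2 with hT
    have hT0 : 0 ≤ T := hn0.trans hnh
    have a1 : 4 * ρ * P.N ≤ 960 * (κ * T) := by
      have : (P.N : ℝ) ≤ 80 * T := by linarith
      calc 4 * ρ * (P.N : ℝ) ≤ 4 * (3 * κ) * (80 * T) := by gcongr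
        _ = _ := by ring
    have a2 : 1536 * W * R ^ 2 / ε ^ 2 ≤ 4608 * c ^ 2 * varianceConst * (κ * T) := by
      calc 1536 * W * R ^ 2 / ε ^ 2
          ≤ 1536 * (varianceConst * (3 * κ) * (c ^ 2 * h) * M₂ ^ 2) * R ^ 2 / ε ^ 2 := by
            rw [hW]
            gcongr
        _ = _ := by
            rw [hT]
            ring
    have a3 : 0 ≤ 12 * (96 * (varianceConst / 2 + 2 * c ^ 2) * c ^ 2 + 3 / 2) * (κ * T) := by
      positivity
    refine h7.trans ((add_le_add a1 a2).trans ?_)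
    unfold complexityConst
    linarith

/-- About T = h·M₂²R²/ε² iterations with batches of size ρ need about κ·T calls, and `hnh` says that
T is within the claimed iteration count. The rounding term 1 is absorbed because T ≥ κ ≥ 2/3. -/
theorem exists_robust_of_le {d : ℕ} (hd : 2 ≤ d) {ρ κ m M₂ R ε h n : ℝ} (hρ : 2 ≤ ρ)
    (hρκ : ρ ≤ 3 * κ) (hm : 0 < m) (hmM₂ : m ≤ M₂) (hM₂ : 0 < M₂) (hε : 0 < ε) (hR : 0 < R)
    (hh1 : 1 ≤ h) (hh : (d : ℝ) ^ (2 / ρ) ≤ Real.exp 1 ^ 2 * h)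
    (hκ : κ * ε ^ 2 ≤ m * M₂ * R ^ 2) (hnh : h * M₂ ^ 2 * R ^ 2 / ε ^ 2 ≤ n) :
    ∃ (P : AGMParams) (L τ : ℕ → ℝ), P.r = ENNReal.ofReal (ρ / (ρ - 1)) ∧ ρ ≤ P.B ∧ 0 < P.N ∧
      (∀ k, (L k = √d * (Real.exp 1 * m) / (ε / (2 * M₂)) ∧ τ k = 0) ∨
        (0 < L k ∧ τ k = (Real.exp 1 * m) ^ 2 / L k)) ∧
      (∀ k, L k * P.a k ^ 2 ≤ P.growth / 2 * P.A (k + 1)) ∧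
      P.β * (R ^ 2 / κ) / 2 + ∑ k ∈ Finset.range P.N, (P.a k ^ 2 / (2 * P.growth)
              * (varianceConst * ρ * (d : ℝ) ^ (2 / ρ) * M₂ ^ 2 / P.B) + P.A (k + 1) * τ k)
        ≤ P.A P.N * (ε / 2) ∧
      (P.N : ℝ) ≤ complexityConst * n ∧
      (P.N : ℝ) * (P.B + P.B) ≤ complexityConst * (κ * (h * M₂ ^ 2 * R ^ 2 / ε ^ 2)) := by
  have hv := varianceConst_pos
  have hd1 : (1 : ℝ) ≤ d := by exact_mod_cast (by omega : 1 ≤ d)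
  set c := Real.exp 1 with hc
  have hκ0 : 0 < κ := by linarith
  set H := (d : ℝ) ^ (2 / ρ) with hH
  have hH1 : 1 ≤ H := Real.one_le_rpow hd1 (by positivity)
  set K := (varianceConst / 2 + 2 * c ^ 2) * H * M₂ ^ 2 with hK
  have hK0 : 0 < K := by positivity
  set W := varianceConst * ρ * H * M₂ ^ 2 with hW
  have hWK : W / ρ / 2 + 2 * (c * m) ^ 2 ≤ K := by
    have e : W / ρ / 2 = varianceConst / 2 * H * M₂ ^ 2 := by
      rw [hW]
      field_simp
    have h1 : m ^ 2 ≤ H * M₂ ^ 2 := by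
      have : m ^ 2 ≤ M₂ ^ 2 := by gcongr
      nlinarith [sq_nonneg M₂]
    have h2 : 2 * c ^ 2 * m ^ 2 ≤ 2 * c ^ 2 * (H * M₂ ^ 2) := by gcongr
    rw [e, hK]
    linarith
  obtain ⟨P, L, τ, h1, h2, h3, h4, h5, h6, h7, h8⟩ :=
    exists_robust (M := c * m) hρ hρκ hK0 (by positivity : 0 ≤ W) hWK hε hR
  set T := h * M₂ ^ 2 * R ^ 2 / ε ^ 2 with hT
  have hT1 : 1 ≤ 3 / 2 * T := by
    have a1 : κ * ε ^ 2 ≤ h * M₂ ^ 2 * R ^ 2 :=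
      calc κ * ε ^ 2 ≤ m * M₂ * R ^ 2 := hκ
        _ ≤ M₂ * M₂ * R ^ 2 := by gcongr
        _ = 1 * (M₂ ^ 2 * R ^ 2) := by ring
        _ ≤ h * (M₂ ^ 2 * R ^ 2) := by gcongr
        _ = _ := by ring
    have a2 : κ ≤ T := by rwa [hT, le_div_iff₀ (by positivity)]
    linarith
  set C₂ := 96 * (varianceConst / 2 + 2 * c ^ 2) * c ^ 2 + 3 / 2 with hC₂
  have hC₂0 : 0 ≤ C₂ := by positivity
  have hN : (P.N : ℝ) ≤ C₂ * T := by
    have a1 : 96 * K * R ^ 2 / ε ^ 2 ≤ 96 * (varianceConst / 2 + 2 * c ^ 2) * c ^ 2 * T :=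
      calc 96 * K * R ^ 2 / ε ^ 2
          ≤ 96 * ((varianceConst / 2 + 2 * c ^ 2) * (c ^ 2 * h) * M₂ ^ 2) * R ^ 2 / ε ^ 2 := by
            rw [hK]
            gcongr
        _ = _ := by
            rw [hT]
            ring
    rw [hC₂, add_mul]
    linarith
  have hT0 : 0 ≤ T := by linarith
  have hC : 12 * C₂ ≤ complexityConst := by
    unfold complexityConst
    have : 0 ≤ 4608 * Real.exp 1 ^ 2 * varianceConst := by positivity
    linarith
  refine ⟨P, L, τ, h1, h2, h3, fun k => Or.inr (h4 k), h5, h6, ?_, ?_⟩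
  · calc (P.N : ℝ) ≤ C₂ * T := hN
      _ ≤ complexityConst * n := mul_le_mul (by linarith) hnh hT0 (by linarith)
  · calc (P.N : ℝ) * (P.B + P.B) ≤ 4 * ρ * P.N := h8
      _ ≤ 4 * (3 * κ) * (C₂ * T) := by gcongr
      _ = 12 * C₂ * (κ * T) := by ring
      _ ≤ complexityConst * (κ * T) := by gcongr

theorem complexityConst_pos : 0 < complexityConst := by
  have := varianceConst_pos
  unfold complexityConst
  positivity

/-- Parameters for which the method is accurate and both complexity bounds hold. -/
theorem exists_accurate {d : ℕ} {p q : ℝ≥0∞} {M M₂ R ε : ℝ} (hd : 2 ≤ d) (hp : 1 ≤ p)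
    (hp2 : p ≤ 2) (hpq : 1 / p + 1 / q = 1) (hM : 0 < M) (hM₂ : 0 < M₂) (hR : 0 ≤ R)
    (hε : 0 < ε) :
    ∃ P : AGMParams,
      (∀ (Q : Set (Vec d)) (f : Vec d → ℝ) (x₀ xs : Vec d),
        IsClosed Q → Convex ℝ Q → x₀ ∈ Q →
        ConvexOn ℝ (Metric.cthickening (ε / (2 * M₂)) Q) f →
        (∀ x ∈ Metric.cthickening (ε / (2 * M₂)) Q,
          ∀ y ∈ Metric.cthickening (ε / (2 * M₂)) Q, |f y - f x| ≤ M * pNorm p (y - x)) →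
        (∀ x ∈ Metric.cthickening (ε / (2 * M₂)) Q,
          ∀ y ∈ Metric.cthickening (ε / (2 * M₂)) Q, |f y - f x| ≤ M₂ * ‖y - x‖) →
        xs ∈ Q → pNorm p (x₀ - xs) * √(minQLog q d) ≤ R →
        Integrable (fun e => f ((fgm P (ε / (2 * M₂)) Q x₀ e).run f)) (directionLaw d P.N P.B) ∧
          ∫ e, f ((fgm P (ε / (2 * M₂)) Q x₀ e).run f) ∂directionLaw d P.N P.B - f xs ≤ ε) ∧
      (P.N : ℝ) ≤ complexityConst * ((d : ℝ) ^ (1 / 4 : ℝ) * √(M * M₂) * R / ε) ∧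
      (P.N : ℝ) * (P.B + P.B) ≤ complexityConst
        * (minQLog q d * (d : ℝ) ^ (2 * (q⁻¹).toReal) * M₂ ^ 2 * R ^ 2 / ε ^ 2) := by
  have hd1 : (1 : ℝ) ≤ d := by exact_mod_cast (by omega : 1 ≤ d)
  have hd0 : (0 : ℝ) < d := by linarith
  have : NeZero d := ⟨by omega⟩
  obtain ⟨ρ, hρ, hρκ, hqρ, hdρ⟩ := exists_conjugate_exponent hd (two_le_of_conjugate hp hp2 hpq)
  set κ := minQLog q d with hκdef
  set t := (q⁻¹).toReal with ht
  have hκ0 : 0 < κ := by linarith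
  have hC := complexityConst_pos
  -- The function is Lipschitz in ‖·‖_r with constant e·m: M enters through ‖·‖_p ≤ e‖·‖_r and M₂
  -- through ‖·‖₂ ≤ ‖·‖_r. Having m ≤ M₂ is needed when M is much larger than M₂.
  set m := min M M₂ with hmdef
  have hm : 0 < m := lt_min hM hM₂
  have hmM₂ : m ≤ M₂ := min_le_right _ _
  by_cases hbig : κ * ε ^ 2 ≤ m * M₂ * R ^ 2
  · have hR0 : 0 < R := by
      refine hR.lt_of_ne' fun h0 => ?_
      have : 0 < κ * ε ^ 2 := by positivity
      rw [h0] at hbig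
      linarith
    set n := (d : ℝ) ^ (1 / 4 : ℝ) * √(M * M₂) * R / ε with hn
    have hn0 : 0 ≤ n := by positivity
    have hn2 : √d * m * M₂ * R ^ 2 / ε ^ 2 ≤ n ^ 2 := by
      have e1 : ((d : ℝ) ^ (1 / 4 : ℝ)) ^ 2 = √d := by
        rw [← Real.rpow_mul_natCast hd0.le, Real.sqrt_eq_rpow]
        norm_num
      have e2 : n ^ 2 = √d * (M * M₂) * R ^ 2 / ε ^ 2 := by
        rw [hn, div_pow, mul_pow, mul_pow, e1, Real.sq_sqrt (by positivity)]
      have : m ≤ M := min_le_left _ _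
      rw [e2, mul_assoc (√(d : ℝ))]
      gcongr
    have hh := rpow_two_div_le hd hdρ
    set h := (d : ℝ) ^ (2 * t) with hhdef
    have hh1 : 1 ≤ h := Real.one_le_rpow hd1 (mul_nonneg zero_le_two ENNReal.toReal_nonneg)
    obtain ⟨P, L, τ, h1, h2, h3, h4, h5, h6, h7, h8⟩ :
        ∃ (P : AGMParams) (L τ : ℕ → ℝ), P.r = ENNReal.ofReal (ρ / (ρ - 1)) ∧ ρ ≤ P.B ∧
          0 < P.N ∧
          (∀ k, (L k = √d * (Real.exp 1 * m) / (ε / (2 * M₂)) ∧ τ k = 0) ∨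
            (0 < L k ∧ τ k = (Real.exp 1 * m) ^ 2 / L k)) ∧
          (∀ k, L k * P.a k ^ 2 ≤ P.growth / 2 * P.A (k + 1)) ∧
          P.β * (R ^ 2 / κ) / 2 + ∑ k ∈ Finset.range P.N, (P.a k ^ 2 / (2 * P.growth)
                  * (varianceConst * ρ * (d : ℝ) ^ (2 / ρ) * M₂ ^ 2 / P.B) + P.A (k + 1) * τ k)
            ≤ P.A P.N * (ε / 2) ∧
          (P.N : ℝ) ≤ complexityConst * n ∧
          (P.N : ℝ) * (P.B + P.B) ≤ complexityConst * (κ * (h * M₂ ^ 2 * R ^ 2 / ε ^ 2)) := by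
      rcases le_total n (h * M₂ ^ 2 * R ^ 2 / ε ^ 2) with hle | hle
      · exact exists_accelerated_of_le hd hρ hρκ hm hM₂ hε hh hn0 hn2 hbig hle
      · exact exists_robust_of_le hd hρ hρκ hm hmM₂ hM₂ hε hR0 hh1 hh hbig hle
    refine ⟨P, ?_, h7, h8.trans (le_of_eq (by ring))⟩
    intro Q f x₀ xs hQ hQc hx₀ hf hfM hfM₂ hxs hdist
    have hpr : p ≤ P.r := h1 ▸ le_ofReal_div_sub_one hp hp2 hpq hρ hqρ
    refine P.integral_fgm_sub_le hρ h1 h2 hε (by positivity) hM₂ hQ hQc hx₀ hxs hf ?_ hfM₂ h4 h5 ?_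
      h3 h6
    · intro x hx y hy
      have a1 := pNorm_le_exp_one_mul hp hp2 hpq hρ hqρ hdρ (y - x)
      rw [← h1] at a1
      have a2 := P.norm_le_pNorm_r (y - x)
      have a3 : 0 ≤ pNorm P.r (y - x) := pNorm_nonneg P.one_lt_r.le _
      have a4 : pNorm P.r (y - x) ≤ Real.exp 1 * pNorm P.r (y - x) :=
        le_mul_of_one_le_left a3 (Real.one_le_exp zero_le_one)
      rcases min_cases M M₂ with ⟨hm', _⟩ | ⟨hm', _⟩
      · rw [hmdef, hm', mul_comm (Real.exp 1), mul_assoc]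
        exact (hfM x hx y hy).trans (mul_le_mul_of_nonneg_left a1 hM.le)
      · rw [hmdef, hm', mul_comm (Real.exp 1), mul_assoc]
        exact (hfM₂ x hx y hy).trans (mul_le_mul_of_nonneg_left (a2.trans a4) hM₂.le)
    · have a1 := pNorm_antitone hp hpr P.r_ne_top (x₀ - xs)
      have a2 : 0 ≤ pNorm P.r (x₀ - xs) := pNorm_nonneg P.one_lt_r.le _
      have a3 : pNorm P.r (x₀ - xs) * √κ ≤ R :=
        (mul_le_mul_of_nonneg_right a1 (Real.sqrt_nonneg _)).trans hdist
      rw [le_div_iff₀ hκ0, ← Real.sq_sqrt hκ0.le, ← mul_pow]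
      gcongr
  -- Zero iterations: f(x⁰) - f(x_*) ≤ m‖x⁰ - x_*‖_p, and κ times its square is at most m·M₂·R² <
  -- κε².
  · push Not at hbig
    refine ⟨ofGrowth 0 1 (fun _ => 1) 2 1 one_pos (fun _ => one_pos) le_rfl one_pos, ?_, ?_, ?_⟩
    · intro Q f x₀ xs hQ hQc hx₀ hf hfM hfM₂ hxs hdist
      set P := ofGrowth 0 1 (fun _ => 1) 2 1 one_pos (fun _ => one_pos) le_rfl one_pos with hP
      have hprob : IsProbabilityMeasure (directionLaw d P.N P.B) := by
        unfold directionLaw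
        infer_instance
      have hrun : ∀ e, (fgm P (ε / (2 * M₂)) Q x₀ e).run f = x₀ := fun e => rfl
      simp only [hrun, integral_const, probReal_univ, one_smul]
      refine ⟨integrable_const _, ?_⟩
      have b0 : 0 ≤ pNorm p (x₀ - xs) := pNorm_nonneg hp _
      have b1 := hfM xs (Metric.self_subset_cthickening Q hxs) x₀
        (Metric.self_subset_cthickening Q hx₀)
      have b2 := hfM₂ xs (Metric.self_subset_cthickening Q hxs) x₀
        (Metric.self_subset_cthickening Q hx₀)
      have b3 : ‖x₀ - xs‖ ≤ pNorm p (x₀ - xs) := by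
        rw [← pNorm_two]
        exact pNorm_antitone hp hp2 (by simp) _
      have b4 : f x₀ - f xs ≤ m * pNorm p (x₀ - xs) := by
        rw [hmdef, min_mul_of_nonneg _ _ b0]
        exact le_min ((le_abs_self _).trans b1)
          ((le_abs_self _).trans (b2.trans (mul_le_mul_of_nonneg_left b3 hM₂.le)))
      refine b4.trans (abs_le_of_sq_le_sq' ?_ hε.le).2
      have b5 : (pNorm p (x₀ - xs) * √κ) ^ 2 ≤ R ^ 2 := by gcongr
      rw [mul_pow, Real.sq_sqrt hκ0.le] at b5
      refine le_of_mul_le_mul_left ?_ hκ0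
      calc κ * (m * pNorm p (x₀ - xs)) ^ 2 = m * m * (pNorm p (x₀ - xs) ^ 2 * κ) := by ring
        _ ≤ m * M₂ * R ^ 2 := by gcongr
        _ ≤ κ * ε ^ 2 := hbig.le
    · simp only [ofGrowth, Nat.cast_zero]
      positivity
    · simp only [ofGrowth, Nat.cast_zero, zero_mul]
      positivity

end AGMParams

/-! ### The main theorem -/

theorem theorem3 :
    ∃ C : ℝ, 0 < C ∧
      ∀ (d : ℕ) (p q : ℝ≥0∞) (M M₂ R ε : ℝ),
        2 ≤ d → 1 ≤ p → p ≤ 2 → 1 / p + 1 / q = 1 → 0 < M → 0 < M₂ → 0 ≤ R → 0 < ε →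
        ∃ P : AGMParams,
          ∀ (Q : Set (Vec d)) (f : Vec d → ℝ) (x₀ xstar : Vec d),
            IsClosed Q → Convex ℝ Q → x₀ ∈ Q →
            ConvexOn ℝ (Metric.cthickening (ε / (2 * M₂)) Q) f →
            (∀ x ∈ Metric.cthickening (ε / (2 * M₂)) Q,
              ∀ y ∈ Metric.cthickening (ε / (2 * M₂)) Q, |f y - f x| ≤ M * pNorm p (y - x)) →
            (∀ x ∈ Metric.cthickening (ε / (2 * M₂)) Q,
              ∀ y ∈ Metric.cthickening (ε / (2 * M₂)) Q, |f y - f x| ≤ M₂ * ‖y - x‖) →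
            xstar ∈ Q → IsMinOn f Q xstar →
            pNorm p (x₀ - xstar) * √(minQLog q d) ≤ R →
            -- the output is an `ε`-solution in expectation
            Integrable (fun e => f ((fgm P (ε / (2 * M₂)) Q x₀ e).run f))
                (directionLaw d P.N P.B) ∧
              ∫ e, f ((fgm P (ε / (2 * M₂)) Q x₀ e).run f) ∂(directionLaw d P.N P.B)
                - f xstar ≤ ε ∧
              ∀ e : Fin P.N → Fin P.B → UnitSphere d,
                -- successive iterations
                ((fgm P (ε / (2 * M₂)) Q x₀ e).iterations f : ℝ)
                    ≤ C * ((d : ℝ) ^ (1 / 4 : ℝ) * √(M * M₂) * R / ε) ∧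
                -- zeroth-order oracle calls
                ((fgm P (ε / (2 * M₂)) Q x₀ e).oracleCalls f : ℝ)
                    ≤ C * (minQLog q d * (d : ℝ) ^ (2 * (q⁻¹).toReal) * M₂ ^ 2 * R ^ 2 / ε ^ 2) ∧
                (p = 2 → ((fgm P (ε / (2 * M₂)) Q x₀ e).oracleCalls f : ℝ)
                    ≤ C * (d * M₂ ^ 2 * R ^ 2 / ε ^ 2)) ∧
                (p = 1 → ((fgm P (ε / (2 * M₂)) Q x₀ e).oracleCalls f : ℝ)
                    ≤ C * (Real.log d * M₂ ^ 2 * R ^ 2 / ε ^ 2)) := by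
  have hC := AGMParams.complexityConst_pos
  -- The factor two is for p = 2, where min {q, ln d} ≤ 2 is absorbed into the constant.
  refine ⟨2 * AGMParams.complexityConst, by positivity, ?_⟩
  intro d p q M M₂ R ε hd hp hp2 hpq hM hM₂ hR hε
  obtain ⟨P, hP, hN, hNB⟩ := AGMParams.exists_accurate hd hp hp2 hpq hM hM₂ hR hε
  refine ⟨P, fun Q f x₀ xstar hQ hQc hx₀ hf hfM hfM₂ hxs _ hdist => ?_⟩
  obtain ⟨h1, h2⟩ := hP Q f x₀ xstar hQ hQc hx₀ hf hfM hfM₂ hxs hdist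
  refine ⟨h1, h2, fun e => ?_⟩
  have hit : (fgm P (ε / (2 * M₂)) Q x₀ e).iterations f = P.N :=
    P.iterations_fgmLoop P.N e 0 x₀ 0
  have hcalls : (fgm P (ε / (2 * M₂)) Q x₀ e).oracleCalls f = P.N * (P.B + P.B) :=
    P.oracleCalls_fgmLoop P.N e 0 x₀ 0
  have hdouble : ∀ {a b : ℝ}, 0 ≤ b → a ≤ AGMParams.complexityConst * b → a ≤ 2 * AGMParams.complexityConst * b :=
    fun hb h => by nlinarith
  have hκ : 0 ≤ minQLog q d := ENNReal.toReal_nonneg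
  have hadd := toReal_inv_add_toReal_inv hpq
  rw [hit, hcalls]
  push_cast
  refine ⟨hdouble (by positivity) hN, hdouble (by positivity) hNB, ?_, ?_⟩
  · rintro rfl
    have ht : (q⁻¹).toReal = 1 / 2 := by
      rw [ENNReal.toReal_ofNat] at hadd
      linarith
    have hq : q = 2 := by
      rw [← inv_inj, ← ENNReal.toReal_eq_toReal_iff' (by
        rw [Ne, ENNReal.inv_eq_top]
        rintro rfl
        simp at hpq) (by simp), ht]
      simp
    refine hNB.trans ?_
    rw [ht, hq, mul_one_div_cancel two_ne_zero, Real.rpow_one, mul_comm (2 : ℝ), mul_assoc AGMParams.complexityConst]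
    refine mul_le_mul_of_nonneg_left ?_ hC.le
    have hk := minQLog_two_le d
    calc minQLog 2 d * d * M₂ ^ 2 * R ^ 2 / ε ^ 2 ≤ 2 * d * M₂ ^ 2 * R ^ 2 / ε ^ 2 := by gcongr
      _ = _ := by ring
  · rintro rfl
    have ht : (q⁻¹).toReal = 0 := by
      rw [ENNReal.toReal_one] at hadd
      linarith
    have hq : q = ⊤ := by
      rw [ENNReal.toReal_eq_zero_iff, ENNReal.inv_eq_zero, ENNReal.inv_eq_top] at ht
      rcases ht with h | rfl
      · exact h
      · simp at hpq
    have hlog : 0 ≤ Real.log d := Real.log_nonneg (by exact_mod_cast (by omega : 1 ≤ d))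
    rw [ht, hq, minQLog_top hd, mul_zero, Real.rpow_zero, mul_one] at hNB
    exact hdouble (by positivity) hNB
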